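/- Let $n\ge 1$, let $T\subset GL_n$ be the diagonal torus, $R(T)=\mathbb{Z}[e^{\pm a_1},\dots,e^{\pm a_n}]$, $b_i=1-e^{-a_i}$ and $c(\alpha)=1-e^{\alpha}$. Let $R(T)^\Delta$ be the localization of $R(T)$ at the elements $c(a_i-a_j)$, $i\ne j$. *The centralizer family.* Let $A$ be the upper bidiagonal $n\times n$ matrix with diagonal entries $e^{-a_1},\dots,e^{-a_n}$ and with $-1$ in every position $(i,i+1)$. Let $\mathscr{Z}_{GL_n}=\{(t,Z): ZA(t)=A(t)Z\}$ with $t\in T$ and $Z$ an invertible upper triangular matrix, so that $$\mathcal{O}(\mathscr{Z}_{GL_n})=R(T)[z_{ij},z_{ii}^{-1}\mid 1\le i\le j\le n]/(ZA-AZ),\qquad Z=(z_{ij}).$$ It is an $R(T)$-Hopf algebra with the coproduct $z_{ij}\mapsto\sum_{k=i}^{j}z_{ik}\otimes z_{kj}$ and the counit $z_{ij}\mapsto\delta_{ij}$ given by matrix multiplication. *The ring $\mathbb{K}_{GL_n}$.* The extended affine Weyl group $\bigoplus_i\mathbb{Z}\varepsilon_i\rtimes S_n=\{t_\mu w\}$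 acts on $R(T)^\Delta$ through $S_n$, which permutes the $a_i$. Let $s_1,\dots,s_{n-1}$ be the simple transpositions, $s_0=t_{\varepsilon_1-\varepsilon_n}s_\theta$ with $s_\theta$ the transposition of $1$ and $n$, $\tau=t_{\varepsilon_1}s_1\cdots s_{n-1}$, $\alpha_i=a_i-a_{i+1}$ for $1\le i\le n-1$, and $\alpha_0=a_n-a_1$. In the smash product of $R(T)^\Delta$ with the group ring of the extended affine Weyl group put $T_i=c(\alpha_i)^{-1}(s_i-1)$ for $0\le i\le n-1$ (for $n=1$ put $T_0=0$). Then $\mathbb{K}_{GL_n}$ is the subring generated by $R(T)$, the $T_i$ and $\tau^{\pm1}$. *The ring $\hat\Lambda_{(n)}$.* For a commutative ring $S$ let $\hat\Lambda_S$ be the ring of symmetric formal power series in $y_1,y_2,\dots$ with coefficients in $S$ (the completed ring of symmetric functions). Let $h_l$ be the complete homogeneous symmetric functions and $$\Omega(b|y)=\prod_{j}(1-by_j)^{-1},\qquad \hat h_m(y|t_1,\dots,t_r)=\sum_{l\ge0}h_l(t_1,\dots,t_r)\,h_{m+l}(y).$$ The smash product acts on $\hat\Lambda_{R(T)^\Delta}$: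 $R(T)^\Delta$ acts by scalars, $S_n$ acts on the coefficients, and $t_{\varepsilon_i}$ acts as multiplication by $\Omega(b_i|y)$. Put $\hat\Lambda_{(n)}=\mathbb{K}_{GL_n}\cdot 1$; this is an $R(T)$-subalgebra. Put $g^{(k)}_{\rho_l}(y|b)=T_{l-1}\cdots T_1T_0(1)$ for $0\le l\le n-1$ (so $g^{(k)}_{\rho_0}=1$), and let $g^{(k)}_{\rho_l}(y|\omega^ib)$ be obtained from it by applying $i$ times the cyclic permutation $\omega\colon a_j\mapsto a_{j+1}$ (indices modulo $n$) to the coefficients. *The action on $\mathcal{O}(\mathscr{Z}_{GL_n})$.* Consider $\mathbb{K}_{GL_n}$-module structures on $\mathcal{O}(\mathscr{Z}_{GL_n})$ such that $R(T)$ acts by multiplication, $t_{\varepsilon_i}$ acts as multiplication by $z_{ii}$, and $s_i$ ($1\le i\le n-1$) acts as a ring automorphism with $$s_i(z_{ii})=z_{i+1,i+1},\qquad s_i(z_{i+1,i+1})=z_{ii},\qquad s_i(z_{ji})=z_{ji}+(b_{i+1}-b_i)z_{j,i+1}\ (j<i),$$ $$s_i(z_{i+1,l})=z_{i+1,l}-(b_{i+1}-b_i)z_{il}\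 (l>i+1),\qquad s_i(z_{jl})=z_{jl}\ (j\le l,\ l\ne i,\ j\ne i+1).$$ **Theorem.** There is exactly one such $\mathbb{K}_{GL_n}$-module structure on $\mathcal{O}(\mathscr{Z}_{GL_n})$. All elements of $\hat\Lambda_{(n)}$ have their coefficients in $R(T)$. There is an isomorphism of $R(T)$-algebras $$\beta\colon\mathcal{O}(\mathscr{Z}_{GL_n})\xrightarrow{\ \cong\ }\hat\Lambda_{(n)},\qquad z_{ij}\mapsto \hat h_{j-i}(y|b_i,\dots,b_j)\quad(1\le i\le j\le n),$$ it is also an isomorphism of $\mathbb{K}_{GL_n}$-modules, and $$\hat h_{j-i}(y|b_i,\dots,b_j)=e^{a_i+\cdots+a_{j-1}}\,\Omega(b_i|y)\,g^{(k)}_{\rho_{j-i}}(y|\omega^ib).$$ In particular $z_{ii}$ is sent to $\Omega(b_i|y)$. Moreover $\beta$ is an isomorphism of Hopf algebras over $R(T)$: the natural map $f\otimes g\mapsto f(y)g(y')$ embeds $\hat\Lambda_{(n)}\otimes_{R(T)}\hat\Lambda_{(n)}$ into the power series in two sets of variables $y,y'$, and under $\beta$ the coproduct of $\mathcal{O}(\mathscr{Z}_{GL_n})$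 corresponds to $f(y)\mapsto f(y,y')$ and the counit to $f\mapsto f(0)$. -/

import Mathlib

namespace CentralizerFamily

open scoped TensorProduct

noncomputable section

/-! ### The representation ring of the diagonal torus

Indices `1, …, n` of the torus are the elements `0, …, n - 1` of `Fin n`. -/

/-- `R(T) = ℤ[X]`, the group ring of the character lattice `X = ℤ a₁ ⊕ … ⊕ ℤ aₙ` of the
diagonal torus of `GL_n`. -/
abbrev RT (n : ℕ) : Type := AddMonoidAlgebra ℤ (Fin n → ℤ)

/-- The element `e^λ` of `R(T)`. -/
def ex {n : ℕ} (lam : Fin n → ℤ) : RT n := AddMonoidAlgebra.single lam 1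

/-- The basis element `a_i` of the character lattice. -/
def aa {n : ℕ} (i : Fin n) : Fin n → ℤ := Pi.single i 1

/-- `b_i = 1 - e^{-a_i}`. -/
def bb {n : ℕ} (i : Fin n) : RT n := 1 - ex (-aa i)

/-- `c(α) = 1 - e^α`. -/
def cc {n : ℕ} (alpha : Fin n → ℤ) : RT n := 1 - ex alpha

/-- The action of a permutation on `ℤⁿ`, which sends the `i`-th basis vector to the `σ i`-th. -/
def latPerm (n : ℕ) (σ : Equiv.Perm (Fin n)) : (Fin n → ℤ) ≃+ (Fin n → ℤ) where
  toFun lam := fun i => lam (σ⁻¹ i)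
  invFun lam := fun i => lam (σ i)
  left_inv lam := by ext i; simp
  right_inv lam := by ext i; simp
  map_add' _ _ := rfl

/-- The action of a permutation on `R(T)`, `e^λ ↦ e^{σ λ}`. -/
def permRT (n : ℕ) (σ : Equiv.Perm (Fin n)) : RT n →+* RT n :=
  AddMonoidAlgebra.mapDomainRingHom ℤ (latPerm n σ).toAddMonoidHom

lemma permRT_ex (n : ℕ) (σ : Equiv.Perm (Fin n)) (lam : Fin n → ℤ) :
    permRT n σ (ex lam) = ex (latPerm n σ lam) := by
  simp [permRT, ex]

instance permActionRT (n : ℕ) : MulSemiringAction (Equiv.Perm (Fin n)) (RT n) where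
  smul σ r := permRT n σ r
  one_smul r := by
    change permRT n 1 r = r
    have : (latPerm n 1).toAddMonoidHom = AddMonoidHom.id _ := by ext; simp [latPerm]
    rw [permRT, this]; simp
  mul_smul σ σ' r := by
    change permRT n (σ * σ') r = permRT n σ (permRT n σ' r)
    have : (latPerm n (σ * σ')).toAddMonoidHom =
        (latPerm n σ).toAddMonoidHom.comp (latPerm n σ').toAddMonoidHom := by
      ext; simp [latPerm]
    simp only [permRT]
    rw [this, AddMonoidAlgebra.mapDomainRingHom_comp]; rfl
  smul_zero σ := map_zero (permRT n σ)
  smul_add σ := map_add (permRT n σ)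
  smul_one σ := map_one (permRT n σ)
  smul_mul σ := map_mul (permRT n σ)

lemma perm_smul_ex {n : ℕ} (σ : Equiv.Perm (Fin n)) (lam : Fin n → ℤ) :
    σ • (ex lam : RT n) = ex (latPerm n σ lam) := permRT_ex n σ lam

lemma latPerm_aa {n : ℕ} (σ : Equiv.Perm (Fin n)) (i : Fin n) :
    latPerm n σ (aa i) = aa (σ i) := by
  ext j
  simp only [latPerm, aa, AddEquiv.coe_mk, Equiv.coe_fn_mk, Pi.single_apply]
  congr 1
  rw [Equiv.Perm.inv_eq_iff_eq, eq_comm (a := j)]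

/-- The multiplicative set generated by the `c(α)`, where `α` runs over the roots
`a_i - a_j`, `i ≠ j`. -/
def rootSet (n : ℕ) : Submonoid (RT n) :=
  Submonoid.closure {r | ∃ i j : Fin n, i ≠ j ∧ r = cc (aa i - aa j)}

/-- The localization `R(T)^Δ` of `R(T)` at the elements `c(α)`, `α` a root. -/
def RD (n : ℕ) : Type := Localization (rootSet n)

instance commRingRD (n : ℕ) : CommRing (RD n) := inferInstanceAs (CommRing (Localization _))

instance algebraRD (n : ℕ) : Algebra (RT n) (RD n) :=
  inferInstanceAs (Algebra (RT n) (Localization (rootSet n)))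

instance isLocalizationRD (n : ℕ) : IsLocalization (rootSet n) (RD n) :=
  inferInstanceAs (IsLocalization (rootSet n) (Localization (rootSet n)))

lemma perm_smul_cc {n : ℕ} (σ : Equiv.Perm (Fin n)) (i j : Fin n) :
    σ • (cc (aa i - aa j) : RT n) = cc (aa (σ i) - aa (σ j)) := by
  simp only [cc, smul_sub, smul_one, perm_smul_ex, map_sub, latPerm_aa]

lemma rootSet_le_comap (n : ℕ) (σ : Equiv.Perm (Fin n)) :
    rootSet n ≤ (rootSet n).comap (permRT n σ) := by
  refine Submonoid.closure_le.2 ?_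
  rintro _ ⟨i, j, hij, rfl⟩
  refine Submonoid.subset_closure ⟨σ i, σ j, fun h => hij (σ.injective h), ?_⟩
  exact perm_smul_cc σ i j

/-- The action of a permutation on `R(T)^Δ`. -/
def permRD (n : ℕ) (σ : Equiv.Perm (Fin n)) : RD n →+* RD n :=
  IsLocalization.map (RD n) (permRT n σ) (rootSet_le_comap n σ)

lemma permRD_algebraMap (n : ℕ) (σ : Equiv.Perm (Fin n)) (r : RT n) :
    permRD n σ (algebraMap (RT n) (RD n) r) = algebraMap (RT n) (RD n) (σ • r) :=
  IsLocalization.map_eq _ _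

instance permActionRD (n : ℕ) : MulSemiringAction (Equiv.Perm (Fin n)) (RD n) where
  smul σ r := permRD n σ r
  one_smul r := by
    have : permRD n 1 = RingHom.id _ := by
      refine IsLocalization.ringHom_ext (rootSet n) (RingHom.ext fun r => ?_)
      simp [permRD_algebraMap]
    exact congrArg (fun f => f r) this
  mul_smul σ σ' r := by
    have : permRD n (σ * σ') = (permRD n σ).comp (permRD n σ') := by
      refine IsLocalization.ringHom_ext (rootSet n) (RingHom.ext fun r => ?_)
      simp [permRD_algebraMap, mul_smul]
    exact congrArg (fun f => f r) this
  smul_zero σ := map_zero (permRD n σ)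
  smul_add σ := map_add (permRD n σ)
  smul_one σ := map_one (permRD n σ)
  smul_mul σ := map_mul (permRD n σ)

lemma perm_smul_algebraMap {n : ℕ} (σ : Equiv.Perm (Fin n)) (r : RT n) :
    σ • (algebraMap (RT n) (RD n) r) = algebraMap (RT n) (RD n) (σ • r) :=
  permRD_algebraMap n σ r

/-! ### The extended affine Weyl group and the `K`-nil-Hecke ring -/

/-- The action of `S_n` on the cocharacter lattice `X^∨ = ℤ ε₁ ⊕ … ⊕ ℤ εₙ`. -/
def coAct (n : ℕ) : Equiv.Perm (Fin n) →* MulAut (Multiplicative (Fin n → ℤ)) where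
  toFun σ := AddEquiv.toMultiplicative (latPerm n σ)
  map_one' := rfl
  map_mul' _ _ := rfl

/-- The extended affine Weyl group `X^∨ ⋊ S_n` of `GL_n`. -/
abbrev AffW (n : ℕ) : Type := Multiplicative (Fin n → ℤ) ⋊[coAct n] Equiv.Perm (Fin n)

/-- The translation element `t_μ`. -/
def tr {n : ℕ} (mu : Fin n → ℤ) : AffW n := SemidirectProduct.inl (Multiplicative.ofAdd mu)

/-- The inclusion of the finite Weyl group `S_n`. -/
def finW {n : ℕ} (σ : Equiv.Perm (Fin n)) : AffW n := SemidirectProduct.inr σ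

/-- The level zero action on `R(T)^Δ`: `t_μ σ` acts as `σ`. -/
instance affActionRD (n : ℕ) : MulSemiringAction (AffW n) (RD n) :=
  MulSemiringAction.compHom (RD n) (SemidirectProduct.rightHom : AffW n →* Equiv.Perm (Fin n))

lemma aff_smul {n : ℕ} (w : AffW n) (r : RD n) : w • r = w.right • r := rfl

/-- The smash product of `R(T)^Δ` and `ℤ[X^∨ ⋊ S_n]`, with the product
`(f ⊗ w) (g ⊗ v) = f w(g) ⊗ w v`. -/
def KD (n : ℕ) : Type := SkewMonoidAlgebra (RD n) (AffW n)

instance ringKD (n : ℕ) : Ring (KD n) :=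
  inferInstanceAs (Ring (SkewMonoidAlgebra (RD n) (AffW n)))

/-- An element of `R(T)^Δ` as an element of the smash product. -/
def coef {n : ℕ} (r : RD n) : KD n := SkewMonoidAlgebra.single 1 r

/-- An element of the extended affine Weyl group as an element of the smash product. -/
def grp {n : ℕ} (w : AffW n) : KD n := SkewMonoidAlgebra.single w 1

section
variable (n : ℕ) [NeZero n]

/-- The simple root `α_i`, `i ∈ ℤ/n`: it is `a_i - a_{i+1}` for `1 ≤ i ≤ n - 1` and
`a_n - a_1` for `i = 0` (here `a_i` has the index `i - 1` in `Fin n`). -/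
def root (i : Fin n) : Fin n → ℤ := aa (i - 1) - aa i

/-- The simple reflection `s_i`, `i ∈ ℤ/n`: for `i ≠ 0` it exchanges the torus indices `i` and
`i + 1`, and `s_0 = t_{θ^∨} s_θ` with `θ^∨ = ε_1 - ε_n` and `s_θ` the exchange of `1`
and `n`. -/
def sRefl (i : Fin n) : AffW n :=
  if i = 0 then tr (Pi.single 0 1 - Pi.single (0 - 1) 1) * finW (Equiv.swap (0 - 1) 0)
  else finW (Equiv.swap (i - 1) i)

/-- The Demazure operator `T_i = c(α_i)⁻¹ (s_i - 1)`, `i ∈ ℤ/n`. (If `n ≥ 2`, then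
`c(α_i)` is invertible in `R(T)^Δ`. If `n = 1`, there are no roots, `α_0 = 0`, and `T_0 = 0`.) -/
def TT (i : Fin n) : KD n :=
  coef (Ring.inverse (algebraMap (RT n) (RD n) (cc (root n i)))) * (grp (sRefl n i) - 1)

/-- The cyclic permutation `ω = s_1 s_2 ⋯ s_{n-1}`, `i ↦ i + 1` modulo `n`. -/
def rot : Equiv.Perm (Fin n) := Equiv.addRight 1

/-- The generator `τ = t_{ε_1} s_1 ⋯ s_{n-1}` of the fundamental group `π_1(GL_n) ≅ ℤ`. -/
def tau : AffW n := tr (Pi.single 0 1) * finW (rot n)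

/-- The affine level zero `K`-nil-Hecke ring `𝕂` of `GL_n`: the subring of the smash product that
is generated by `R(T)`, the `T_i` and the fundamental group. -/
def KK : Subring (KD n) :=
  Subring.closure (Set.range (fun r : RT n => coef (algebraMap (RT n) (RD n) r)) ∪
    Set.range (TT n) ∪ Set.range (fun m : ℤ => grp (tau n ^ m)))

end

/-! ### Symmetric power series -/

/-- The power series in `y_1, y_2, …` that are invariant under all permutations of the variables. -/
def symSub (A : Type) [CommRing A] : Subalgebra A (MvPowerSeries ℕ A) where
  carrier := {f | ∀ σ : Equiv.Perm ℕ, MvPowerSeries.rename σ f = f}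
  mul_mem' hf hg σ := by rw [map_mul, hf σ, hg σ]
  add_mem' hf hg σ := by rw [map_add, hf σ, hg σ]
  algebraMap_mem' r σ := AlgHom.commutes _ r

/-- The completed ring `Λ̂_A` of symmetric functions in `y_1, y_2, …` with coefficients in `A`: the
symmetric formal power series. (Such a series is a formal sum `f_0 + f_1 + ⋯`, where `f_d` is a
symmetric function of degree `d` with coefficients in `A`.) -/
def SymSer (A : Type) [CommRing A] : Type := symSub A

instance commRingSym (A : Type) [CommRing A] : CommRing (SymSer A) :=
  inferInstanceAs (CommRing (symSub A))

instance algebraSym (R A : Type) [CommRing R] [CommRing A] [Algebra R A] : Algebra R (SymSer A) :=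
  inferInstanceAs (Algebra R (symSub A))

instance scalarTowerSym (R A : Type) [CommRing R] [CommRing A] [Algebra R A] :
    IsScalarTower R A (SymSer A) :=
  inferInstanceAs (IsScalarTower R A (symSub A))

/-- A symmetric power series as a power series. -/
def toSeries (R : Type) {A : Type} [CommRing R] [CommRing A] [Algebra R A] :
    SymSer A →ₐ[R] MvPowerSeries ℕ A :=
  (symSub A).val.restrictScalars R

/-- The symmetric series `∑_m c_m h_m(y)`, where `h_m` is the complete homogeneous symmetric
function: each monomial of degree `m` has the coefficient `c_m`. -/
def ofDegree {A : Type} [CommRing A] (c : ℕ → A) : SymSer A :=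
  ⟨fun d => c d.degree, fun σ => by
    ext d
    obtain ⟨x, rfl⟩ : ∃ x, Finsupp.embDomain σ.toEmbedding x = d :=
      ⟨d.embDomain (σ.symm).toEmbedding, by
        simp [Finsupp.embDomain_eq_mapDomain, ← Finsupp.mapDomain_comp]⟩
    have h := MvPowerSeries.coeff_embDomain_rename (R := A) σ.toEmbedding
      (fun d => c d.degree) x
    refine Eq.trans h ?_
    change c x.degree = c (Finsupp.embDomain σ.toEmbedding x).degree
    rw [Finsupp.embDomain_eq_mapDomain]
    exact congrArg c (Finsupp.degree_mapDomain _ x).symm⟩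

/-- `Ω(b|y) = ∏_j (1 - b y_j)⁻¹ = ∑_l b^l h_l(y)`. -/
def Om {A : Type} [CommRing A] (b : A) : SymSer A := ofDegree fun l => b ^ l

/-- `ĥ_m(y|t) = ∑_l h_l(t) h_{m+l}(y)` for a finite family of parameters `t`. -/
def hhat {A : Type} [CommRing A] {ι : Type} [Fintype ι] [DecidableEq ι] (m : ℕ) (t : ι → A) :
    SymSer A :=
  ofDegree fun d => if m ≤ d then MvPolynomial.aeval t (MvPolynomial.hsymm ι A (d - m)) else 0

/-- The map `Λ̂_A → Λ̂_B` induced by a ring homomorphism of the coefficients. -/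
def mapSym {A B : Type} [CommRing A] [CommRing B] (φ : A →+* B) : SymSer A →+* SymSer B :=
  ((MvPowerSeries.map φ).comp (symSub A).val.toRingHom).codRestrict (symSub B) fun f σ =>
    (MvPowerSeries.rename_map σ φ f.1).trans (congrArg (MvPowerSeries.map φ) (f.2 σ))

lemma mapSym_ofDegree {A B : Type} [CommRing A] [CommRing B] (φ : A →+* B) (c : ℕ → A) :
    mapSym φ (ofDegree c) = ofDegree fun m => φ (c m) := rfl

lemma mapSym_Om {A B : Type} [CommRing A] [CommRing B] (φ : A →+* B) (b : A) :
    mapSym φ (Om b) = Om (φ b) := by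
  simp [Om, mapSym_ofDegree]

lemma mapSym_comp {A B C : Type} [CommRing A] [CommRing B] [CommRing C] (φ : A →+* B)
    (ψ : B →+* C) (f : SymSer A) : mapSym ψ (mapSym φ f) = mapSym (ψ.comp φ) f := rfl

lemma mapSym_smul {A B : Type} [CommRing A] [CommRing B] (φ : A →+* B) (r : A) (f : SymSer A) :
    mapSym φ (r • f) = φ r • mapSym φ f := by
  rw [Algebra.smul_def, Algebra.smul_def, map_mul]
  congr 1
  refine Subtype.ext ?_
  exact MvPowerSeries.map_C φ r

lemma isUnit_Om {A : Type} [CommRing A] (b : A) : IsUnit (Om b) := by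
  set F : MvPowerSeries ℕ A := toSeries A (Om b) with hF
  have h : IsUnit F := by
    rw [MvPowerSeries.isUnit_iff_constantCoeff]
    have : MvPowerSeries.constantCoeff F = b ^ 0 := by
      rw [← MvPowerSeries.coeff_zero_eq_constantCoeff_apply]
      rfl
    simp [this]
  obtain ⟨v, hv⟩ := h.exists_right_inv
  have hv' : v ∈ symSub A := fun σ => by
    have h1 : F * MvPowerSeries.rename σ v = 1 := by
      have := congrArg (MvPowerSeries.rename (R := A) σ) hv
      rwa [map_mul, show MvPowerSeries.rename σ F = F from (Om b).2 σ, map_one] at this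
    exact h.mul_left_cancel (h1.trans hv.symm)
  exact IsUnit.of_mul_eq_one ⟨v, hv'⟩ (Subtype.ext hv)

/-- `Ω(b|y)` as a unit. -/
def OmU {A : Type} [CommRing A] (b : A) : (SymSer A)ˣ := (isUnit_Om b).unit

lemma mapSym_OmU {A B : Type} [CommRing A] [CommRing B] (φ : A →+* B) (b : A) :
    Units.map (mapSym φ).toMonoidHom (OmU b) = OmU (φ b) := by
  ext1
  exact mapSym_Om φ b

/-! ### The action of the `K`-nil-Hecke ring on symmetric series -/

/-- `b_i` in `R(T)^Δ`. -/
def bD {n : ℕ} (i : Fin n) : RD n := algebraMap (RT n) (RD n) (bb i)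

lemma permRD_bD {n : ℕ} (σ : Equiv.Perm (Fin n)) (i : Fin n) :
    permRD n σ (bD i) = bD (σ i) := by
  rw [bD, permRD_algebraMap, bD]
  simp only [bb, smul_sub, smul_one, perm_smul_ex, map_neg, latPerm_aa]

/-- `Ω^μ = ∏_i Ω(b_i|y)^{μ_i}` for a cocharacter `μ`. -/
def OmPow {n : ℕ} (mu : Fin n → ℤ) : (SymSer (RD n))ˣ := ∏ i, OmU (bD i) ^ mu i

lemma OmPow_add {n : ℕ} (mu nu : Fin n → ℤ) : OmPow (mu + nu) = OmPow mu * OmPow nu := by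
  simp [OmPow, zpow_add, Finset.prod_mul_distrib]

lemma mapSym_OmPow {n : ℕ} (σ : Equiv.Perm (Fin n)) (mu : Fin n → ℤ) :
    mapSym (permRD n σ) (OmPow mu : (SymSer (RD n))ˣ) = (OmPow (latPerm n σ mu) : (SymSer (RD n))ˣ) := by
  have : Units.map (mapSym (permRD n σ)).toMonoidHom (OmPow mu) = OmPow (latPerm n σ mu) := by
    rw [OmPow, map_prod, OmPow,
      ← Equiv.prod_comp σ (fun i => OmU (bD i) ^ latPerm n σ mu i)]
    refine Finset.prod_congr rfl fun i _ => ?_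
    rw [map_zpow, mapSym_OmU, permRD_bD]
    simp [latPerm]
  exact congrArg Units.val this

/-- The action of the extended affine Weyl group: `σ ∈ S_n` acts on the coefficients, and `t_{ε_i}`
acts as the multiplication by `Ω(b_i|y)`. -/
def affSym (n : ℕ) : AffW n →* AddMonoid.End (SymSer (RD n)) where
  toFun w := (AddMonoidHom.mulLeft ((OmPow (Multiplicative.toAdd w.left) : (SymSer (RD n))ˣ) :
    SymSer (RD n))).comp (mapSym (permRD n w.right)).toAddMonoidHom
  map_one' := by
    refine AddMonoidHom.ext fun f => ?_
    have h : permRD n 1 = RingHom.id _ := RingHom.ext fun r => one_smul (Equiv.Perm (Fin n)) r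
    change ((OmPow (0 : Fin n → ℤ) : (SymSer (RD n))ˣ) : SymSer (RD n)) * mapSym (permRD n 1) f = f
    rw [h]
    have : (OmPow (0 : Fin n → ℤ)) = 1 := by simp [OmPow]
    rw [this, Units.val_one, one_mul]
    refine Subtype.ext ?_
    ext d
    rfl
  map_mul' w v := by
    refine AddMonoidHom.ext fun f => ?_
    have h : permRD n (w.right * v.right) = (permRD n w.right).comp (permRD n v.right) :=
      RingHom.ext fun r => mul_smul w.right v.right r
    change ((OmPow (Multiplicative.toAdd w.left + latPerm n w.right (Multiplicative.toAdd v.left)) :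
      (SymSer (RD n))ˣ) : SymSer (RD n)) * mapSym (permRD n (w.right * v.right)) f =
      (OmPow (Multiplicative.toAdd w.left) : (SymSer (RD n))ˣ) * mapSym (permRD n w.right)
        ((OmPow (Multiplicative.toAdd v.left) : (SymSer (RD n))ˣ) * mapSym (permRD n v.right) f)
    rw [h, OmPow_add, map_mul, mapSym_OmPow, mapSym_comp, Units.val_mul, mul_assoc]

/-- The action of the smash product on `Λ̂` with coefficients in `R(T)^Δ`. -/
def actSym (n : ℕ) : KD n →+* AddMonoid.End (SymSer (RD n)) :=
  SkewMonoidAlgebra.liftNCRingHom (Module.toAddMonoidEnd (RD n) (SymSer (RD n))) (affSym n) (by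
    intro r w
    refine AddMonoidHom.ext fun f => ?_
    change (w • r) • (_ * mapSym (permRD n w.right) f) = _ * mapSym (permRD n w.right) (r • f)
    rw [mapSym_smul, mul_smul_comm]
    rfl)

instance moduleSym (n : ℕ) : Module (KD n) (SymSer (RD n)) := Module.compHom _ (actSym n)

lemma coef_smul {n : ℕ} (r : RD n) (f : SymSer (RD n)) : coef r • f = r • f := by
  have h := SkewMonoidAlgebra.liftNC_single
    (Module.toAddMonoidEnd (RD n) (SymSer (RD n)) : RD n →+ _) (affSym n) 1 r
  rw [map_one, mul_one] at h
  exact congrArg (fun F => F f) h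

lemma grp_smul {n : ℕ} (w : AffW n) (f : SymSer (RD n)) :
    grp w • f = (OmPow (Multiplicative.toAdd w.left) : (SymSer (RD n))ˣ) *
      mapSym (permRD n w.right) f := by
  have h := SkewMonoidAlgebra.liftNC_single
    (Module.toAddMonoidEnd (RD n) (SymSer (RD n)) : RD n →+ _) (affSym n) w 1
  rw [AddMonoidHom.coe_coe, map_one, one_mul] at h
  exact congrArg (fun F => F f) h

/-! ### Membership in the `K`-nil-Hecke ring -/

lemma grp_mul {n : ℕ} (w v : AffW n) : (grp w * grp v : KD n) = grp (w * v) := by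
  refine (SkewMonoidAlgebra.single_mul_single (k := RD n) (G := AffW n)).trans ?_
  simp [grp]

lemma grp_one {n : ℕ} : (grp 1 : KD n) = 1 := rfl

lemma coef_mul {n : ℕ} (r s : RD n) : (coef r * coef s : KD n) = coef (r * s) := by
  refine (SkewMonoidAlgebra.single_mul_single (k := RD n) (G := AffW n)).trans ?_
  simp [coef]

lemma coef_one {n : ℕ} : (coef 1 : KD n) = 1 := rfl

lemma coef_zero {n : ℕ} : (coef 0 : KD n) = 0 :=
  SkewMonoidAlgebra.single_zero 1

lemma grp_coef {n : ℕ} (w : AffW n) (r : RD n) :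
    (grp w * coef r : KD n) = coef (w • r) * grp w := by
  refine (SkewMonoidAlgebra.single_mul_single (k := RD n) (G := AffW n)).trans ?_
  refine Eq.trans ?_ (SkewMonoidAlgebra.single_mul_single (k := RD n) (G := AffW n)).symm
  simp

lemma finW_mul {n : ℕ} (σ σ' : Equiv.Perm (Fin n)) : finW (σ * σ') = finW σ * finW σ' :=
  map_mul _ _ _

lemma finW_smul {n : ℕ} (σ : Equiv.Perm (Fin n)) (r : RD n) : finW σ • r = σ • r := rfl

lemma finW_tr {n : ℕ} (σ : Equiv.Perm (Fin n)) (mu : Fin n → ℤ) :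
    finW σ * tr mu = tr (latPerm n σ mu) * finW σ := by
  refine SemidirectProduct.ext ?_ ?_
  · change (1 : Multiplicative (Fin n → ℤ)) * _ = _ * 1
    rw [one_mul, mul_one]
    rfl
  · change σ * 1 = 1 * σ
    simp

lemma isUnit_cc {n : ℕ} {i j : Fin n} (h : i ≠ j) :
    IsUnit (algebraMap (RT n) (RD n) (cc (aa i - aa j))) :=
  IsLocalization.map_units (RD n)
    (⟨_, Submonoid.subset_closure ⟨i, j, h, rfl⟩⟩ : rootSet n)

section
variable (n : ℕ) [NeZero n]

lemma coef_mem (r : RT n) : coef (algebraMap (RT n) (RD n) r) ∈ KK n :=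
  Subring.subset_closure (Or.inl (Or.inl ⟨r, rfl⟩))

lemma TT_mem (i : Fin n) : TT n i ∈ KK n :=
  Subring.subset_closure (Or.inl (Or.inr ⟨i, rfl⟩))

lemma tau_zpow_mem (m : ℤ) : grp (tau n ^ m) ∈ KK n :=
  Subring.subset_closure (Or.inr ⟨m, rfl⟩)

lemma sRefl_mem (i : Fin n) (h : i - 1 ≠ i) : grp (sRefl n i) ∈ KK n := by
  have h1 : (grp (sRefl n i) : KD n) =
      coef (algebraMap (RT n) (RD n) (cc (root n i))) * TT n i + 1 := by
    have hu : IsUnit (algebraMap (RT n) (RD n) (cc (root n i))) := isUnit_cc h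
    rw [TT, ← mul_assoc, coef_mul, Ring.mul_inverse_cancel _ hu, coef_one, one_mul]
    abel
  rw [h1]
  exact add_mem (mul_mem (coef_mem n _) (TT_mem n i)) (one_mem _)

lemma swap_mem (i : Fin n) (hi : i ≠ 0) : grp (finW (Equiv.swap (i - 1) i)) ∈ KK n := by
  have h : i - 1 ≠ i := by
    intro h
    have h1 : (1 : Fin n) = 0 := by simpa using h
    obtain _ | _ | n := n
    · exact i.elim0
    · exact hi (Fin.ext (by omega))
    · simp at h1
  have := sRefl_mem n i h
  rwa [sRefl, if_neg hi] at this

lemma finW_mem (σ : Equiv.Perm (Fin n)) : grp (finW σ) ∈ KK n := by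
  obtain _ | n := n
  · exact absurd rfl (NeZero.ne 0)
  have : σ ∈ Submonoid.closure (Set.range fun i : Fin n ↦ Equiv.swap i.castSucc i.succ) := by
    rw [Equiv.Perm.mclosure_swap_castSucc_succ]; trivial
  induction this using Submonoid.closure_induction with
  | mem x hx =>
    obtain ⟨i, rfl⟩ := hx
    have h := swap_mem (n + 1) i.succ (Fin.succ_ne_zero i)
    have h2 : i.succ - 1 = i.castSucc := by
      rw [sub_eq_iff_eq_add, Fin.coeSucc_eq_succ]
    rwa [h2] at h
  | one => exact one_mem _
  | mul x y _ _ hx hy => rw [finW_mul, ← grp_mul]; exact mul_mem hx hy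

lemma tr_single_mem (i : Fin n) : grp (tr (Pi.single i 1)) ∈ KK n ∧
    grp (tr (-Pi.single i 1)) ∈ KK n := by
  have h0 : (tr (Pi.single 0 1) : AffW n) = tau n * finW (rot n)⁻¹ := by
    rw [tau, mul_assoc, ← finW_mul, mul_inv_cancel]
    exact (mul_one _).symm
  have hp : latPerm n (Equiv.swap 0 i) (Pi.single 0 1) = Pi.single i 1 := by
    simpa [aa] using latPerm_aa (Equiv.swap 0 i) 0
  have key (mu : Fin n → ℤ) (h : grp (tr mu) ∈ KK n) :
      grp (tr (latPerm n (Equiv.swap 0 i) mu)) ∈ KK n := by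
    have h1 : (tr (latPerm n (Equiv.swap 0 i) mu) : AffW n) =
        finW (Equiv.swap 0 i) * tr mu * finW (Equiv.swap 0 i)⁻¹ := by
      rw [finW_tr, mul_assoc, ← finW_mul, mul_inv_cancel]
      exact (mul_one _).symm
    rw [h1, ← grp_mul, ← grp_mul]
    exact mul_mem (mul_mem (finW_mem n _) h) (finW_mem n _)
  constructor
  · rw [← hp]
    refine key _ ?_
    rw [h0, ← grp_mul]
    refine mul_mem ?_ (finW_mem n _)
    simpa using tau_zpow_mem n 1
  · rw [← hp, ← map_neg]
    refine key _ ?_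
    have h1 : (tr (-Pi.single 0 1) : AffW n) = finW (rot n) * (tau n) ^ (-1 : ℤ) := by
      have : (tr (-Pi.single 0 1) : AffW n) = (tr (Pi.single 0 1))⁻¹ := map_inv _ _
      rw [this, h0, mul_inv_rev, zpow_neg_one]
      congr 1
    rw [h1, ← grp_mul]
    exact mul_mem (finW_mem n _) (tau_zpow_mem n _)

lemma tr_mem (mu : Fin n → ℤ) : grp (tr mu) ∈ KK n := by
  have hz (i : Fin n) (m : ℤ) : grp (tr (m • Pi.single i 1 : Fin n → ℤ)) ∈ KK n := by
    induction m using Int.induction_on with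
    | zero => rw [zero_smul]; exact one_mem _
    | succ m ih =>
      have : (tr (((m : ℤ) + 1) • Pi.single i 1 : Fin n → ℤ) : AffW n) =
        tr ((m : ℤ) • Pi.single i 1) * tr (Pi.single i 1) := by
          rw [add_smul, one_smul]; exact map_mul SemidirectProduct.inl _ _
      rw [this, ← grp_mul]
      exact mul_mem ih (tr_single_mem n i).1
    | pred m ih =>
      have : (tr ((-(m : ℤ) - 1) • Pi.single i 1 : Fin n → ℤ) : AffW n) =
        tr (-(m : ℤ) • Pi.single i 1) * tr (-Pi.single i 1) := by
          rw [sub_smul, one_smul, sub_eq_add_neg]; exact map_mul SemidirectProduct.inl _ _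
      rw [this, ← grp_mul]
      exact mul_mem ih (tr_single_mem n i).2
  have hs (s : Finset (Fin n)) : grp (tr (∑ i ∈ s, mu i • Pi.single i 1)) ∈ KK n := by
    induction s using Finset.induction_on with
    | empty => rw [Finset.sum_empty]; exact one_mem _
    | insert a s ha ih =>
      rw [Finset.sum_insert ha]
      have : (tr (mu a • Pi.single a 1 + ∑ i ∈ s, mu i • Pi.single i 1) : AffW n) =
        tr (mu a • Pi.single a 1) * tr (∑ i ∈ s, mu i • Pi.single i 1) :=
          map_mul SemidirectProduct.inl _ _
      rw [this, ← grp_mul]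
      exact mul_mem (hz a _) ih
  have h := hs Finset.univ
  have e : (∑ i, mu i • Pi.single i 1 : Fin n → ℤ) = mu := by
    ext j
    simp [Finset.sum_apply, Pi.single_apply]
  rwa [e] at h

lemma grp_mem (w : AffW n) : grp w ∈ KK n := by
  have : w = tr (Multiplicative.toAdd w.left) * finW w.right := by
    exact (SemidirectProduct.inl_left_mul_inr_right w).symm
  rw [this, ← grp_mul]
  exact mul_mem (tr_mem n _) (finW_mem n _)

/-- For every `i ∈ ℤ/n`, the element `c(α_i)⁻¹ (s - 1)` with the finite part `s` of `s_i` lies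
in `𝕂`. -/
lemma finite_demazure_mem (i : Fin n) :
    coef (Ring.inverse (algebraMap (RT n) (RD n) (cc (root n i)))) *
      (grp (finW (Equiv.swap (i - 1) i)) - 1) ∈ KK n := by
  by_cases hi : i = 0
  swap
  · have := TT_mem n i
    rwa [TT, sRefl, if_neg hi] at this
  subst hi
  by_cases h1 : (1 : Fin n) = 0
  · have : (0 - 1 : Fin n) = 0 := by simp [h1]
    rw [this, Equiv.swap_self]
    have : (grp (finW (Equiv.refl (Fin n))) : KD n) = 1 := rfl
    rw [this, sub_self, mul_zero]
    exact zero_mem _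
  set ρ := (rot n)⁻¹ with hρ
  have hr (j : Fin n) : ρ j = j - 1 := by
    rw [hρ, Equiv.Perm.inv_eq_iff_eq]; simp [rot]
  have hu : IsUnit (algebraMap (RT n) (RD n) (cc (root n 1))) :=
    isUnit_cc (by simpa using Ne.symm h1)
  have hu0 : IsUnit (algebraMap (RT n) (RD n) (cc (root n 0))) :=
    isUnit_cc (by simpa using h1)
  have hc : ρ • (algebraMap (RT n) (RD n) (cc (root n 1))) =
      algebraMap (RT n) (RD n) (cc (root n 0)) := by
    rw [perm_smul_algebraMap, root, perm_smul_cc, hr, hr, root]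
    simp
  have hi : ρ • Ring.inverse (algebraMap (RT n) (RD n) (cc (root n 1))) =
      Ring.inverse (algebraMap (RT n) (RD n) (cc (root n 0))) := by
    refine hu0.mul_left_cancel ?_
    rw [Ring.mul_inverse_cancel _ hu0, ← hc, ← smul_mul', Ring.mul_inverse_cancel _ hu, smul_one]
  have hsw : ρ * Equiv.swap (1 - 1) 1 * ρ⁻¹ = Equiv.swap (0 - 1) 0 := by
    rw [Equiv.mul_swap_eq_swap_mul, mul_assoc, mul_inv_cancel, mul_one, hr, hr]
    simp
  have key : coef (Ring.inverse (algebraMap (RT n) (RD n) (cc (root n 0)))) *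
      (grp (finW (Equiv.swap (0 - 1) 0)) - 1) =
      grp (finW ρ) * TT n 1 * grp (finW ρ⁻¹) := by
    rw [TT, sRefl, if_neg h1, ← mul_assoc, grp_coef, finW_smul, hi, mul_assoc, mul_assoc]
    congr 1
    rw [sub_mul, mul_sub, one_mul, grp_mul, grp_mul, grp_mul, ← finW_mul, ← finW_mul,
      ← finW_mul, ← mul_assoc, hsw, mul_inv_cancel]
    rfl
  rw [key]
  exact mul_mem (mul_mem (finW_mem n _) (TT_mem n 1)) (finW_mem n _)

end

/-! ### The ring `Λ̂_(n)` and the double `k`-Schur functions of the single rows -/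

lemma grp_smul_mul (n : ℕ) (w : AffW n) (f g : SymSer (RD n)) :
    (grp w • f) * g = grp w • (f * grp (finW w.right⁻¹) • g) := by
  simp only [grp_smul]
  have h1 : (OmPow (Multiplicative.toAdd (finW (n := n) w.right⁻¹).left) : (SymSer (RD n))ˣ) = 1 := by
    change OmPow (0 : Fin n → ℤ) = 1
    simp [OmPow]
  have h2 : (permRD n w.right).comp (permRD n w.right⁻¹) = RingHom.id _ :=
    RingHom.ext fun r => smul_inv_smul w.right r
  have h3 : mapSym (permRD n w.right) (mapSym (permRD n w.right⁻¹) g) = g := by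
    rw [mapSym_comp, h2]
    rfl
  rw [h1, Units.val_one, one_mul, map_mul]
  change _ = _ * (_ * mapSym (permRD n w.right) (mapSym (permRD n w.right⁻¹) g))
  rw [h3, mul_assoc]

section
variable (n : ℕ) [NeZero n]

lemma orbit_mul_mem (x : KD n) (hx : x ∈ KK n) (f : SymSer (RD n))
    (hf : ∀ y ∈ KK n, ∃ z ∈ KK n, z • (1 : SymSer (RD n)) = f * y • (1 : SymSer (RD n))) :
    ∀ y ∈ KK n, ∃ z ∈ KK n, z • (1 : SymSer (RD n)) = (x • f) * y • (1 : SymSer (RD n)) := by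
  have hgrp (w : AffW n) (f : SymSer (RD n))
      (hf : ∀ y ∈ KK n, ∃ z ∈ KK n, z • (1 : SymSer (RD n)) = f * y • (1 : SymSer (RD n))) :
      ∀ y ∈ KK n, ∃ z ∈ KK n, z • (1 : SymSer (RD n)) = (grp w • f) * y • (1 : SymSer (RD n)) := by
    intro y hy
    obtain ⟨z, hz, h⟩ := hf _ (mul_mem (finW_mem n w.right⁻¹) hy)
    refine ⟨grp w * z, mul_mem (grp_mem n w) hz, ?_⟩
    rw [mul_smul, h, grp_smul_mul, mul_smul]
  induction hx using Subring.closure_induction generalizing f with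
  | mem x hx =>
    obtain (⟨r, rfl⟩ | ⟨i, rfl⟩) | ⟨m, rfl⟩ := hx
    · intro y hy
      obtain ⟨z, hz, h⟩ := hf y hy
      refine ⟨coef (algebraMap (RT n) (RD n) r) * z, mul_mem (coef_mem n r) hz, ?_⟩
      simp only [mul_smul, h, coef_smul, smul_mul_assoc]
    · intro y hy
      set c := Ring.inverse (algebraMap (RT n) (RD n) (cc (root n i))) with hc
      set s := finW (n := n) (Equiv.swap (i - 1) i) with hs
      have hsr : (sRefl n i).right⁻¹ = Equiv.swap (i - 1) i := by
        rw [sRefl]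
        split_ifs with h
        · subst h
          change (1 * Equiv.swap (0 - 1) (0 : Fin n))⁻¹ = _
          rw [one_mul, Equiv.swap_inv]
        · exact Equiv.swap_inv _ _
      obtain ⟨z1, hz1, h1⟩ := hf _ (mul_mem (finW_mem n (Equiv.swap (i - 1) i)) hy)
      obtain ⟨z2, hz2, h2⟩ := hf _ (mul_mem (finite_demazure_mem n i) hy)
      refine ⟨TT n i * z1 + z2, add_mem (mul_mem (TT_mem n i) hz1) hz2, ?_⟩
      rw [add_smul, mul_smul, h1, h2]
      have h3 := grp_smul_mul n (sRefl n i) f (y • 1)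
      rw [hsr] at h3
      simp only [TT, mul_smul, coef_smul, sub_smul, one_smul, ← hc, ← hs] at h3 ⊢
      generalize y • (1 : SymSer (RD n)) = g at h3 ⊢
      rw [← h3, smul_mul_assoc c, mul_smul_comm c, ← smul_add]
      congr 1
      ring
    · exact hgrp _ f hf
  | zero =>
    intro y hy
    exact ⟨0, zero_mem _, by rw [zero_smul, zero_smul, zero_mul]⟩
  | one => simpa only [one_smul] using hf
  | add x x' _ _ h h' =>
    intro y hy
    obtain ⟨z, hz, e⟩ := h f hf y hy
    obtain ⟨z', hz', e'⟩ := h' f hf y hy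
    exact ⟨z + z', add_mem hz hz', by rw [add_smul, e, e', add_smul, add_mul]⟩
  | neg x _ h =>
    intro y hy
    obtain ⟨z, hz, e⟩ := h f hf y hy
    exact ⟨-z, neg_mem hz, by rw [neg_smul, e, neg_smul, neg_mul]⟩
  | mul x x' _ _ h h' =>
    have := h _ (h' f hf)
    simpa only [mul_smul] using this

/-- `Λ̂_(n) = 𝕂 · 1`, an `R(T)`-subalgebra of the ring of symmetric series. -/
def LambdaN : Subalgebra (RT n) (SymSer (RD n)) where
  carrier := {f | ∃ x ∈ KK n, x • (1 : SymSer (RD n)) = f}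
  mul_mem' := by
    rintro _ _ ⟨x, hx, rfl⟩ ⟨y, hy, rfl⟩
    exact orbit_mul_mem n x hx 1 (fun y hy => ⟨y, hy, (one_mul _).symm⟩) y hy
  add_mem' := by
    rintro _ _ ⟨x, hx, rfl⟩ ⟨y, hy, rfl⟩
    exact ⟨x + y, add_mem hx hy, add_smul _ _ _⟩
  algebraMap_mem' r := by
    refine ⟨coef (algebraMap (RT n) (RD n) r), coef_mem n r, ?_⟩
    rw [coef_smul, algebraMap_smul, ← Algebra.algebraMap_eq_smul_one]

lemma smul_mem_LambdaN (x : KK n) (f : LambdaN n) : x • (f : SymSer (RD n)) ∈ LambdaN n := by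
  obtain ⟨y, hy, h⟩ := f.2
  refine ⟨x * y, mul_mem x.2 hy, ?_⟩
  rw [mul_smul, h]
  rfl

/-- `Λ̂_(n) = 𝕂 · 1` as a `𝕂`-module. -/
instance moduleLambdaN : Module (KK n) (LambdaN n) where
  smul x f := ⟨x • (f : SymSer (RD n)), smul_mem_LambdaN n x f⟩
  one_smul f := Subtype.ext (one_smul (KK n) (f : SymSer (RD n)))
  mul_smul x y f := Subtype.ext (mul_smul x y (f : SymSer (RD n)))
  smul_zero x := Subtype.ext (smul_zero x)
  smul_add x f g := Subtype.ext (smul_add x (f : SymSer (RD n)) (g : SymSer (RD n)))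
  add_smul x y f := Subtype.ext (add_smul x y (f : SymSer (RD n)))
  zero_smul f := Subtype.ext (zero_smul (KK n) (f : SymSer (RD n)))

/-- The `K`-theoretic double `k`-Schur function `g_{ρ_l}(y|b) = T_{ρ_l}(1)`, `0 ≤ l ≤ n - 1`, where
`ρ_l = s_{l-1} ⋯ s_1 s_0` (a reduced expression) and thus `T_{ρ_l} = T_{l-1} ⋯ T_1 T_0`. -/
def gRho : ℕ → SymSer (RD n)
  | 0 => 1
  | l + 1 => TT n (Fin.ofNat n l) • gRho l

/-- `f(y|ω^i b)`: the cyclic permutation `ω`, `ω(b_j) = b_{j+1}`, is applied `i` times to the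
coefficients of `f`. -/
def rotPow (i : ℕ) (f : SymSer (RD n)) : SymSer (RD n) := mapSym (permRD n (rot n ^ i)) f

end

/-! ### The coordinate ring of the centralizer family -/

/-- The upper bidiagonal matrix `A` with the diagonal entries `e^{-a_i}` and the entries `-1` above
the diagonal. -/
def matA (n : ℕ) : Matrix (Fin n) (Fin n) (RT n) := Matrix.of fun i j =>
  if i = j then ex (-aa i) else if i.val + 1 = j.val then -1 else 0

/-- The polynomial ring `R(T)[z_ij | i ≤ j]`. -/
abbrev PolyZ (n : ℕ) : Type := MvPolynomial {p : Fin n × Fin n // p.1 ≤ p.2} (RT n)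

/-- The generic upper triangular matrix `(z_ij)`. -/
def matX (n : ℕ) : Matrix (Fin n) (Fin n) (PolyZ n) := Matrix.of fun i j =>
  if h : i ≤ j then MvPolynomial.X ⟨(i, j), h⟩ else 0

/-- The matrix `Z A - A Z`, where `Z = (z_ij)`. -/
def commMat (n : ℕ) : Matrix (Fin n) (Fin n) (PolyZ n) :=
  matX n * (matA n).map MvPolynomial.C - (matA n).map MvPolynomial.C * matX n

/-- The ideal generated by the entries of `Z A - A Z`. -/
def commIdeal (n : ℕ) : Ideal (PolyZ n) := Ideal.span {p | ∃ i j, p = commMat n i j}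

/-- The ring `R(T)[z_ij | i ≤ j] / (Z A - A Z)`. -/
def QZ (n : ℕ) : Type := PolyZ n ⧸ commIdeal n

instance commRingQZ (n : ℕ) : CommRing (QZ n) := inferInstanceAs (CommRing (_ ⧸ commIdeal n))

instance algebraQZ (n : ℕ) : Algebra (RT n) (QZ n) :=
  inferInstanceAs (Algebra (RT n) (_ ⧸ commIdeal n))

/-- The quotient map onto `R(T)[z_ij | i ≤ j] / (Z A - A Z)`. -/
def mkQZ (n : ℕ) : PolyZ n →ₐ[RT n] QZ n := Ideal.Quotient.mkₐ (RT n) (commIdeal n)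

/-- The multiplicative set that is generated by the `z_ii`. -/
def diagSet (n : ℕ) : Submonoid (QZ n) :=
  Submonoid.closure (Set.range fun i => mkQZ n (matX n i i))

/-- The coordinate ring of the closed subscheme `{(t, Z) | Z A(t) = A(t) Z}` of `T × B`, where
`B ⊂ GL_n` is the group of the upper triangular matrices: the localization of
`R(T)[z_ij | i ≤ j] / (Z A - A Z)` at the `z_ii`. -/
def OZ (n : ℕ) : Type := Localization (diagSet n)

instance commRingOZ (n : ℕ) : CommRing (OZ n) := inferInstanceAs (CommRing (Localization (diagSet n)))

instance algebraQuotOZ (n : ℕ) : Algebra (QZ n) (OZ n) :=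
  inferInstanceAs (Algebra (QZ n) (Localization (diagSet n)))

instance algebraOZ (n : ℕ) : Algebra (RT n) (OZ n) :=
  inferInstanceAs (Algebra (RT n) (Localization (diagSet n)))

instance scalarTowerOZ (n : ℕ) : IsScalarTower (RT n) (QZ n) (OZ n) :=
  inferInstanceAs (IsScalarTower (RT n) (QZ n) (Localization (diagSet n)))

instance isLocalizationOZ (n : ℕ) : IsLocalization (diagSet n) (OZ n) :=
  inferInstanceAs (IsLocalization (diagSet n) (Localization (diagSet n)))

/-- The canonical map `R(T)[z_ij | i ≤ j] → 𝒪(𝒵)`. -/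
def toOZ (n : ℕ) : PolyZ n →ₐ[RT n] OZ n :=
  (IsScalarTower.toAlgHom (RT n) (QZ n) (OZ n)).comp
    (mkQZ n)

/-- The coordinate functions `z_ij` on the centralizer family; `z_ij = 0` for `i > j`. -/
def zz (n : ℕ) : Matrix (Fin n) (Fin n) (OZ n) := (matX n).map (toOZ n)

lemma zz_lower {n : ℕ} {i j : Fin n} (h : j < i) : zz n i j = 0 := by
  simp [zz, matX, not_le.2 h]

lemma isUnit_zz {n : ℕ} (i : Fin n) : IsUnit (zz n i i) :=
  IsLocalization.map_units (OZ n)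
    (⟨_, Submonoid.subset_closure ⟨i, rfl⟩⟩ : diagSet n)

lemma zz_comm (n : ℕ) : zz n * (matA n).map (algebraMap (RT n) (OZ n)) =
    (matA n).map (algebraMap (RT n) (OZ n)) * zz n := by
  have hA : ((matA n).map MvPolynomial.C).map (toOZ n) =
      (matA n).map (algebraMap (RT n) (OZ n)) := by
    ext i j
    exact (toOZ n).commutes _
  rw [← hA, zz, ← Matrix.map_mul, ← Matrix.map_mul]
  ext i j
  have h : commMat n i j ∈ commIdeal n := Ideal.subset_span ⟨i, j, rfl⟩
  have h1 : mkQZ n (commMat n i j) = 0 := Ideal.Quotient.eq_zero_iff_mem.2 h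
  have h2 : toOZ n (commMat n i j) = 0 :=
    (congrArg (algebraMap (QZ n) (OZ n)) h1).trans (map_zero _)
  rw [commMat, Matrix.sub_apply, map_sub, sub_eq_zero] at h2
  exact h2

/-- The evaluation of polynomials in the `z_ij` at a matrix. -/
def evalMat {n : ℕ} {S : Type} [CommRing S] [Algebra (RT n) S] (M : Matrix (Fin n) (Fin n) S) :
    PolyZ n →ₐ[RT n] S := MvPolynomial.aeval fun p => M p.1.1 p.1.2

lemma evalMat_matX {n : ℕ} {S : Type} [CommRing S] [Algebra (RT n) S]
    (M : Matrix (Fin n) (Fin n) S) (hlow : ∀ i j, j < i → M i j = 0) (i j : Fin n) :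
    evalMat M (matX n i j) = M i j := by
  by_cases h : i ≤ j
  · simp [evalMat, matX, h]
  · simp [evalMat, matX, h, hlow i j (not_le.1 h)]

lemma evalMat_commMat {n : ℕ} {S : Type} [CommRing S] [Algebra (RT n) S]
    (M : Matrix (Fin n) (Fin n) S) (hlow : ∀ i j, j < i → M i j = 0)
    (hcomm : M * (matA n).map (algebraMap (RT n) S) =
      (matA n).map (algebraMap (RT n) S) * M) (a : PolyZ n) (ha : a ∈ commIdeal n) :
    evalMat M a = 0 := by
  suffices commIdeal n ≤ RingHom.ker (evalMat M) from this ha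
  refine Ideal.span_le.2 ?_
  rintro _ ⟨i, j, rfl⟩
  have hX : (matX n).map (evalMat M) = M := by ext i j; exact evalMat_matX M hlow i j
  have hA : ((matA n).map MvPolynomial.C).map (evalMat M) =
      (matA n).map (algebraMap (RT n) S) := by
    ext i j
    exact (evalMat M).commutes _
  have h : (commMat n).map (evalMat M) = 0 := by
    rw [commMat, Matrix.map_sub _ (map_sub _), Matrix.map_mul, Matrix.map_mul, hX, hA, hcomm,
      sub_self]
  exact congrFun (congrFun h i) j

/-- The homomorphism `R(T)[z_ij] / (Z A - A Z) → S` given by a matrix that commutes with `A`. -/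
def liftQZ {n : ℕ} {S : Type} [CommRing S] [Algebra (RT n) S] (M : Matrix (Fin n) (Fin n) S)
    (hlow : ∀ i j, j < i → M i j = 0)
    (hcomm : M * (matA n).map (algebraMap (RT n) S) =
      (matA n).map (algebraMap (RT n) S) * M) : QZ n →ₐ[RT n] S :=
  Ideal.Quotient.liftₐ (commIdeal n) (evalMat M) (evalMat_commMat M hlow hcomm)

lemma liftQZ_isUnit {n : ℕ} {S : Type} [CommRing S] [Algebra (RT n) S]
    (M : Matrix (Fin n) (Fin n) S)
    (hlow : ∀ i j, j < i → M i j = 0) (hdiag : ∀ i, IsUnit (M i i))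
    (hcomm : M * (matA n).map (algebraMap (RT n) S) =
      (matA n).map (algebraMap (RT n) S) * M) (y : diagSet n) :
    IsUnit (liftQZ M hlow hcomm (y : QZ n)) := by
  suffices diagSet n ≤ (IsUnit.submonoid S).comap (liftQZ M hlow hcomm) from this y.2
  refine Submonoid.closure_le.2 ?_
  rintro _ ⟨i, rfl⟩
  have h : liftQZ M hlow hcomm (mkQZ n (matX n i i)) = M i i := evalMat_matX M hlow i i
  change IsUnit (liftQZ M hlow hcomm (mkQZ n (matX n i i)))
  rw [h]
  exact hdiag i

/-- The universal property of `𝒪(𝒵)`: a point of the centralizer family over an `R(T)`-algebra `S`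
is an upper triangular matrix over `S` with invertible diagonal entries that commutes with `A`. -/
def liftOZ {n : ℕ} {S : Type} [CommRing S] [Algebra (RT n) S] (M : Matrix (Fin n) (Fin n) S)
    (hlow : ∀ i j, j < i → M i j = 0) (hdiag : ∀ i, IsUnit (M i i))
    (hcomm : M * (matA n).map (algebraMap (RT n) S) =
      (matA n).map (algebraMap (RT n) S) * M) : OZ n →ₐ[RT n] S :=
  IsLocalization.liftAlgHom (M := diagSet n) (f := liftQZ M hlow hcomm)
    (liftQZ_isUnit M hlow hdiag hcomm)

lemma liftOZ_zz {n : ℕ} {S : Type} [CommRing S] [Algebra (RT n) S] (M : Matrix (Fin n) (Fin n) S)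
    (hlow : ∀ i j, j < i → M i j = 0) (hdiag : ∀ i, IsUnit (M i i))
    (hcomm : M * (matA n).map (algebraMap (RT n) S) =
      (matA n).map (algebraMap (RT n) S) * M) (i j : Fin n) :
    liftOZ M hlow hdiag hcomm (zz n i j) = M i j :=
  (IsLocalization.lift_eq (M := diagSet n) (g := (liftQZ M hlow hcomm : QZ n →+* S))
    (liftQZ_isUnit M hlow hdiag hcomm) _).trans (evalMat_matX M hlow i j)

/-- The counit of `𝒪(𝒵)`, `z_ij ↦ δ_ij` (the unit section `Z = 1` of the group scheme). -/
def counitOZ (n : ℕ) : OZ n →ₐ[RT n] RT n :=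
  liftOZ 1 (fun _ _ h => Matrix.one_apply_ne h.ne') (fun i => by simp) (by simp)

lemma map_mulA {n : ℕ} {S : Type} [CommRing S] [Algebra (RT n) S] (f : OZ n →ₐ[RT n] S) :
    (zz n).map f * (matA n).map (algebraMap (RT n) S) =
      (matA n).map (algebraMap (RT n) S) * (zz n).map f := by
  have hA : ((matA n).map (algebraMap (RT n) (OZ n))).map f =
      (matA n).map (algebraMap (RT n) S) := by
    ext i j
    exact f.commutes _
  have h := congrArg (fun M => M.map f) (zz_comm n)
  simp only [Matrix.map_mul, hA] at h
  exact h

/-- The matrix `(∑_k z_ik ⊗ z_kj)`. -/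
def mulMat (n : ℕ) : Matrix (Fin n) (Fin n) (OZ n ⊗[RT n] OZ n) :=
  (zz n).map (Algebra.TensorProduct.includeLeft : OZ n →ₐ[RT n] OZ n ⊗[RT n] OZ n) *
    (zz n).map (Algebra.TensorProduct.includeRight : OZ n →ₐ[RT n] OZ n ⊗[RT n] OZ n)

/-- The coproduct of `𝒪(𝒵)`, `z_ij ↦ ∑_k z_ik ⊗ z_kj` (the multiplication of matrices). -/
def comulOZ (n : ℕ) : OZ n →ₐ[RT n] OZ n ⊗[RT n] OZ n :=
  liftOZ (mulMat n)
    (fun i j h => by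
      refine (Matrix.mul_apply).trans (Finset.sum_eq_zero fun k _ => ?_)
      rw [Matrix.map_apply, Matrix.map_apply]
      rcases lt_or_ge k i with hk | hk
      · rw [zz_lower hk, map_zero, zero_mul]
      · rw [zz_lower (h.trans_le hk), map_zero, mul_zero])
    (fun i => by
      have : mulMat n i i =
          (Algebra.TensorProduct.includeLeft : OZ n →ₐ[RT n] OZ n ⊗[RT n] OZ n) (zz n i i) *
          (Algebra.TensorProduct.includeRight : OZ n →ₐ[RT n] OZ n ⊗[RT n] OZ n) (zz n i i) := by
        refine (Matrix.mul_apply).trans (Finset.sum_eq_single i (fun k _ hk => ?_) (by simp))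
        rw [Matrix.map_apply, Matrix.map_apply]
        rcases lt_or_gt_of_ne hk with hk | hk
        · rw [zz_lower hk, map_zero, zero_mul]
        · rw [zz_lower hk, map_zero, mul_zero]
      rw [this]
      exact ((isUnit_zz i).map _).mul ((isUnit_zz i).map _))
    (by rw [mulMat, Matrix.mul_assoc, map_mulA, ← Matrix.mul_assoc, map_mulA, Matrix.mul_assoc])

/-! ### The `𝕂`-module structure of the coordinate ring -/

section
variable (n : ℕ) [NeZero n]

/-- An element of `R(T)` as an element of `𝕂`. -/
def coefK (r : RT n) : KK n := ⟨coef (algebraMap (RT n) (RD n) r), coef_mem n r⟩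

/-- An element of the extended affine Weyl group as an element of `𝕂`. -/
def grpK (w : AffW n) : KK n := ⟨grp w, grp_mem n w⟩

/-- The defining properties of the action of `𝕂` on `𝒪(𝒵)`. It extends the structure of an
`R(T)`-module and the following action of the extended affine Weyl group. The simple reflections
`s_i`, `1 ≤ i ≤ n - 1`, act by ring automorphisms, with

* `s_i(z_jl) = z_jl` unless `l = i` or `j = i + 1`,
* `s_i(z_ii) = z_{i+1,i+1}` and `s_i(z_{i+1,i+1}) = z_ii`,
* `s_i(z_ji) = z_ji + (b_{i+1} - b_i) z_{j,i+1}` for `j < i`,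
* `s_i(z_{i+1,l}) = z_{i+1,l} - (b_{i+1} - b_i) z_il` for `i + 1 < l`,

and the translation `t_{ε_i}` acts as the multiplication by `z_ii`. (Below, the torus indices
`i` and `i + 1` are the elements `i - 1` and `i` of `Fin n`. The actions of `s_0 = t_{θ^∨} s_θ`
and of `T_i = c(α_i)⁻¹ (s_i - 1)` are thereby determined.) -/
structure IsKModuleOZ (m : Module (KK n) (OZ n)) : Prop where
  coef_smul (r : RT n) (f : OZ n) : coefK n r • f = r • f
  refl_mul (i : Fin n) (hi : i ≠ 0) (f g : OZ n) :
    grpK n (sRefl n i) • (f * g) = (grpK n (sRefl n i) • f) * (grpK n (sRefl n i) • g)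
  refl_one (i : Fin n) (hi : i ≠ 0) : grpK n (sRefl n i) • (1 : OZ n) = 1
  refl_other (i : Fin n) (hi : i ≠ 0) (j l : Fin n) (hjl : j ≤ l) (hl : l ≠ i - 1) (hj : j ≠ i) :
    grpK n (sRefl n i) • zz n j l = zz n j l
  refl_diag (i : Fin n) (hi : i ≠ 0) :
    grpK n (sRefl n i) • zz n (i - 1) (i - 1) = zz n i i
  refl_diag' (i : Fin n) (hi : i ≠ 0) :
    grpK n (sRefl n i) • zz n i i = zz n (i - 1) (i - 1)
  refl_col (i : Fin n) (hi : i ≠ 0) (j : Fin n) (hj : j < i - 1) :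
    grpK n (sRefl n i) • zz n j (i - 1) = zz n j (i - 1) + (bb i - bb (i - 1) : RT n) • zz n j i
  refl_row (i : Fin n) (hi : i ≠ 0) (l : Fin n) (hl : i < l) :
    grpK n (sRefl n i) • zz n i l = zz n i l - (bb i - bb (i - 1) : RT n) • zz n (i - 1) l
  trans_smul (i : Fin n) (f : OZ n) : grpK n (tr (Pi.single i 1)) • f = zz n i i * f

end

/-! ### The Hopf structure of symmetric series -/

/-- The coproduct `f(y) ↦ f(y, y')` of symmetric series; the values are series in the two sets of
variables `y` and `y'`, indexed by `ℕ ⊕ ℕ`. In particular `h_r ↦ ∑_i h_i(y) h_{r-i}(y')`. (As `f`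
is symmetric, the choice of a bijection `ℕ ≃ ℕ ⊕ ℕ` does not matter.) -/
def coprodSym {A : Type} [CommRing A] (f : SymSer A) : MvPowerSeries (ℕ ⊕ ℕ) A :=
  MvPowerSeries.rename Equiv.natSumNatEquivNat.symm (toSeries A f)

/-- The embedding of the first set of variables. -/
def renameL (n : ℕ) : MvPowerSeries ℕ (RD n) →ₐ[RT n] MvPowerSeries (ℕ ⊕ ℕ) (RD n) :=
  (MvPowerSeries.rename (R := RD n) (Function.Embedding.inl : ℕ ↪ ℕ ⊕ ℕ)).restrictScalars (RT n)

/-- The embedding of the second set of variables. -/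
def renameR (n : ℕ) : MvPowerSeries ℕ (RD n) →ₐ[RT n] MvPowerSeries (ℕ ⊕ ℕ) (RD n) :=
  (MvPowerSeries.rename (R := RD n) (Function.Embedding.inr : ℕ ↪ ℕ ⊕ ℕ)).restrictScalars (RT n)

/-- The map `Λ̂_(n) ⊗ Λ̂_(n) → A[[y, y']]`, `f ⊗ g ↦ f(y) g(y')`, to the completed tensor product. -/
def tensorSeries (n : ℕ) [NeZero n] :
    LambdaN n ⊗[RT n] LambdaN n →ₐ[RT n] MvPowerSeries (ℕ ⊕ ℕ) (RD n) :=
  Algebra.TensorProduct.productMap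
    (((renameL n).comp (toSeries (RT n))).comp (LambdaN n).val)
    (((renameR n).comp (toSeries (RT n))).comp (LambdaN n).val)

end

end CentralizerFamily

open CentralizerFamily
open scoped TensorProduct

namespace CentralizerFamily

open scoped TensorProduct

noncomputable section

/-! ### Complete homogeneous symmetric polynomials in finite families -/

section hsymm

variable {A : Type} [CommRing A]

/-! Read entrywise, the equation ZA = AZ for an upper triangular Z says (b_i - b_j) z_ij = z_{i,j-1}
- z_{i+1,j} for i < j. Splitting one variable off a complete homogeneous polynomial in two ways
shows that the series ĥ_{j-i}(y|b_i, …, b_j) satisfy the same divided difference recursion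
(`hFin_sub`, `centralizerRel_matH`). Hence z_ij ↦ ĥ_{j-i} defines a homomorphism on 𝒪(𝒵), with
values that have coefficients in R(T).

The image is Λ̂_(n). A simple transposition permutes the b's, and it alters an interval {i, …, j}
only if it moves one of its ends. The recursion then shows that the change is divisible by c(α), so
that the image is stable under T_1, …, T_{n-1} (`permSym_swap_sub`). Translations multiply by units
of the image, and T_0 is conjugate to T_1 under τ, so the image is stable under 𝕂 and contains 𝕂 ·
1. Conversely T_j lengthens an interval that ends at j by one step, up to a unit
(`TT_smul_extSym_hSet`), so every ĥ_{j-i} arises from 1 (`range_betaD`). Moving τ past T_{l-1} ⋯ T_0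
turns the same computation into the formula for g_{ρ_l} (`tau_smul_gRho`).

The map is injective. Solved for z_{i+1,j}, the recursion shows that the first row generates 𝒪(𝒵) up
to inverting the z_ii, so it suffices that the images of the first row are algebraically independent
over R(T)^Δ. There b_i - b_j is invertible, and the first row generates the same algebra as the
Ω(b_i|y). These are algebraically independent: their monomials are distinct group-like series, and
distinct group-like series are linearly independent by Dedekind's lemma. Finally, n elements that
generate a polynomial ring in n variables over a Noetherian ring are independent, since a surjective
endomorphism of a Noetherian ring is injective (`aeval_row_injective`).

The module structure on 𝒪(𝒵) is transported along this isomorphism. It is unique because the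
prescribed formulas force the isomorphism to intertwine the s_i and the translations, and because
c(α_i) T_i = s_i - 1 with c(α_i) invertible in R(T)^Δ. For the Hopf structure, an algebra map from
𝒪(𝒵) to an R(T)^Δ-algebra is determined by the z_ii, where both sides are group-like. -/

lemma aeval_hsymm {ι : Type} [Fintype ι] [DecidableEq ι] (t : ι → A) (k : ℕ) :
    MvPolynomial.aeval t (MvPolynomial.hsymm ι A k) = ∑ s : Sym ι k, (s.1.map t).prod := by
  simp [MvPolynomial.hsymm, map_sum, map_multiset_prod]

/-- Multisets of size k + 1 are sorted by whether they contain `none`. If they do, removing one copy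
leaves an arbitrary multiset of size k. -/
lemma aeval_hsymm_option {ι : Type} [Fintype ι] [DecidableEq ι] (t : Option ι → A) (k : ℕ) :
    MvPolynomial.aeval t (MvPolynomial.hsymm (Option ι) A (k + 1)) =
      t none * MvPolynomial.aeval t (MvPolynomial.hsymm (Option ι) A k) +
        MvPolynomial.aeval (fun i => t (some i)) (MvPolynomial.hsymm ι A (k + 1)) := by
  simp only [aeval_hsymm]
  rw [← Equiv.sum_comp (symOptionSuccEquiv (α := ι) (n := k)).symm, Fintype.sum_sum_type,
    Finset.mul_sum]
  congr 1
  · refine Finset.sum_congr rfl fun s _ => ?_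
    change (Multiset.map t (none ::ₘ s.1)).prod = _
    simp
  · refine Finset.sum_congr rfl fun s _ => ?_
    change (Multiset.map t (s.1.map _)).prod = _
    rw [Multiset.map_map]
    rfl

lemma aeval_hsymm_equiv {ι κ : Type} [Fintype ι] [DecidableEq ι] [Fintype κ] [DecidableEq κ]
    (e : ι ≃ κ) (t : κ → A) (k : ℕ) :
    MvPolynomial.aeval t (MvPolynomial.hsymm κ A k) =
      MvPolynomial.aeval (t ∘ e) (MvPolynomial.hsymm ι A k) := by
  rw [← MvPolynomial.rename_hsymm ι A k e, MvPolynomial.aeval_rename]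

variable {κ : Type} [DecidableEq κ]

/-- `h_k(t_i : i ∈ s)`. -/
def hFin (s : Finset κ) (t : κ → A) (k : ℕ) : A :=
  MvPolynomial.aeval (fun i : s => t i) (MvPolynomial.hsymm s A k)

lemma hFin_zero (s : Finset κ) (t : κ → A) : hFin s t 0 = 1 := by
  simp [hFin]

lemma hFin_insert (s : Finset κ) (t : κ → A) {a : κ} (ha : a ∉ s) (k : ℕ) :
    hFin (insert a s) t (k + 1) = t a * hFin (insert a s) t k + hFin s t (k + 1) := by
  have key (k : ℕ) := aeval_hsymm_equiv (A := A) (Finset.subtypeInsertEquivOption ha).symm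
    (fun i : (insert a s : Finset κ) => t i) k
  rw [hFin, key, aeval_hsymm_option, hFin, key]
  rfl

lemma hFin_empty (t : κ → A) (k : ℕ) : hFin ∅ t (k + 1) = 0 := by
  rw [hFin, aeval_hsymm]
  refine Finset.sum_eq_zero fun s _ => ?_
  have hs : 0 < s.1.card := by rw [s.2]; exact k.succ_pos
  obtain ⟨i, _⟩ := Multiset.card_pos_iff_exists_mem.1 hs
  exact absurd i.2 (Finset.notMem_empty _)

lemma hFin_singleton (t : κ → A) (a : κ) (k : ℕ) : hFin {a} t k = t a ^ k := by
  induction k with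
  | zero => rw [hFin_zero, pow_zero]
  | succ k ih =>
    have := hFin_insert ∅ t (Finset.notMem_empty a) k
    rw [insert_empty_eq, ih, hFin_empty, add_zero] at this
    rw [this, pow_succ']

lemma hFin_map {κ' : Type} [DecidableEq κ'] (s : Finset κ) (e : κ ↪ κ') (t : κ' → A) (k : ℕ) :
    hFin (s.map e) t k = hFin s (t ∘ e) k :=
  aeval_hsymm_equiv (s.equivMap e) _ k

/-- Splitting off a and splitting off b are two expansions of h_{k+1} in the variables of s, a and
b. Their difference is the claim. -/
lemma hFin_sub (s : Finset κ) (t : κ → A) {a b : κ} (hab : a ≠ b) (ha : a ∉ s) (hb : b ∉ s)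
    (k : ℕ) : (t a - t b) * hFin (insert a (insert b s)) t k =
      hFin (insert a s) t (k + 1) - hFin (insert b s) t (k + 1) := by
  have h1 := hFin_insert (insert b s) t (a := a) (by simp [hab, ha]) k
  have h2 := hFin_insert (insert a s) t (a := b) (by simp [hab.symm, hb]) k
  rw [Finset.insert_comm] at h2
  linear_combination h2 - h1

lemma map_hFin {B : Type} [CommRing B] (φ : A →+* B) (s : Finset κ) (t : κ → A) (k : ℕ) :
    φ (hFin s t k) = hFin s (φ ∘ t) k := by
  simp only [hFin, aeval_hsymm, map_sum, map_multiset_prod, Multiset.map_map]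
  rfl

end hsymm

/-! ### The series `ĥ_m(y|t)` of finite families -/

section hhat

variable {A : Type} [CommRing A] {κ : Type} [DecidableEq κ]

lemma ofDegree_sub (c d : ℕ → A) : ofDegree c - ofDegree d = ofDegree (c - d) := rfl

lemma ofDegree_smul (r : A) (c : ℕ → A) : r • ofDegree c = ofDegree (r • c) := rfl

lemma hhat_eq (m : ℕ) (s : Finset κ) (t : κ → A) :
    hhat m (fun k : s => t k) = ofDegree fun d => if m ≤ d then hFin s t (d - m) else 0 := rfl

lemma hhat_singleton (t : κ → A) (a : κ) :
    hhat 0 (fun k : ({a} : Finset κ) => t k) = Om (t a) := by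
  simp [hhat_eq, hFin_singleton, Om]

lemma mapSym_hhat {B : Type} [CommRing B] (φ : A →+* B) (m : ℕ) (s : Finset κ) (t : κ → A) :
    mapSym φ (hhat m (fun k : s => t k)) = hhat m (fun k : s => (φ ∘ t) k) := by
  rw [hhat_eq, mapSym_ofDegree, hhat_eq]
  congr 1
  ext d
  split_ifs
  · exact map_hFin φ s t _
  · exact map_zero φ

lemma hhat_map {κ' : Type} [DecidableEq κ'] (m : ℕ) (s : Finset κ) (e : κ ↪ κ') (t : κ' → A) :
    hhat m (fun k : s.map e => t k) = hhat m (fun k : s => (t ∘ e) k) := by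
  simp only [hhat_eq, hFin_map]

lemma hhat_sub (m : ℕ) (s : Finset κ) (t : κ → A) {a b : κ} (hab : a ≠ b) (ha : a ∉ s)
    (hb : b ∉ s) :
    (t a - t b) • hhat (m + 1) (fun k : (insert a (insert b s) : Finset κ) => t k) =
      hhat m (fun k : (insert a s : Finset κ) => t k) -
        hhat m (fun k : (insert b s : Finset κ) => t k) := by
  simp only [hhat_eq, ofDegree_smul, ofDegree_sub]
  congr 1
  ext d
  simp only [Pi.smul_apply, smul_eq_mul, Pi.sub_apply]
  -- In degree m both series on the right have the coefficient h_0 = 1, which cancels. This matches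
  -- the series on the left, which starts in degree m + 1.
  rcases lt_trichotomy d m with h | rfl | h
  · rw [if_neg (by omega), if_neg (by omega), if_neg (by omega), mul_zero, sub_zero]
  · rw [if_neg (by omega), if_pos le_rfl, if_pos le_rfl, mul_zero, Nat.sub_self, hFin_zero,
      hFin_zero, sub_self]
  · rw [if_pos (show m + 1 ≤ d from h), if_pos h.le, if_pos h.le, hFin_sub s t hab ha hb]
    congr 2 <;> omega

end hhat

/-- `ĥ_{|s|-1}(y|b_i : i ∈ s)` for a set `s` of torus indices. -/
def hSet {n : ℕ} (s : Finset (Fin n)) : SymSer (RT n) :=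
  hhat (s.card - 1) (fun k : s => (bb k.val : RT n))

lemma hSet_singleton {n : ℕ} (i : Fin n) : hSet {i} = Om (bb i) := hhat_singleton _ i

lemma hSet_sub {n : ℕ} (s : Finset (Fin n)) {a b : Fin n} (hab : a ≠ b) (ha : a ∉ s)
    (hb : b ∉ s) : (bb a - bb b : RT n) • hSet (insert a (insert b s)) =
      hSet (insert a s) - hSet (insert b s) := by
  have h := hhat_sub s.card s (bb : Fin n → RT n) hab ha hb
  simp only [hSet]
  rwa [Finset.card_insert_of_notMem (by simp [hab, ha]), Finset.card_insert_of_notMem hb,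
    Finset.card_insert_of_notMem ha, Nat.add_sub_cancel, Nat.add_sub_cancel]

lemma perm_smul_bb {n : ℕ} (σ : Equiv.Perm (Fin n)) (i : Fin n) :
    σ • (bb i : RT n) = bb (σ i) := by
  simp only [bb, smul_sub, smul_one, perm_smul_ex, map_neg, latPerm_aa]

lemma mapSym_hSet {n : ℕ} (σ : Equiv.Perm (Fin n)) (s : Finset (Fin n)) :
    mapSym (permRT n σ) (hSet s) = hSet (s.map σ.toEmbedding) := by
  rw [hSet, mapSym_hhat, hSet, hhat_map, Finset.card_map]
  exact congrArg (hhat _) (funext fun k => perm_smul_bb σ k)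

lemma mapSym_algebraMap_hSet {n : ℕ} (i j : Fin n) (h : i ≤ j) :
    mapSym (algebraMap (RT n) (RD n)) (hSet (Finset.Icc i j)) =
      hhat (j.val - i.val) (fun k : Finset.Icc i j => (bD k.val : RD n)) := by
  rw [hSet, mapSym_hhat, Fin.card_Icc]
  have : i.val ≤ j.val := h
  rw [show j.val + 1 - i.val - 1 = j.val - i.val by omega]
  rfl

/-! ### The relations of the centralizer family -/

section relations

variable {n : ℕ} {S : Type} [CommRing S] [Algebra (RT n) S]

/-- The superdiagonal contributes a sum with at most one nonzero term; in this form the first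
column, where the sum is empty, is not exceptional. -/
lemma mul_matA_apply (M : Matrix (Fin n) (Fin n) S) (i j : Fin n) :
    (M * (matA n).map (algebraMap (RT n) S)) i j =
      algebraMap (RT n) S (ex (-aa j)) * M i j -
        ∑ k : Fin n, if k.val + 1 = j.val then M i k else 0 := by
  have h (k : Fin n) : M i k * (matA n).map (algebraMap (RT n) S) k j =
      (if k = j then algebraMap (RT n) S (ex (-aa j)) * M i j else 0) -
        (if k.val + 1 = j.val then M i k else 0) := by
    rw [Matrix.map_apply, matA, Matrix.of_apply]
    split_ifs with h1 h2 h2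
    · subst h1; omega
    · subst h1; ring
    · simp
    · simp
  rw [Matrix.mul_apply, Finset.sum_congr rfl fun k _ => h k, Finset.sum_sub_distrib]
  simp

lemma matA_mul_apply (M : Matrix (Fin n) (Fin n) S) (i j : Fin n) :
    ((matA n).map (algebraMap (RT n) S) * M) i j =
      algebraMap (RT n) S (ex (-aa i)) * M i j -
        ∑ k : Fin n, if i.val + 1 = k.val then M k j else 0 := by
  have h (k : Fin n) : (matA n).map (algebraMap (RT n) S) i k * M k j =
      (if i = k then algebraMap (RT n) S (ex (-aa i)) * M i j else 0) -
        (if i.val + 1 = k.val then M k j else 0) := by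
    rw [Matrix.map_apply, matA, Matrix.of_apply]
    split_ifs with h1 h2 h2
    · subst h1; omega
    · subst h1; ring
    · simp
    · simp
  rw [Matrix.mul_apply, Finset.sum_congr rfl fun k _ => h k, Finset.sum_sub_distrib]
  simp

/-- The relations that express that an upper triangular matrix commutes with `A`. -/
def CentralizerRel (M : Matrix (Fin n) (Fin n) S) : Prop :=
  ∀ i j i' j' : Fin n, i < j → i'.val = i.val + 1 → j'.val + 1 = j.val →
    (bb i - bb j : RT n) • M i j = M i j' - M i' j

/-- Above the diagonal an entry of ZA - AZ is the stated relation. On and below it, triangularity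
kills the superdiagonal terms, and what remains cancels. -/
lemma commute_matA_iff (M : Matrix (Fin n) (Fin n) S) (hlow : ∀ i j, j < i → M i j = 0) :
    M * (matA n).map (algebraMap (RT n) S) = (matA n).map (algebraMap (RT n) S) * M ↔
      CentralizerRel M := by
  have key (i j i' j' : Fin n) (hi : i'.val = i.val + 1) (hj : j'.val + 1 = j.val) :
      (M * (matA n).map (algebraMap (RT n) S)) i j =
        ((matA n).map (algebraMap (RT n) S) * M) i j ↔
      (bb i - bb j : RT n) • M i j = M i j' - M i' j := by
    rw [mul_matA_apply, matA_mul_apply,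
      Finset.sum_eq_single j' (fun k _ hk => if_neg fun h => hk (Fin.ext (by omega))) (by simp),
      Finset.sum_eq_single i' (fun k _ hk => if_neg fun h => hk (Fin.ext (by omega))) (by simp),
      if_pos hj, if_pos hi.symm, Algebra.smul_def, bb, bb]
    simp only [map_sub, map_one]
    constructor <;> intro h <;> linear_combination h
  constructor
  · intro h i j i' j' _ hi hj
    exact (key i j i' j' hi hj).1 (congrFun (congrFun h i) j)
  · intro h
    ext i j
    rcases lt_or_ge i j with hij | hij
    · have hij' : i.val < j.val := hij
      let i' : Fin n := ⟨i.val + 1, by omega⟩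
      let j' : Fin n := ⟨j.val - 1, by omega⟩
      have hj : j'.val + 1 = j.val := by simp only [j']; omega
      exact (key i j i' j' rfl hj).2 (h i j i' j' hij rfl hj)
    · have hij' : j.val ≤ i.val := hij
      rw [mul_matA_apply, matA_mul_apply, Finset.sum_eq_zero, Finset.sum_eq_zero]
      · rcases hij.eq_or_lt with rfl | hlt
        · rfl
        · rw [hlow i j hlt, mul_zero, mul_zero]
      · intro k _
        split_ifs with hk
        · exact hlow k j (Fin.lt_def.2 (by omega))
        · rfl
      · intro k _
        split_ifs with hk
        · exact hlow i k (Fin.lt_def.2 (by omega))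
        · rfl

lemma CentralizerRel.map {S' : Type} [CommRing S'] [Algebra (RT n) S']
    {M : Matrix (Fin n) (Fin n) S} (h : CentralizerRel M) (f : S →ₐ[RT n] S') :
    CentralizerRel (M.map f) := fun i j i' j' hij hi hj => by
  simp only [Matrix.map_apply]
  rw [← map_smul, h i j i' j' hij hi hj, map_sub]

/-- Induction on j - i: the relation expresses (b_i - b_j) M_ij by entries nearer to the diagonal.
Only an additive subgroup in which one can divide by b_i - b_j is needed, so the lemma applies to
equalizers of homomorphisms as well as to subalgebras. -/
lemma CentralizerRel.mem_of_diag {M : Matrix (Fin n) (Fin n) S} (h : CentralizerRel M)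
    (N : AddSubgroup S)
    (hN : ∀ (i j : Fin n) (x : S), i ≠ j → (bb i - bb j : RT n) • x ∈ N → x ∈ N)
    (hd : ∀ i, M i i ∈ N) (i j : Fin n) (hij : i ≤ j) : M i j ∈ N := by
  induction hm : j.val - i.val generalizing i j with
  | zero =>
    have : i = j := le_antisymm hij (Fin.le_def.2 (by omega))
    exact this ▸ hd i
  | succ m ih =>
    have hlt : i < j := Fin.lt_def.2 (by omega)
    refine hN i j _ hlt.ne ?_
    rw [h i j ⟨i.val + 1, by omega⟩ ⟨j.val - 1, by omega⟩ hlt rfl (by simp only; omega)]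
    exact sub_mem (ih _ _ (Fin.le_def.2 (by simp only; omega)) (by simp only; omega))
      (ih _ _ (Fin.le_def.2 (by simp only; omega)) (by simp only; omega))

/-- Here the relation is solved for the lower row, M_{i+1,j} = M_{i,j-1} - (b_i - b_j) M_ij. Nothing
is divided, so the statement holds over R(T) itself. -/
lemma CentralizerRel.mem_of_row [NeZero n] {M : Matrix (Fin n) (Fin n) S} (h : CentralizerRel M)
    (N : Submodule (RT n) S) (hr : ∀ j, M 0 j ∈ N) (i j : Fin n) (hij : i ≤ j) : M i j ∈ N := by
  induction hm : i.val generalizing i j with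
  | zero =>
    have : i = 0 := Fin.ext hm
    exact this ▸ hr j
  | succ m ih =>
    have hij' : i.val ≤ j.val := hij
    have e := h ⟨m, by omega⟩ j i ⟨j.val - 1, by omega⟩ (Fin.lt_def.2 (by simp only; omega)) hm
      (by simp only; omega)
    rw [eq_sub_iff_add_eq, ← eq_sub_iff_add_eq'] at e
    rw [e]
    exact sub_mem (ih _ _ (Fin.le_def.2 (by simp only; omega)) rfl)
      (N.smul_mem _ (ih _ _ (Fin.le_def.2 (by simp only; omega)) rfl))

end relations

/-! ### Generators of the coordinate ring -/

section generators

variable {n : ℕ}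

lemma centralizerRel_zz (n : ℕ) : CentralizerRel (zz n) :=
  (commute_matA_iff _ fun _ _ h => zz_lower h).1 (zz_comm n)

lemma mkQZ_surjective (n : ℕ) : Function.Surjective (mkQZ n) := Ideal.Quotient.mk_surjective

/-- An induction principle for 𝒪(𝒵). It is stated for subrings because the maps to which it is
applied, such as the s_i, are only semilinear over R(T). -/
lemma OZ_subring_eq_top (S : Subring (OZ n)) (hr : ∀ r, algebraMap (RT n) (OZ n) r ∈ S)
    (hz : ∀ i j, i ≤ j → zz n i j ∈ S) (hinv : ∀ i v, zz n i i * v = 1 → v ∈ S) : S = ⊤ := by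
  rw [eq_top_iff]
  rintro x -
  have hp (p : PolyZ n) : toOZ n p ∈ S := by
    induction p using MvPolynomial.induction_on with
    | C r =>
      have : toOZ n (MvPolynomial.C r) = algebraMap (RT n) (OZ n) r := (toOZ n).commutes r
      rw [this]
      exact hr r
    | add p q hp hq => rw [map_add]; exact add_mem hp hq
    | mul_X p k hp =>
      rw [map_mul]
      refine mul_mem hp ?_
      have := hz k.1.1 k.1.2 k.2
      rwa [zz, Matrix.map_apply, matX, Matrix.of_apply, dif_pos k.2] at this
  obtain ⟨q, s, rfl⟩ := IsLocalization.exists_mk'_eq (diagSet n) x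
  have hs : ∃ v ∈ S, algebraMap (QZ n) (OZ n) s * v = 1 := by
    obtain ⟨s, hs⟩ := s
    induction hs using Submonoid.closure_induction with
    | mem s hs =>
      obtain ⟨i, rfl⟩ := hs
      obtain ⟨v, hv⟩ := (isUnit_zz (n := n) i).exists_right_inv
      exact ⟨v, hinv i v hv, hv⟩
    | one => exact ⟨1, one_mem S, by simp⟩
    | mul s t _ _ hs ht =>
      obtain ⟨v, hv, h1⟩ := hs
      obtain ⟨w, hw, h2⟩ := ht
      refine ⟨v * w, mul_mem hv hw, ?_⟩
      rw [map_mul, mul_mul_mul_comm, h1, h2, one_mul]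
  obtain ⟨v, hv, h1⟩ := hs
  obtain ⟨p, rfl⟩ := mkQZ_surjective n q
  have : IsLocalization.mk' (OZ n) (mkQZ n p) s = toOZ n p * v := by
    rw [IsLocalization.mk'_eq_iff_eq_mul, mul_assoc, mul_comm v, h1, mul_one]
    rfl
  rw [this]
  exact mul_mem (hp p) hv

lemma OZ_ringHom_ext {S : Type} [CommRing S] {f g : OZ n →+* S}
    (hr : ∀ r, f (algebraMap (RT n) (OZ n) r) = g (algebraMap (RT n) (OZ n) r))
    (hz : ∀ i j, i ≤ j → f (zz n i j) = g (zz n i j)) : f = g := by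
  have h : f.eqLocus g = ⊤ := OZ_subring_eq_top _ hr hz fun i v hv => by
    have h1 : f (zz n i i) * f v = 1 := by rw [← map_mul, hv, map_one]
    have h2 : f (zz n i i) * g v = 1 := by rw [hz i i le_rfl, ← map_mul, hv, map_one]
    exact (isUnit_zz i).map f |>.mul_left_cancel (h1.trans h2.symm)
  exact RingHom.ext fun x => (h ▸ Subring.mem_top x : x ∈ f.eqLocus g)

lemma cc_smul_injective {S : Type} [CommRing S] [Algebra (RT n) S] [Algebra (RD n) S]
    [IsScalarTower (RT n) (RD n) S] {i j : Fin n} (h : i ≠ j) {x y : S}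
    (hxy : (cc (aa i - aa j) : RT n) • x = (cc (aa i - aa j) : RT n) • y) : x = y := by
  rw [← algebraMap_smul (RD n) (cc (aa i - aa j)) x,
    ← algebraMap_smul (RD n) (cc (aa i - aa j)) y] at hxy
  exact (isUnit_cc h).smul_left_cancel.1 hxy

lemma ex_add (lam mu : Fin n → ℤ) : (ex (lam + mu) : RT n) = ex lam * ex mu := by
  simp [ex, AddMonoidAlgebra.single_mul_single]

lemma ex_zero : (ex 0 : RT n) = 1 := rfl

lemma ex_neg_mul (lam : Fin n → ℤ) : (ex (-lam) * ex lam : RT n) = 1 := by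
  rw [← ex_add, neg_add_cancel, ex_zero]

/-- Up to a unit of R(T), b_i - b_j is the root element c(a_i - a_j); thus the localization at the
roots inverts exactly the denominators of the recursion. -/
lemma bb_sub_bb (i j : Fin n) : (bb i - bb j : RT n) = -ex (-aa i) * cc (aa i - aa j) := by
  rw [bb, bb, cc, mul_sub, neg_mul, neg_mul, ← ex_add]
  have : -aa i + (aa i - aa j) = -aa j := by abel
  rw [this]
  ring

lemma bb_smul_injective {S : Type} [CommRing S] [Algebra (RT n) S] [Algebra (RD n) S]
    [IsScalarTower (RT n) (RD n) S] {i j : Fin n} (h : i ≠ j) {x y : S}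
    (hxy : (bb i - bb j : RT n) • x = (bb i - bb j : RT n) • y) : x = y := by
  refine cc_smul_injective h ?_
  rw [bb_sub_bb, mul_smul, mul_smul] at hxy
  have := congrArg (fun z => (-ex (aa i) : RT n) • z) hxy
  simp only [smul_smul, ← mul_assoc, neg_mul_neg] at this
  rwa [mul_comm (ex _), ex_neg_mul, one_mul] at this

/-- Homomorphisms from `𝒪(𝒵)` to an algebra over `R(T)^Δ` are determined by their values on the
diagonal entries `z_ii`. -/
lemma OZ_algHom_ext {S : Type} [CommRing S] [Algebra (RT n) S] [Algebra (RD n) S]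
    [IsScalarTower (RT n) (RD n) S] {f g : OZ n →ₐ[RT n] S}
    (h : ∀ i, f (zz n i i) = g (zz n i i)) : f = g := by
  have key (i j : Fin n) (hij : i ≤ j) : f (zz n i j) = g (zz n i j) := by
    refine (centralizerRel_zz n).mem_of_diag ((f : OZ n →+ S).eqLocus (g : OZ n →+ S))
      (fun i j x hne hx => ?_) h i j hij
    refine bb_smul_injective hne ?_
    have hx' : f ((bb i - bb j : RT n) • x) = g ((bb i - bb j : RT n) • x) := hx
    rwa [map_smul, map_smul] at hx'
  have := OZ_ringHom_ext (f := (f : OZ n →+* S)) (g := (g : OZ n →+* S))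
    (fun r => by simp) key
  exact AlgHom.ext fun x => congrArg (fun F => F x) this

/-- The entries of the first row generate the coordinate ring before the localization. -/
lemma aeval_row_surjective (n : ℕ) [NeZero n] :
    Function.Surjective (MvPolynomial.aeval (fun j => mkQZ n (matX n 0 j)) :
      MvPolynomial (Fin n) (RT n) →ₐ[RT n] QZ n) := by
  rw [← AlgHom.range_eq_top, eq_top_iff]
  set N := (MvPolynomial.aeval (fun j => mkQZ n (matX n 0 j)) :
      MvPolynomial (Fin n) (RT n) →ₐ[RT n] QZ n).range with hN
  rintro q -
  obtain ⟨p, rfl⟩ := mkQZ_surjective n q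
  have hlow (i j : Fin n) (h : j < i) : ((matX n).map (mkQZ n)) i j = 0 := by
    simp [matX, not_le.2 h]
  have hrel : CentralizerRel ((matX n).map (mkQZ n)) := by
    rw [← commute_matA_iff _ hlow]
    have hA : ((matA n).map MvPolynomial.C).map (mkQZ n) =
        (matA n).map (algebraMap (RT n) (QZ n)) := by
      ext i j
      exact (mkQZ n).commutes _
    rw [← hA, ← Matrix.map_mul, ← Matrix.map_mul]
    ext i j
    have h : commMat n i j ∈ commIdeal n := Ideal.subset_span ⟨i, j, rfl⟩
    have h1 : mkQZ n (commMat n i j) = 0 := Ideal.Quotient.eq_zero_iff_mem.2 h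
    rwa [commMat, Matrix.sub_apply, map_sub, sub_eq_zero] at h1
  have hz (i j : Fin n) (hij : i ≤ j) : mkQZ n (matX n i j) ∈ N :=
    hrel.mem_of_row (Subalgebra.toSubmodule N)
      (fun j => ⟨MvPolynomial.X j, by simp⟩) i j hij
  induction p using MvPolynomial.induction_on with
  | C r =>
    have : mkQZ n (MvPolynomial.C r) = algebraMap (RT n) (QZ n) r := (mkQZ n).commutes r
    rw [this]
    exact N.algebraMap_mem r
  | add p q hp hq => rw [map_add]; exact add_mem hp hq
  | mul_X p k hp =>
    rw [map_mul]
    refine mul_mem hp ?_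
    have := hz k.1.1 k.1.2 k.2
    rwa [matX, Matrix.of_apply, dif_pos k.2] at this

end generators

/-! ### The homomorphism to symmetric series -/

section beta

variable {n : ℕ}

/-- The matrix `(ĥ_{j-i}(y|b_i, …, b_j))`. -/
def matH (n : ℕ) : Matrix (Fin n) (Fin n) (SymSer (RT n)) := Matrix.of fun i j =>
  if i ≤ j then hSet (Finset.Icc i j) else 0

lemma matH_apply {i j : Fin n} (h : i ≤ j) : matH n i j = hSet (Finset.Icc i j) := if_pos h

lemma matH_lower (i j : Fin n) (h : j < i) : matH n i j = 0 := if_neg (not_le.2 h)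

/-- The three intervals in the relation are the open interval between i and j with both ends, the
left end or the right end added, so this is an instance of `hSet_sub`. -/
lemma centralizerRel_matH (n : ℕ) : CentralizerRel (matH n) := by
  intro i j i' j' hij hi hj
  have hij' : i.val < j.val := hij
  have h1 : Finset.Icc i j = insert i (insert j (Finset.Ioo i j)) := by
    ext x
    simp only [Finset.mem_Icc, Finset.mem_insert, Finset.mem_Ioo, Fin.le_def, Fin.lt_def,
      Fin.ext_iff]
    omega
  have h2 : Finset.Icc i j' = insert i (Finset.Ioo i j) := by
    ext x
    simp only [Finset.mem_Icc, Finset.mem_insert, Finset.mem_Ioo, Fin.le_def, Fin.lt_def,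
      Fin.ext_iff]
    omega
  have h3 : Finset.Icc i' j = insert j (Finset.Ioo i j) := by
    ext x
    simp only [Finset.mem_Icc, Finset.mem_insert, Finset.mem_Ioo, Fin.le_def, Fin.lt_def,
      Fin.ext_iff]
    omega
  rw [matH_apply hij.le, matH_apply (Fin.le_def.2 (by omega)),
    matH_apply (Fin.le_def.2 (by omega)), h1, h2, h3]
  exact hSet_sub _ hij.ne (by simp) (by simp)

lemma matH_diag (i : Fin n) : matH n i i = Om (bb i) := by
  rw [matH_apply le_rfl, Finset.Icc_self, hSet_singleton]

/-- The homomorphism `𝒪(𝒵) → Λ̂_{R(T)}`, `z_ij ↦ ĥ_{j-i}(y|b_i, …, b_j)`. -/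
def betaR (n : ℕ) : OZ n →ₐ[RT n] SymSer (RT n) :=
  liftOZ (matH n) matH_lower (fun i => matH_diag i ▸ isUnit_Om _)
    ((commute_matA_iff _ matH_lower).2 (centralizerRel_matH n))

lemma betaR_zz {i j : Fin n} (h : i ≤ j) : betaR n (zz n i j) = hSet (Finset.Icc i j) :=
  (liftOZ_zz _ _ _ _ i j).trans (matH_apply h)

/-- The extension of the coefficients `Λ̂_{R(T)} → Λ̂_{R(T)^Δ}`. -/
def extSym (n : ℕ) : SymSer (RT n) →ₐ[RT n] SymSer (RD n) where
  __ := mapSym (algebraMap (RT n) (RD n))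
  commutes' r := by
    have h := mapSym_smul (algebraMap (RT n) (RD n)) r 1
    rw [map_one, ← Algebra.algebraMap_eq_smul_one, algebraMap_smul,
      ← Algebra.algebraMap_eq_smul_one] at h
    exact h

lemma extSym_apply (f : SymSer (RT n)) : extSym n f = mapSym (algebraMap (RT n) (RD n)) f := rfl

/-- The homomorphism `𝒪(𝒵) → Λ̂_{R(T)^Δ}`, `z_ij ↦ ĥ_{j-i}(y|b_i, …, b_j)`. -/
def betaD (n : ℕ) : OZ n →ₐ[RT n] SymSer (RD n) := (extSym n).comp (betaR n)

lemma betaD_zz {i j : Fin n} (h : i ≤ j) :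
    betaD n (zz n i j) = extSym n (hSet (Finset.Icc i j)) :=
  congrArg (extSym n) (betaR_zz h)

lemma betaD_diag (i : Fin n) : betaD n (zz n i i) = Om (bD i) := by
  rw [betaD_zz le_rfl, Finset.Icc_self, hSet_singleton, extSym_apply, mapSym_Om]
  rfl

/-- The action of a permutation on the coefficients of symmetric series. -/
def permSym (σ : Equiv.Perm (Fin n)) : SymSer (RD n) →+* SymSer (RD n) := mapSym (permRD n σ)

lemma permSym_mul (σ σ' : Equiv.Perm (Fin n)) (f : SymSer (RD n)) :
    permSym (σ * σ') f = permSym σ (permSym σ' f) := by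
  have h : permRD n (σ * σ') = (permRD n σ).comp (permRD n σ') :=
    RingHom.ext fun r => mul_smul σ σ' r
  rw [permSym, permSym, permSym, mapSym_comp, h]

lemma permSym_one (f : SymSer (RD n)) : permSym 1 f = f := by
  have h : permRD n 1 = RingHom.id _ := RingHom.ext fun r => one_smul (Equiv.Perm (Fin n)) r
  rw [permSym, h]
  rfl

lemma permSym_extSym (σ : Equiv.Perm (Fin n)) (f : SymSer (RT n)) :
    permSym σ (extSym n f) = extSym n (mapSym (permRT n σ) f) := by
  rw [permSym, extSym_apply, extSym_apply, mapSym_comp, mapSym_comp]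
  congr 1
  exact congrArg mapSym (RingHom.ext fun r => permRD_algebraMap n σ r)

lemma permSym_extSym_hSet (σ : Equiv.Perm (Fin n)) (s : Finset (Fin n)) :
    permSym σ (extSym n (hSet s)) = extSym n (hSet (s.map σ.toEmbedding)) := by
  rw [permSym_extSym, mapSym_hSet]

lemma permSym_smul (σ : Equiv.Perm (Fin n)) (r : RD n) (f : SymSer (RD n)) :
    permSym σ (r • f) = (σ • r) • permSym σ f := mapSym_smul _ r f

lemma permSym_smul' (σ : Equiv.Perm (Fin n)) (r : RT n) (f : SymSer (RD n)) :
    permSym σ (r • f) = (σ • r) • permSym σ f := by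
  rw [← algebraMap_smul (RD n) r f, permSym_smul, perm_smul_algebraMap, algebraMap_smul]

lemma permSym_algebraMap (σ : Equiv.Perm (Fin n)) (r : RT n) :
    permSym σ (algebraMap (RT n) (SymSer (RD n)) r) =
      algebraMap (RT n) (SymSer (RD n)) (σ • r) := by
  rw [Algebra.algebraMap_eq_smul_one, permSym_smul', map_one, ← Algebra.algebraMap_eq_smul_one]

lemma permSym_Om (σ : Equiv.Perm (Fin n)) (i : Fin n) :
    permSym σ (Om (bD i)) = Om (bD (σ i)) := by
  rw [permSym, mapSym_Om, permRD_bD]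

lemma finW_smul_sym (σ : Equiv.Perm (Fin n)) (f : SymSer (RD n)) :
    grp (finW σ) • f = permSym σ f := by
  rw [grp_smul]
  have : (OmPow (Multiplicative.toAdd (finW (n := n) σ).left) : (SymSer (RD n))ˣ) = 1 := by
    change OmPow (0 : Fin n → ℤ) = 1
    simp [OmPow]
  rw [this, Units.val_one, one_mul]
  rfl

lemma tr_smul_sym (mu : Fin n → ℤ) (f : SymSer (RD n)) :
    grp (tr mu) • f = (OmPow mu : (SymSer (RD n))ˣ) * f := by
  rw [grp_smul]
  congr 1
  exact permSym_one f

lemma OmPow_single (i : Fin n) : OmPow (Pi.single i 1 : Fin n → ℤ) = OmU (bD i) := by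
  rw [OmPow, Finset.prod_eq_single i (fun j _ hj => by simp [hj]) (by simp)]
  simp

lemma tr_single_smul_sym (i : Fin n) (f : SymSer (RD n)) :
    grp (tr (Pi.single i 1)) • f = Om (bD i) * f := by
  rw [tr_smul_sym, OmPow_single]
  rfl

end beta

/-! ### Simple transpositions -/

section transpositions

variable {n : ℕ}

lemma bb_sub_bb' (p i : Fin n) : (bb i - bb p : RT n) = ex (-aa p) * cc (aa p - aa i) := by
  rw [bb, bb, cc, mul_sub, ← ex_add]
  have : -aa p + (aa p - aa i) = -aa i := by abel
  rw [this]
  ring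

/-- The geometric series. A negative exponent reduces to a positive one after a unit is factored
out. -/
lemma cc_dvd_ex_zsmul_sub_one (alpha : Fin n → ℤ) (k : ℤ) :
    (cc alpha : RT n) ∣ ex (k • alpha) - 1 := by
  have hnat (m : ℕ) : (cc alpha : RT n) ∣ ex ((m : ℤ) • alpha) - 1 := by
    induction m with
    | zero => simp [ex_zero]
    | succ m ih =>
      have e : (ex (((m + 1 : ℕ) : ℤ) • alpha) - 1 : RT n) =
          (ex ((m : ℤ) • alpha) - 1) * ex alpha - cc alpha := by
        push_cast
        rw [add_smul, one_smul, ex_add, cc]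
        ring
      rw [e]
      exact dvd_sub (ih.mul_right _) dvd_rfl
  obtain ⟨m, rfl | rfl⟩ := k.eq_nat_or_neg
  · exact hnat m
  · have e : (ex (-(m : ℤ) • alpha) - 1 : RT n) =
        -(ex (-((m : ℤ) • alpha)) * (ex ((m : ℤ) • alpha) - 1)) := by
      rw [mul_sub, ex_neg_mul, neg_smul]
      ring
    rw [e]
    exact ((hnat m).mul_left _).neg_right

/-- Integrality of the Demazure operators on R(T): a reflection moves a weight by a multiple of the
root, so each e^μ changes by e^μ (e^{kα} - 1). -/
lemma cc_dvd_swap_smul_sub (p i : Fin n) (r : RT n) :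
    (cc (aa p - aa i) : RT n) ∣ Equiv.swap p i • r - r := by
  induction r using AddMonoidAlgebra.induction_on with
  | of mu =>
    change _ ∣ Equiv.swap p i • (ex mu : RT n) - ex mu
    have h : latPerm n (Equiv.swap p i) mu = mu + (mu i - mu p) • (aa p - aa i) := by
      ext k
      simp only [latPerm, AddEquiv.coe_mk, Equiv.coe_fn_mk, Equiv.swap_inv, Pi.add_apply,
        Pi.smul_apply, Pi.sub_apply, aa, smul_eq_mul, Equiv.swap_apply_def, Pi.single_apply]
      split_ifs <;> simp_all
    rw [perm_smul_ex, h, ex_add]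
    have := (cc_dvd_ex_zsmul_sub_one (aa p - aa i) (mu i - mu p)).mul_left (ex mu)
    rwa [mul_sub, mul_one] at this
  | add r s hr hs =>
    rw [smul_add, add_sub_add_comm]
    exact dvd_add hr hs
  | smul m r hr =>
    have : Equiv.swap p i • (m • r) = m • Equiv.swap p i • r :=
      map_zsmul (permRT n (Equiv.swap p i)) m r
    rw [this, ← smul_sub]
    exact hr.trans ⟨m, by rw [zsmul_eq_mul, mul_comm]⟩

variable {p i : Fin n}

/-- The transposition replaces the right end p by the next index i. The sets before and after differ
in one element, and their union is the interval from j to i, so `hSet_sub` gives the difference. The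
case j = p covers the diagonal entry. -/
lemma map_swap_Icc_col (hp : p.val + 1 = i.val) {j : Fin n} (hj : j ≤ p) :
    extSym n (hSet ((Finset.Icc j p).map (Equiv.swap p i).toEmbedding)) =
      extSym n (hSet (Finset.Icc j p)) +
        (bb i - bb p : RT n) • extSym n (hSet (Finset.Icc j i)) := by
  have hj' : j.val ≤ p.val := hj
  have h1 : (Finset.Icc j p).map (Equiv.swap p i).toEmbedding = insert i (Finset.Ico j p) := by
    ext x
    rw [Finset.mem_map_equiv, Equiv.symm_swap, Equiv.swap_apply_def]
    split_ifs <;> simp only [Finset.mem_Icc, Finset.mem_insert, Finset.mem_Ico,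
      Fin.le_def, Fin.lt_def, Fin.ext_iff] at * <;> omega
  have h2 : Finset.Icc j p = insert p (Finset.Ico j p) := by
    ext x
    simp only [Finset.mem_Icc, Finset.mem_insert, Finset.mem_Ico, Fin.le_def, Fin.lt_def,
      Fin.ext_iff]
    omega
  have h3 : Finset.Icc j i = insert i (insert p (Finset.Ico j p)) := by
    ext x
    simp only [Finset.mem_Icc, Finset.mem_insert, Finset.mem_Ico, Fin.le_def, Fin.lt_def,
      Fin.ext_iff]
    omega
  rw [h1, h2, h3, ← map_smul, hSet_sub _ (by simp only [ne_eq, Fin.ext_iff]; omega)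
    (by simp only [Finset.mem_Ico, Fin.le_def, Fin.lt_def]; omega) (by simp), map_sub]
  abel

/-- The mirror image of `map_swap_Icc_col`: the left end i is replaced by the preceding index p. -/
lemma map_swap_Icc_row (hp : p.val + 1 = i.val) {l : Fin n} (hl : i ≤ l) :
    extSym n (hSet ((Finset.Icc i l).map (Equiv.swap p i).toEmbedding)) =
      extSym n (hSet (Finset.Icc i l)) -
        (bb i - bb p : RT n) • extSym n (hSet (Finset.Icc p l)) := by
  have hl' : i.val ≤ l.val := hl
  have h1 : (Finset.Icc i l).map (Equiv.swap p i).toEmbedding = insert p (Finset.Ioc i l) := by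
    ext x
    rw [Finset.mem_map_equiv, Equiv.symm_swap, Equiv.swap_apply_def]
    split_ifs <;> simp only [Finset.mem_Icc, Finset.mem_insert, Finset.mem_Ioc,
      Fin.le_def, Fin.lt_def, Fin.ext_iff] at * <;> omega
  have h2 : Finset.Icc i l = insert i (Finset.Ioc i l) := by
    ext x
    simp only [Finset.mem_Icc, Finset.mem_insert, Finset.mem_Ioc, Fin.le_def, Fin.lt_def,
      Fin.ext_iff]
    omega
  have h3 : Finset.Icc p l = insert i (insert p (Finset.Ioc i l)) := by
    ext x
    simp only [Finset.mem_Icc, Finset.mem_insert, Finset.mem_Ioc, Fin.le_def, Fin.lt_def,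
      Fin.ext_iff]
    omega
  rw [h1, h2, h3, ← map_smul, hSet_sub _ (by simp only [ne_eq, Fin.ext_iff]; omega)
    (by simp) (by simp only [Finset.mem_Ioc, Fin.le_def, Fin.lt_def]; omega), map_sub]
  abel

/-- Since p and i are adjacent, such an interval contains both of them or neither. -/
lemma map_swap_Icc_other (hp : p.val + 1 = i.val) {j l : Fin n} (hl : l ≠ p) (hj : j ≠ i) :
    (Finset.Icc j l).map (Equiv.swap p i).toEmbedding = Finset.Icc j l := by
  have hl' : l.val ≠ p.val := fun h => hl (Fin.ext h)
  have hj' : j.val ≠ i.val := fun h => hj (Fin.ext h)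
  ext x
  rw [Finset.mem_map_equiv, Equiv.symm_swap, Equiv.swap_apply_def]
  split_ifs <;> simp only [Finset.mem_Icc,
      Fin.le_def, Fin.ext_iff] at * <;> omega

/-- The image of `𝒪(𝒵)` is stable under the divided differences of the simple transpositions. -/
lemma permSym_swap_sub (hp : p.val + 1 = i.val) (f : OZ n) : ∃ g : OZ n,
    permSym (Equiv.swap p i) (betaD n f) = betaD n f + (cc (aa p - aa i) : RT n) • betaD n g := by
  have hdiag (k : Fin n) (v : OZ n) (hv : zz n k k * v = 1) :
      betaD n (zz n k k) * betaD n v = 1 := by rw [← map_mul, hv, map_one]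
  have hz (j l : Fin n) (hjl : j ≤ l) : ∃ g : OZ n, permSym (Equiv.swap p i) (betaD n (zz n j l)) =
      betaD n (zz n j l) + (cc (aa p - aa i) : RT n) • betaD n g := by
    rw [betaD_zz hjl, permSym_extSym_hSet]
    by_cases hl : l = p
    · subst hl
      refine ⟨(ex (-aa l) : RT n) • zz n j i, ?_⟩
      rw [map_swap_Icc_col hp hjl, map_smul, smul_smul, mul_comm, ← bb_sub_bb',
        betaD_zz (hjl.trans (Fin.le_def.2 (by omega)))]
    by_cases hj : j = i
    · subst hj
      refine ⟨-(ex (-aa p) : RT n) • zz n p l, ?_⟩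
      rw [map_swap_Icc_row hp hjl, map_smul, smul_smul, mul_comm, neg_mul, ← bb_sub_bb',
        betaD_zz (le_trans (Fin.le_def.2 (by omega)) hjl), neg_smul, sub_eq_add_neg]
    · exact ⟨0, by rw [map_swap_Icc_other hp hl hj, map_zero, smul_zero, add_zero]⟩
  let S : Subring (OZ n) :=
    { carrier := {f | ∃ g : OZ n, permSym (Equiv.swap p i) (betaD n f) =
        betaD n f + (cc (aa p - aa i) : RT n) • betaD n g}
      mul_mem' := by
        rintro f f' ⟨g, hg⟩ ⟨g', hg'⟩
        -- The twisted Leibniz rule: with s(f) = f + cg and s(f') = f' + cg', the product is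
        -- s(f)s(f') = ff' + c(s(f)g' + gf').
        refine ⟨(f + (cc (aa p - aa i) : RT n) • g) * g' + g * f', ?_⟩
        rw [map_mul, map_mul, hg, hg']
        simp only [map_mul, map_add, AlgHom.commutes, Algebra.smul_def]
        ring
      one_mem' := ⟨0, by simp⟩
      add_mem' := by
        rintro f f' ⟨g, hg⟩ ⟨g', hg'⟩
        refine ⟨g + g', ?_⟩
        rw [map_add, map_add, hg, hg', map_add, smul_add]
        abel
      zero_mem' := ⟨0, by simp⟩
      neg_mem' := by
        rintro f ⟨g, hg⟩
        refine ⟨-g, ?_⟩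
        rw [map_neg, map_neg, hg, map_neg, smul_neg]
        abel }
  have hS : S = ⊤ := by
    refine OZ_subring_eq_top S (fun r => ?_) hz fun k v hv => ?_
    · obtain ⟨s, hs⟩ := cc_dvd_swap_smul_sub p i r
      refine ⟨algebraMap _ _ s, ?_⟩
      rw [AlgHom.commutes, permSym_algebraMap, AlgHom.commutes, Algebra.smul_def, ← map_mul, ← hs,
        ← map_add]
      congr 1
      ring
    · obtain ⟨g, hg⟩ := hz k k le_rfl
      obtain ⟨v', hv'⟩ := (isUnit_zz (n := n) (Equiv.swap p i k)).exists_right_inv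
      have h1 := hdiag k v hv
      have h2 := hdiag _ v' hv'
      have h3 : permSym (Equiv.swap p i) (betaD n (zz n k k)) =
          betaD n (zz n (Equiv.swap p i k) (Equiv.swap p i k)) := by
        rw [betaD_diag, betaD_diag, permSym_Om]
      have h4 : permSym (Equiv.swap p i) (betaD n v) = betaD n v' := by
        have : permSym (Equiv.swap p i) (betaD n (zz n k k)) *
            permSym (Equiv.swap p i) (betaD n v) = 1 := by rw [← map_mul, h1, map_one]
        rw [h3] at this
        calc _ = (betaD n (zz n (Equiv.swap p i k) (Equiv.swap p i k)) * betaD n v') *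
            permSym (Equiv.swap p i) (betaD n v) := by rw [h2, one_mul]
          _ = betaD n v' * (betaD n (zz n (Equiv.swap p i k) (Equiv.swap p i k)) *
            permSym (Equiv.swap p i) (betaD n v)) := by ring
          _ = _ := by rw [this, mul_one]
      -- For the inverses v of z and v' of s(z) = z + cg, one has v' - v = -v v' (s(z) - z) = -c v
      -- v' g.
      refine ⟨-(v * v' * g), ?_⟩
      rw [h3] at hg
      rw [h4]
      simp only [map_mul, map_neg, Algebra.smul_def] at hg ⊢
      rw [hg] at h2
      linear_combination (betaD n v) * h2 - (betaD n v') * h1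
  exact (hS ▸ Subring.mem_top f : f ∈ S)

end transpositions

/-! ### The action of 𝕂 on the image of 𝒪(𝒵), and the formula for ĥ -/

section action

variable (n : ℕ) [NeZero n]

lemma val_sub_one_add_one {i : Fin n} (hi : i ≠ 0) : (i - 1).val + 1 = i.val := by
  obtain _ | n := n
  · exact i.elim0
  have : i.val ≠ 0 := fun h => hi (Fin.ext h)
  rw [Fin.val_sub_one_of_ne_zero hi]
  omega

lemma sub_one_ne_of_ne_zero {i : Fin n} (hi : i ≠ 0) : i - 1 ≠ i := fun h => by
  have := val_sub_one_add_one n hi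
  rw [h] at this
  omega

lemma sub_one_ne_self_iff (i : Fin n) : i - 1 = i ↔ (1 : Fin n) = 0 := by simp

/-- This is the case n = 1: the root is 0, so c(α) = 0, and `Ring.inverse` takes the default value 0
there. -/
lemma TT_eq_zero {i : Fin n} (h : i - 1 = i) : TT n i = 0 := by
  have : cc (root n i) = 0 := by rw [root, h, sub_self, cc, ex_zero, sub_self]
  rw [TT, this, map_zero, Ring.inverse_zero, coef_zero, zero_mul]

/-- The action of `T_i` on series, `i ≠ 0`. -/
lemma TT_smul_eq {i : Fin n} (hi : i ≠ 0) (f g : SymSer (RD n))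
    (h : permSym (Equiv.swap (i - 1) i) f = f + (cc (aa (i - 1) - aa i) : RT n) • g) :
    TT n i • f = g := by
  have hu : IsUnit (algebraMap (RT n) (RD n) (cc (root n i))) :=
    isUnit_cc (sub_one_ne_of_ne_zero n hi)
  rw [TT, mul_smul, sub_smul, one_smul, sRefl, if_neg hi, finW_smul_sym, h, add_sub_cancel_left,
    coef_smul, ← algebraMap_smul (RD n) (cc (aa (i - 1) - aa i)) g, smul_smul]
  change (Ring.inverse (algebraMap (RT n) (RD n) (cc (root n i))) *
    algebraMap (RT n) (RD n) (cc (root n i))) • g = g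
  rw [Ring.inverse_mul_cancel _ hu, one_smul]

lemma TT_smul_betaD {i : Fin n} (hi : i ≠ 0) (f : OZ n) :
    ∃ g : OZ n, TT n i • betaD n f = betaD n g := by
  obtain ⟨g, hg⟩ := permSym_swap_sub (val_sub_one_add_one n hi) f
  exact ⟨g, TT_smul_eq n hi _ _ hg⟩

/-- T_i lengthens an interval ending just before i by one index, up to a unit. This produces every
ĥ_{j-i} from the Ω(b_i|y). -/
lemma TT_smul_extSym_hSet {i j : Fin n} (hi : i ≠ 0) (hj : j ≤ i - 1) :
    TT n i • extSym n (hSet (Finset.Icc j (i - 1))) =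
      (ex (-aa (i - 1)) : RT n) • extSym n (hSet (Finset.Icc j i)) := by
  refine TT_smul_eq n hi _ _ ?_
  rw [permSym_extSym_hSet, map_swap_Icc_col (val_sub_one_add_one n hi) hj, smul_smul,
    mul_comm (cc _), ← bb_sub_bb']

lemma rot_apply (i : Fin n) : rot n i = i + 1 := rfl

/-- Conjugation by τ rotates the affine Dynkin diagram. Writing every s_i as a translation, trivial
unless i = 0, times a finite transposition reduces this to comparing the two factors. -/
lemma tau_mul_sRefl (i : Fin n) : tau n * sRefl n i = sRefl n (i + 1) * tau n := by
  have hform (i : Fin n) : sRefl n i =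
      tr (if i = 0 then Pi.single 0 1 - Pi.single (0 - 1) 1 else 0) *
        finW (Equiv.swap (i - 1) i) := by
    rw [sRefl]
    split_ifs with h
    · rw [h]
    · exact (one_mul _).symm
  have hmul (mu nu : Fin n → ℤ) (σ σ' : Equiv.Perm (Fin n)) :
      tr mu * finW σ * (tr nu * finW σ') = tr (mu + latPerm n σ nu) * finW (σ * σ') := by
    rw [mul_assoc, ← mul_assoc (finW σ), finW_tr, mul_assoc, ← finW_mul, ← mul_assoc]
    rfl
  have hlat (σ : Equiv.Perm (Fin n)) (k : Fin n) :
      latPerm n σ (Pi.single k 1) = Pi.single (σ k) 1 := latPerm_aa σ k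
  rw [hform, hform, tau, hmul, hmul]
  congr 1
  · congr 1
    rw [hlat, add_sub_cancel_right]
    -- For n = 1 there is a single index, so the translation parts are compared at that coordinate.
    -- Otherwise only i = 0 and i + 1 = 0 involve the translation of s_0.
    by_cases h1 : (1 : Fin n) = 0
    · have hsub (a b : Fin n) : a = b := by
        have : ∀ a : Fin n, a = 0 := fun a => by rw [← mul_one a, h1, mul_zero]
        rw [this a, this b]
      have (mu nu : Fin n → ℤ) (k : Fin n) (h : mu k = nu k) : mu = nu :=
        funext fun l => hsub k l ▸ h
      refine this _ _ 0 ?_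
      have e (a b : Fin n) : (Pi.single a (1 : ℤ) : Fin n → ℤ) = Pi.single b 1 := by
        rw [hsub a b]
      simp [e _ 0]
    by_cases hi : i = 0
    · subst hi
      rw [if_pos rfl, map_sub, hlat, hlat, rot_apply, rot_apply, zero_add, if_neg h1, zero_add,
        Equiv.swap_apply_left, sub_add_cancel]
      abel
    · rw [if_neg hi, map_zero, add_zero]
      by_cases hi1 : i + 1 = 0
      · have : i = 0 - 1 := by rw [← hi1, add_sub_cancel_right]
        rw [if_pos hi1, hi1, Equiv.swap_apply_right, this]
        abel
      · rw [if_neg hi1, Equiv.swap_apply_of_ne_of_ne (Ne.symm hi) (Ne.symm hi1), zero_add]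
  · congr 1
    rw [Equiv.mul_swap_eq_swap_mul, rot_apply, rot_apply, sub_add_cancel, add_sub_cancel_right]

lemma tau_mul_TT (i : Fin n) : grp (tau n) * TT n i = TT n (i + 1) * grp (tau n) := by
  by_cases h : i - 1 = i
  · rw [TT_eq_zero n h, TT_eq_zero n (i := i + 1), mul_zero, zero_mul]
    rw [sub_one_ne_self_iff] at h ⊢
    exact h
  have h' : i + 1 - 1 ≠ i + 1 := by
    rw [sub_one_ne_self_iff] at h
    rwa [ne_eq, sub_one_ne_self_iff]
  have hu : IsUnit (algebraMap (RT n) (RD n) (cc (root n i))) := isUnit_cc h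
  have hu' : IsUnit (algebraMap (RT n) (RD n) (cc (root n (i + 1)))) := isUnit_cc h'
  have hc : rot n • algebraMap (RT n) (RD n) (cc (root n i)) =
      algebraMap (RT n) (RD n) (cc (root n (i + 1))) := by
    rw [perm_smul_algebraMap, root, perm_smul_cc, rot_apply, rot_apply, root, sub_add_cancel,
      add_sub_cancel_right]
  have hinv : tau n • Ring.inverse (algebraMap (RT n) (RD n) (cc (root n i))) =
      Ring.inverse (algebraMap (RT n) (RD n) (cc (root n (i + 1)))) := by
    have hr : (tau n).right = rot n := one_mul _
    rw [aff_smul, hr]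
    refine hu'.mul_left_cancel ?_
    rw [Ring.mul_inverse_cancel _ hu', ← hc, ← smul_mul', Ring.mul_inverse_cancel _ hu, smul_one]
  rw [TT, ← mul_assoc, grp_coef, hinv, TT, mul_assoc, mul_assoc, mul_sub, sub_mul, grp_mul,
    grp_mul, tau_mul_sRefl, mul_one, one_mul]

/-- The affine operator T_0 never has to be computed: it is obtained from T_1 and the group
elements. -/
lemma TT_zero_eq : TT n 0 = grp (tau n)⁻¹ * TT n 1 * grp (tau n) := by
  have h := tau_mul_TT n 0
  rw [zero_add] at h
  rw [mul_assoc, ← h, ← mul_assoc, grp_mul, inv_mul_cancel, grp_one, one_mul]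

lemma finW_induction {P : Equiv.Perm (Fin n) → Prop}
    (hs : ∀ i : Fin n, i ≠ 0 → P (Equiv.swap (i - 1) i)) (h1 : P 1)
    (hmul : ∀ σ σ', P σ → P σ' → P (σ * σ')) (σ : Equiv.Perm (Fin n)) : P σ := by
  obtain _ | n := n
  · exact absurd rfl (NeZero.ne 0)
  have : σ ∈ Submonoid.closure (Set.range fun i : Fin n ↦ Equiv.swap i.castSucc i.succ) := by
    rw [Equiv.Perm.mclosure_swap_castSucc_succ]; trivial
  induction this using Submonoid.closure_induction with
  | mem x hx =>
    obtain ⟨i, rfl⟩ := hx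
    have h := hs i.succ (Fin.succ_ne_zero i)
    have h2 : i.succ - 1 = i.castSucc := by
      rw [sub_eq_iff_eq_add, Fin.coeSucc_eq_succ]
    rwa [h2] at h
  | one => exact h1
  | mul x y _ _ hx hy => exact hmul x y hx hy

omit [NeZero n] in
lemma aff_eq_tr_mul_finW (w : AffW n) :
    w = tr (Multiplicative.toAdd w.left) * finW w.right :=
  (SemidirectProduct.inl_left_mul_inr_right w).symm

/-- The units `z_ii`. -/
def zzU (i : Fin n) : (OZ n)ˣ := (isUnit_zz i).unit

omit [NeZero n] in
lemma map_betaD_zzU (i : Fin n) :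
    Units.map (betaD n : OZ n →* SymSer (RD n)) (zzU n i) = OmU (bD i) :=
  Units.ext (betaD_diag i)

omit [NeZero n] in
lemma OmPow_eq_betaD (mu : Fin n → ℤ) :
    ((OmPow mu : (SymSer (RD n))ˣ) : SymSer (RD n)) =
      betaD n ((∏ i, zzU n i ^ mu i : (OZ n)ˣ) : OZ n) := by
  have : OmPow mu = Units.map (betaD n : OZ n →* SymSer (RD n)) (∏ i, zzU n i ^ mu i) := by
    rw [map_prod, OmPow]
    exact Finset.prod_congr rfl fun i _ => by rw [map_zpow, map_betaD_zzU]
  exact congrArg Units.val this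

lemma permSym_betaD (σ : Equiv.Perm (Fin n)) (f : OZ n) :
    ∃ g : OZ n, permSym σ (betaD n f) = betaD n g := by
  induction σ using finW_induction n generalizing f with
  | hs i hi =>
    obtain ⟨g, hg⟩ := permSym_swap_sub (val_sub_one_add_one n hi) f
    exact ⟨f + (cc (aa (i - 1) - aa i) : RT n) • g, by rw [hg, map_add, map_smul]⟩
  | h1 => exact ⟨f, permSym_one _⟩
  | hmul σ σ' h h' =>
    obtain ⟨g, hg⟩ := h' f
    obtain ⟨g', hg'⟩ := h g
    exact ⟨g', by rw [permSym_mul, hg, hg']⟩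

lemma grp_smul_betaD (w : AffW n) (f : OZ n) : ∃ g : OZ n, grp w • betaD n f = betaD n g := by
  obtain ⟨g, hg⟩ := permSym_betaD n w.right f
  rw [aff_eq_tr_mul_finW n w, ← grp_mul, mul_smul, finW_smul_sym, hg, tr_smul_sym,
    OmPow_eq_betaD, ← map_mul]
  exact ⟨_, rfl⟩

/-- Induction over generators without T_0, which is a conjugate of T_1 (or 0 for n = 1), and without
a clause for negatives, since -1 comes from R(T). The membership hypotheses allow P to mention
elements of 𝕂 as a subtype. -/
lemma KK_induction {P : KD n → Prop} (hc : ∀ r : RT n, P (coef (algebraMap (RT n) (RD n) r)))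
    (hT : ∀ i : Fin n, i ≠ 0 → P (TT n i)) (hw : ∀ w : AffW n, P (grp w))
    (hadd : ∀ x ∈ KK n, ∀ y ∈ KK n, P x → P y → P (x + y))
    (hmul : ∀ x ∈ KK n, ∀ y ∈ KK n, P x → P y → P (x * y)) (x : KD n) (hx : x ∈ KK n) : P x := by
  have h0 : P 0 := by
    have := hc 0
    rwa [map_zero, coef_zero] at this
  have hneg : P (-1) := by
    have := hc (-1)
    have e : (coef (-1 : RD n) : KD n) = -1 := by
      rw [eq_neg_iff_add_eq_zero, ← coef_one, coef, coef]
      refine (SkewMonoidAlgebra.single_add 1 (-1 : RD n) 1).symm.trans ?_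
      rw [neg_add_cancel]
      exact SkewMonoidAlgebra.single_zero 1
    rwa [map_neg, map_one, e] at this
  have h1 : (-1 : KD n) ∈ KK n := neg_mem (one_mem _)
  induction hx using Subring.closure_induction with
  | mem x hx =>
    obtain (⟨r, rfl⟩ | ⟨i, rfl⟩) | ⟨m, rfl⟩ := hx
    · exact hc r
    · by_cases hi : i = 0
      · subst hi
        by_cases h : (1 : Fin n) = 0
        · rw [TT_eq_zero n (by simp [h])]
          exact h0
        · rw [TT_zero_eq]
          exact hmul _ (mul_mem (grp_mem n _) (TT_mem n 1)) _ (grp_mem n _)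
            (hmul _ (grp_mem n _) _ (TT_mem n 1) (hw _) (hT 1 h)) (hw _)
      · exact hT i hi
    · exact hw _
  | zero => exact h0
  | one => exact hw 1
  | add x y hx hy h h' => exact hadd x hx y hy h h'
  | neg x hx h =>
    rw [neg_eq_neg_one_mul]
    exact hmul _ h1 _ hx hneg h
  | mul x y hx hy h h' => exact hmul x hx y hy h h'

lemma KK_smul_betaD (x : KD n) (hx : x ∈ KK n) (f : OZ n) :
    ∃ g : OZ n, x • betaD n f = betaD n g := by
  refine KK_induction n (P := fun x => ∀ f, ∃ g : OZ n, x • betaD n f = betaD n g)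
    (fun r f => ⟨r • f, by rw [coef_smul, algebraMap_smul, map_smul]⟩)
    (fun i hi f => TT_smul_betaD n hi f) (grp_smul_betaD n)
    (fun x _ y _ hx hy f => ?_) (fun x _ y _ hx hy f => ?_) x hx f
  · obtain ⟨g, hg⟩ := hx f
    obtain ⟨g', hg'⟩ := hy f
    exact ⟨g + g', by rw [add_smul, hg, hg', map_add]⟩
  · obtain ⟨g, hg⟩ := hy f
    obtain ⟨g', hg'⟩ := hx g
    exact ⟨g', by rw [mul_smul, hg, hg']⟩

/-- Induction on j - i: t_{ε_i} sends 1 to the diagonal value Ω(b_i|y), and each further T_j adds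
one index, up to an exponential that R(T) cancels. -/
lemma betaD_zz_mem (i j : Fin n) (hij : i ≤ j) : betaD n (zz n i j) ∈ LambdaN n := by
  induction hm : j.val - i.val generalizing j with
  | zero =>
    have : i = j := le_antisymm hij (Fin.le_def.2 (by omega))
    subst this
    refine ⟨grp (tr (Pi.single i 1)), grp_mem n _, ?_⟩
    rw [tr_single_smul_sym, mul_one, betaD_diag]
  | succ m ih =>
    have hj : j ≠ 0 := fun h => by
      subst h
      simp at hm
    have hv := val_sub_one_add_one n hj
    have hle : i ≤ j - 1 := Fin.le_def.2 (by omega)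
    have h := ih (j - 1) hle (by omega)
    have h2 := smul_mem_LambdaN n ⟨TT n j, TT_mem n j⟩ ⟨_, h⟩
    have h3 : TT n j • betaD n (zz n i (j - 1)) ∈ LambdaN n := h2
    rw [betaD_zz hle, TT_smul_extSym_hSet n hj hle] at h3
    have h4 := (LambdaN n).smul_mem h3 (ex (aa (j - 1)) : RT n)
    rwa [smul_smul, mul_comm, ex_neg_mul, one_smul, ← betaD_zz hij] at h4

/-- The generators z_ij and the inverses of the z_ii go into 𝕂 · 1; conversely the image contains 1
and is stable under 𝕂. -/
lemma range_betaD : (betaD n).range = LambdaN n := by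
  refine le_antisymm ?_ ?_
  · rintro _ ⟨f, rfl⟩
    have h : ((LambdaN n).comap (betaD n)).toSubring = ⊤ := by
      refine OZ_subring_eq_top _ (fun r => ?_) (fun i j hij => betaD_zz_mem n i j hij)
        fun i v hv => ?_
      · exact ((LambdaN n).comap (betaD n)).algebraMap_mem r
      · refine ⟨grp (tr (-Pi.single i 1)), grp_mem n _, ?_⟩
        have h1 : betaD n (zz n i i) * betaD n v = 1 := by rw [← map_mul, hv, map_one]
        have h2 : (OmPow (Pi.single i 1 + -Pi.single i 1 : Fin n → ℤ) : (SymSer (RD n))ˣ) = 1 := by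
          rw [add_neg_cancel]
          simp [OmPow]
        rw [OmPow_add, OmPow_single] at h2
        have h3 : Om (bD i) * (OmPow (-Pi.single i 1 : Fin n → ℤ) : (SymSer (RD n))ˣ) = 1 :=
          congrArg Units.val h2
        rw [tr_smul_sym, mul_one]
        rw [betaD_diag] at h1
        exact (isUnit_Om _).mul_left_cancel (h3.trans h1.symm)
    exact (h ▸ Subring.mem_top f : f ∈ ((LambdaN n).comap (betaD n)).toSubring)
  · rintro _ ⟨x, hx, rfl⟩
    obtain ⟨g, hg⟩ := KK_smul_betaD n x hx 1
    exact ⟨g, by rw [← map_one (betaD n), hg]; rfl⟩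

/-- A Demazure operator is linear over the scalars fixed by its reflection. -/
lemma TT_smul_smul_of_invariant {i : Fin n} (hi : i ≠ 0) (r : RT n) (f : SymSer (RD n))
    (hr : Equiv.swap (i - 1) i • r = r) : TT n i • (r • f) = r • TT n i • f := by
  simp only [TT, mul_smul, sub_smul, one_smul, coef_smul, sRefl, if_neg hi, finW_smul_sym,
    permSym_smul', hr]
  rw [← smul_sub, smul_comm]

/-- Moving τ to the right past each operator raises its index by one, so T_l ⋯ T_1 acts on τ(1) =
Ω(b|y) with the first parameter b. Each operator adds an index to the interval and contributes one
exponential. -/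
lemma tau_smul_gRho (l : Fin n) : grp (tau n) • gRho n l.val =
    (ex (-∑ k ∈ Finset.Ico 0 l, aa k) : RT n) • extSym n (hSet (Finset.Icc 0 l)) := by
  induction hl : l.val generalizing l with
  | zero =>
    have : l = 0 := Fin.ext hl
    subst this
    rw [gRho, tau, ← grp_mul, mul_smul, finW_smul_sym, map_one, tr_single_smul_sym, mul_one,
      Finset.Ico_self, Finset.sum_empty, neg_zero, ex_zero, one_smul, ← betaD_zz le_rfl, betaD_diag]
  | succ m ih =>
    have hl0 : l ≠ 0 := fun h => by
      subst h
      simp at hl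
    have hv := val_sub_one_add_one n hl0
    have hm : (l - 1).val = m := by omega
    -- The reduction modulo n in `gRho` has no effect, because the index is below n.
    have hm' : Fin.ofNat n m = l - 1 := by
      rw [← hm]
      exact Fin.ext (Nat.mod_eq_of_lt (l - 1).isLt)
    have h0 : (0 : Fin n).val = 0 := Fin.val_zero n
    have hIco : Finset.Ico 0 l = insert (l - 1) (Finset.Ico 0 (l - 1)) := by
      ext x
      simp only [Finset.mem_insert, Finset.mem_Ico, Fin.le_def, Fin.lt_def, Fin.ext_iff]
      omega
    rw [gRho, ← mul_smul, hm', tau_mul_TT, sub_add_cancel, mul_smul, ih (l - 1) hm,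
      TT_smul_smul_of_invariant n hl0, TT_smul_extSym_hSet n hl0 (Fin.zero_le _), smul_smul,
      ← ex_add, hIco, Finset.sum_insert (by simp), neg_add_rev]
    -- The accumulated exponential involves only indices below l - 1, so it is fixed by the
    -- transposition of l - 1 and l and can be taken out of the operator.
    · rw [perm_smul_ex, map_neg, map_sum]
      congr 2
      refine Finset.sum_congr rfl fun k hk => ?_
      rw [latPerm_aa, Equiv.swap_apply_of_ne_of_ne]
      · exact (Finset.mem_Ico.1 hk).2.ne
      · rintro rfl
        have := (Finset.mem_Ico.1 hk).2
        rw [Fin.lt_def] at this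
        omega

lemma rot_pow_apply (m : ℕ) (k : Fin n) (h : k.val + m < n) :
    (rot n ^ m) k = ⟨k.val + m, h⟩ := by
  induction m with
  | zero => rfl
  | succ m ih =>
    rw [pow_succ', Equiv.Perm.mul_apply, ih (by omega), rot_apply]
    obtain _ | n := n
    · exact k.elim0
    refine Fin.ext ?_
    rw [Fin.val_add_one_of_lt (Fin.lt_def.2 (by simp only [Fin.val_last]; omega))]
    rfl

lemma rot_pow_map_Icc (i j : Fin n) (hij : i ≤ j) :
    (Finset.Icc 0 (⟨j.val - i.val, by omega⟩ : Fin n)).map (rot n ^ i.val).toEmbedding =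
      Finset.Icc i j := by
  have hij' : i.val ≤ j.val := hij
  ext x
  simp only [Finset.mem_map, Finset.mem_Icc, Equiv.coe_toEmbedding]
  constructor
  · rintro ⟨k, ⟨_, hk⟩, rfl⟩
    have hk' : k.val ≤ j.val - i.val := hk
    rw [rot_pow_apply n _ _ (by omega)]
    simp only [Fin.le_def]
    omega
  · rintro ⟨h1, h2⟩
    rw [Fin.le_def] at h1 h2
    refine ⟨⟨x.val - i.val, by omega⟩, ⟨Fin.zero_le _, Fin.le_def.2 (by simp only; omega)⟩, ?_⟩
    rw [rot_pow_apply n _ _ (by simp only; omega)]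
    exact Fin.ext (by simp only; omega)

lemma rot_pow_map_Ico (i j : Fin n) (hij : i ≤ j) :
    (Finset.Ico 0 (⟨j.val - i.val, by omega⟩ : Fin n)).map (rot n ^ i.val).toEmbedding =
      Finset.Ico i j := by
  have hij' : i.val ≤ j.val := hij
  ext x
  simp only [Finset.mem_map, Finset.mem_Ico, Equiv.coe_toEmbedding]
  constructor
  · rintro ⟨k, ⟨_, hk⟩, rfl⟩
    have hk' : k.val < j.val - i.val := hk
    rw [rot_pow_apply n _ _ (by omega)]
    simp only [Fin.le_def, Fin.lt_def]
    omega
  · rintro ⟨h1, h2⟩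
    rw [Fin.le_def] at h1
    rw [Fin.lt_def] at h2
    refine ⟨⟨x.val - i.val, by omega⟩, ⟨Fin.zero_le _, Fin.lt_def.2 (by simp only; omega)⟩, ?_⟩
    rw [rot_pow_apply n _ _ (by simp only; omega)]
    exact Fin.ext (by simp only; omega)

/-- The case of the first row, rotated by ω^i. As τ = t_{ε_1} ω already contains one rotation, g is
rotated i + 1 times for a zero-based i, that is, as often as the one-based index says. -/
lemma extSym_hSet_eq_gRho (i j : Fin n) (hij : i ≤ j) : extSym n (hSet (Finset.Icc i j)) =
    (ex (∑ k ∈ Finset.Ico i j, aa k) : RT n) •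
      (Om (bD i) * rotPow n (i.val + 1) (gRho n (j.val - i.val))) := by
  have h := congrArg (permSym (rot n ^ i.val)) (tau_smul_gRho n ⟨j.val - i.val, by omega⟩)
  have hrot : (rot n ^ i.val) 0 = i := by
    rw [rot_pow_apply n _ _ (by simp)]
    exact Fin.ext (by simp)
  rw [permSym_smul', permSym_extSym_hSet, rot_pow_map_Icc n i j hij, tau, ← grp_mul, mul_smul,
    finW_smul_sym, tr_single_smul_sym, map_mul, permSym_Om, hrot, ← permSym_mul, ← pow_succ,
    perm_smul_ex, map_neg, map_sum] at h
  have hsum : ∑ k ∈ Finset.Ico 0 (⟨j.val - i.val, by omega⟩ : Fin n),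
      latPerm n (rot n ^ i.val) (aa k) = ∑ k ∈ Finset.Ico i j, aa k := by
    rw [← rot_pow_map_Ico n i j hij, Finset.sum_map]
    exact Finset.sum_congr rfl fun k _ => latPerm_aa _ _
  rw [hsum] at h
  change _ = _ • (_ * permSym (rot n ^ (i.val + 1)) _)
  rw [h, smul_smul, mul_comm, ex_neg_mul, one_smul]

end action

/-! ### The ring `R(T)^Δ` is a Noetherian domain -/

section domain

variable {n : ℕ}

lemma ex_injective (n : ℕ) : Function.Injective (ex : (Fin n → ℤ) → RT n) :=
  AddMonoidAlgebra.single_left_injective one_ne_zero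

lemma aa_injective (n : ℕ) : Function.Injective (aa : Fin n → (Fin n → ℤ)) := fun i j h => by
  by_contra hne
  have := congrFun h i
  simp [aa, hne] at this

lemma cc_ne_zero {alpha : Fin n → ℤ} (h : alpha ≠ 0) : (cc alpha : RT n) ≠ 0 := fun h0 => by
  rw [cc, sub_eq_zero, ← ex_zero] at h0
  exact h (ex_injective n h0.symm)

lemma rootSet_le_nonZeroDivisors (n : ℕ) : rootSet n ≤ nonZeroDivisors (RT n) := by
  refine Submonoid.closure_le.2 ?_
  rintro _ ⟨i, j, hij, rfl⟩
  refine mem_nonZeroDivisors_of_ne_zero (cc_ne_zero fun h => hij (aa_injective n ?_))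
  rwa [sub_eq_zero] at h

instance isDomainRD (n : ℕ) : IsDomain (RD n) :=
  IsLocalization.isDomain_of_le_nonZeroDivisors _ (rootSet_le_nonZeroDivisors n)

lemma algebraMap_RD_injective (n : ℕ) : Function.Injective (algebraMap (RT n) (RD n)) :=
  IsLocalization.injective _ (rootSet_le_nonZeroDivisors n)

instance isNoetherianRingRT (n : ℕ) : IsNoetherianRing (RT n) :=
  Algebra.FiniteType.isNoetherianRing ℤ _

instance isNoetherianRingRD (n : ℕ) : IsNoetherianRing (RD n) :=
  IsLocalization.isNoetherianRing (rootSet n) _ inferInstance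

lemma bD_injective (n : ℕ) : Function.Injective (bD : Fin n → RD n) := fun i j h => by
  have h1 := algebraMap_RD_injective n h
  rw [bb, bb, sub_right_inj] at h1
  exact aa_injective n (neg_injective (ex_injective n h1))

lemma bD_ne_zero (i : Fin n) : (bD i : RD n) ≠ 0 := fun h => by
  rw [bD, map_eq_zero_iff _ (algebraMap_RD_injective n), bb, sub_eq_zero, ← ex_zero] at h
  have := congrFun (ex_injective n h) i
  simp [aa] at this

end domain

/-- The kernels of the powers of f stabilize at some m. An element of the kernel of f has the form
f^m(y); then y is in the kernel of f^{m+1}, hence of f^m. -/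
lemma RingHom.injective_of_surjective_of_isNoetherianRing {S : Type*} [CommRing S]
    [IsNoetherianRing S] (f : S →+* S) (hf : Function.Surjective f) : Function.Injective f := by
  have hpow (m : ℕ) (x : S) : (f ^ m) x = f^[m] x := by
    rw [RingHom.coe_pow]
  let K : ℕ →o Ideal S :=
    { toFun := fun m => RingHom.ker (f ^ m)
      monotone' := monotone_nat_of_le_succ fun m x hx => by
        rw [RingHom.mem_ker, hpow] at hx ⊢
        rw [Function.iterate_succ_apply', hx, map_zero] }
  obtain ⟨m, hm⟩ := monotone_stabilizes_iff_noetherian.2 ‹IsNoetherianRing S› K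
  refine (injective_iff_map_eq_zero f).2 fun x hx => ?_
  obtain ⟨y, rfl⟩ := hf.iterate m x
  have h1 : y ∈ K (m + 1) := by
    change y ∈ RingHom.ker (f ^ (m + 1))
    rwa [RingHom.mem_ker, hpow, Function.iterate_succ_apply']
  rw [← hm (m + 1) (by omega)] at h1
  change y ∈ RingHom.ker (f ^ m) at h1
  rwa [RingHom.mem_ker, hpow] at h1

/-! ### Coproducts of symmetric series -/

section coproduct

/-- The monomial `y^d y'^{d'}`. -/
def pairIdx (d d' : ℕ →₀ ℕ) : ℕ ⊕ ℕ →₀ ℕ :=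
  Finsupp.embDomain Function.Embedding.inl d + Finsupp.embDomain Function.Embedding.inr d'

lemma pairIdx_inl (d d' : ℕ →₀ ℕ) (k : ℕ) : pairIdx d d' (Sum.inl k) = d k := by
  have h1 := Finsupp.embDomain_apply_self (Function.Embedding.inl : ℕ ↪ ℕ ⊕ ℕ) d k
  have h2 := Finsupp.embDomain_of_notMem_range (Function.Embedding.inr : ℕ ↪ ℕ ⊕ ℕ) d' (Sum.inl k)
    (by simp)
  simp only [Function.Embedding.inl_apply] at h1
  rw [pairIdx, Finsupp.add_apply, h1, h2, add_zero]

lemma pairIdx_inr (d d' : ℕ →₀ ℕ) (k : ℕ) : pairIdx d d' (Sum.inr k) = d' k := by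
  have h1 := Finsupp.embDomain_apply_self (Function.Embedding.inr : ℕ ↪ ℕ ⊕ ℕ) d' k
  have h2 := Finsupp.embDomain_of_notMem_range (Function.Embedding.inl : ℕ ↪ ℕ ⊕ ℕ) d (Sum.inr k)
    (by simp)
  simp only [Function.Embedding.inr_apply] at h1
  rw [pairIdx, Finsupp.add_apply, h1, h2, zero_add]

lemma exists_pairIdx (x : ℕ ⊕ ℕ →₀ ℕ) : ∃ d d', pairIdx d d' = x := by
  refine ⟨(Finsupp.sumFinsuppEquivProdFinsupp x).1, (Finsupp.sumFinsuppEquivProdFinsupp x).2, ?_⟩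
  ext (k | k)
  · rw [pairIdx_inl, Finsupp.fst_sumFinsuppEquivProdFinsupp]
  · rw [pairIdx_inr, Finsupp.snd_sumFinsuppEquivProdFinsupp]

lemma degree_pairIdx (d d' : ℕ →₀ ℕ) : (pairIdx d d').degree = d.degree + d'.degree := by
  rw [pairIdx, map_add, Finsupp.embDomain_eq_mapDomain, Finsupp.embDomain_eq_mapDomain,
    Finsupp.degree_mapDomain, Finsupp.degree_mapDomain]

lemma embDomain_symm_embDomain {α β : Type*} (e : α ≃ β) (x : α →₀ ℕ) :
    Finsupp.embDomain e.symm.toEmbedding (Finsupp.embDomain e.toEmbedding x) = x := by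
  rw [Finsupp.embDomain_eq_mapDomain, Finsupp.embDomain_eq_mapDomain, ← Finsupp.mapDomain_comp]
  have : (e.symm.toEmbedding ∘ e.toEmbedding : α → α) = id := funext e.symm_apply_apply
  rw [this, Finsupp.mapDomain_id]

variable {n : ℕ}

/-- A pair of monomials contributes to the product only if the first is in y alone and the second in
y' alone, which leaves one pair. -/
lemma coeff_renameL_mul_renameR (f g : MvPowerSeries ℕ (RD n)) (d d' : ℕ →₀ ℕ) :
    MvPowerSeries.coeff (pairIdx d d') (renameL n f * renameR n g) =
      MvPowerSeries.coeff d f * MvPowerSeries.coeff d' g := by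
  classical
  rw [MvPowerSeries.coeff_mul, Finset.sum_eq_single
    (Finsupp.embDomain Function.Embedding.inl d, Finsupp.embDomain Function.Embedding.inr d')]
  · congr 1
    · exact MvPowerSeries.coeff_embDomain_rename _ f d
    · exact MvPowerSeries.coeff_embDomain_rename _ g d'
  · rintro ⟨p, q⟩ hpq hne
    rw [Finset.HasAntidiagonal.mem_antidiagonal] at hpq
    by_cases hp : p ∈ Set.range (Finsupp.mapDomain (Function.Embedding.inl : ℕ ↪ ℕ ⊕ ℕ))
    · by_cases hq : q ∈ Set.range (Finsupp.mapDomain (Function.Embedding.inr : ℕ ↪ ℕ ⊕ ℕ))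
      · refine absurd ?_ hne
        obtain ⟨a, rfl⟩ := hp
        obtain ⟨b, rfl⟩ := hq
        rw [← Finsupp.embDomain_eq_mapDomain, ← Finsupp.embDomain_eq_mapDomain] at hpq ⊢
        change pairIdx a b = pairIdx d d' at hpq
        have ha : a = d := by
          ext k
          rw [← pairIdx_inl a b, hpq, pairIdx_inl]
        have hb : b = d' := by
          ext k
          rw [← pairIdx_inr a b, hpq, pairIdx_inr]
        rw [ha, hb]
      · have : MvPowerSeries.coeff q (renameR n g) = 0 :=
          MvPowerSeries.coeff_rename_eq_zero _ g hq
        rw [this, mul_zero]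
    · have : MvPowerSeries.coeff p (renameL n f) = 0 :=
        MvPowerSeries.coeff_rename_eq_zero _ f hp
      rw [this, zero_mul]
  · intro h
    exact absurd (Finset.HasAntidiagonal.mem_antidiagonal.2 (by rw [pairIdx])) h

/-- The coproduct of symmetric series as a homomorphism of algebras. -/
def coprodHom (n : ℕ) : SymSer (RD n) →ₐ[RT n] MvPowerSeries (ℕ ⊕ ℕ) (RD n) :=
  ((MvPowerSeries.rename (R := RD n) Equiv.natSumNatEquivNat.symm).restrictScalars (RT n)).comp
    (toSeries (RT n))

lemma coprodHom_apply (f : SymSer (RD n)) : coprodHom n f = coprodSym f := rfl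

lemma coeff_coprodSym (f : SymSer (RD n)) (x : ℕ ⊕ ℕ →₀ ℕ) :
    MvPowerSeries.coeff x (coprodSym f) =
      MvPowerSeries.coeff (Finsupp.embDomain Equiv.natSumNatEquivNat.toEmbedding x)
        (toSeries (RT n) f) := by
  obtain ⟨y, rfl⟩ : ∃ y, Finsupp.embDomain Equiv.natSumNatEquivNat.symm.toEmbedding y = x :=
    ⟨x.embDomain Equiv.natSumNatEquivNat.toEmbedding,
      embDomain_symm_embDomain Equiv.natSumNatEquivNat x⟩
  refine (MvPowerSeries.coeff_embDomain_rename (R := RD n)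
    Equiv.natSumNatEquivNat.symm.toEmbedding (toSeries (RD n) f) y).trans ?_
  rw [show Finsupp.embDomain Equiv.natSumNatEquivNat.toEmbedding
    (Finsupp.embDomain Equiv.natSumNatEquivNat.symm.toEmbedding y) = y from
    embDomain_symm_embDomain Equiv.natSumNatEquivNat.symm y]
  rfl

/-- The symmetric series with `f(y, y') = f(y) f(y')` and `f(0) = 1`. -/
def groupLike (n : ℕ) : Submonoid (SymSer (RD n)) where
  carrier := {f | coprodSym f = renameL n (toSeries (RT n) f) * renameR n (toSeries (RT n) f) ∧
    MvPowerSeries.constantCoeff (toSeries (RT n) f) = 1}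
  mul_mem' := by
    rintro f g ⟨hf, hf'⟩ ⟨hg, hg'⟩
    constructor
    · rw [← coprodHom_apply] at hf hg ⊢
      simp only [map_mul, hf, hg]
      ring
    · rw [map_mul, map_mul, hf', hg', one_mul]
  one_mem' := by
    constructor
    · rw [← coprodHom_apply]
      simp only [map_one, one_mul]
    · rw [map_one, map_one]

lemma Om_mem_groupLike (b : RD n) : Om b ∈ groupLike n := by
  constructor
  · ext x
    obtain ⟨d, d', rfl⟩ := exists_pairIdx x
    rw [coeff_coprodSym, coeff_renameL_mul_renameR, Finsupp.embDomain_eq_mapDomain]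
    change b ^ _ = b ^ _ * b ^ _
    rw [Finsupp.degree_mapDomain, degree_pairIdx, pow_add]
  · rw [← MvPowerSeries.coeff_zero_eq_constantCoeff_apply]
    change b ^ (Finsupp.degree (0 : ℕ →₀ ℕ)) = 1
    rw [map_zero, pow_zero]

/-- Group-like series are linearly independent. -/
lemma linearIndependent_groupLike (n : ℕ) :
    LinearIndependent (RD n) (fun f : groupLike n => (f : SymSer (RD n))) := by
  -- For a group-like f, a product of coefficients is again one coefficient of f, at an exponent
  -- that does not depend on f. Thus f defines a character of the free monoid on exponents, and
  -- Dedekind's lemma applies.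
  have hidx (w : List (ℕ →₀ ℕ)) : ∃ e : ℕ →₀ ℕ, ∀ f : groupLike n,
      (w.map fun d => MvPowerSeries.coeff d (toSeries (RT n) (f : SymSer (RD n)))).prod =
        MvPowerSeries.coeff e (toSeries (RT n) (f : SymSer (RD n))) := by
    induction w with
    | nil => exact ⟨0, fun f => by
        rw [MvPowerSeries.coeff_zero_eq_constantCoeff_apply, f.2.2]; rfl⟩
    | cons d w ih =>
      obtain ⟨e, he⟩ := ih
      refine ⟨Finsupp.embDomain Equiv.natSumNatEquivNat.toEmbedding (pairIdx d e), fun f => ?_⟩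
      rw [List.map_cons, List.prod_cons, he, ← coeff_coprodSym, f.2.1, coeff_renameL_mul_renameR]
  choose e he using hidx
  let χ (f : groupLike n) : FreeMonoid (ℕ →₀ ℕ) →* RD n := FreeMonoid.lift fun d =>
    MvPowerSeries.coeff d (toSeries (RT n) (f : SymSer (RD n)))
  have hχ : Function.Injective χ := fun f g h => by
    refine Subtype.ext (Subtype.ext ?_)
    ext d
    have := congrArg (fun F => F (FreeMonoid.of d)) h
    simp only [χ, FreeMonoid.lift_eval_of] at this
    exact this
  -- Reading off the coefficients at these exponents is linear and sends f to its character, so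
  -- independence of the characters pulls back.
  let Φ : SymSer (RD n) →ₗ[RD n] (FreeMonoid (ℕ →₀ ℕ) → RD n) := LinearMap.pi fun w =>
    (MvPowerSeries.coeff (e w.toList)).comp (toSeries (RD n)).toLinearMap
  refine LinearIndependent.of_comp Φ ?_
  convert! (linearIndependent_monoidHom (FreeMonoid (ℕ →₀ ℕ)) (RD n)).comp χ hχ using 1
  ext f w
  exact (he w.toList f).symm.trans (FreeMonoid.lift_apply _ w).symm

end coproduct

/-! ### Algebraic independence -/

section independence

variable {n : ℕ}

/-- The restriction of a symmetric series to one variable. -/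
def oneVar (n : ℕ) : SymSer (RD n) →ₐ[RD n] PowerSeries (RD n) :=
  (MvPowerSeries.killCompl (⟨fun _ => 0, fun _ _ _ => rfl⟩ : Unit ↪ ℕ)).comp (toSeries (RD n))

lemma oneVar_Om (b : RD n) : oneVar n (Om b) = PowerSeries.mk fun k => b ^ k := by
  ext k
  rw [PowerSeries.coeff_mk]
  change b ^ (Finsupp.degree (Finsupp.embDomain _ (Finsupp.single () k))) = b ^ k
  rw [Finsupp.embDomain_single, Finsupp.degree_single]

lemma mul_oneVar_Om (b : RD n) :
    ((1 - Polynomial.C b * Polynomial.X : Polynomial (RD n)) : PowerSeries (RD n)) *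
      oneVar n (Om b) = 1 := by
  rw [oneVar_Om]
  ext k
  push_cast
  rw [sub_mul, one_mul, mul_assoc, map_sub, PowerSeries.coeff_C_mul, PowerSeries.coeff_mk]
  cases k with
  | zero => simp
  | succ k =>
    rw [PowerSeries.coeff_succ_X_mul, PowerSeries.coeff_mk, PowerSeries.coeff_one,
      if_neg (Nat.succ_ne_zero k), pow_succ']
    ring

/-- Unique factorization by hand: the factors have the distinct roots 1/b_i in the fraction field,
so multiplicities can be compared root by root. -/
lemma prod_one_sub_injective : Function.Injective fun m : Fin n →₀ ℕ =>
    ∏ i, (1 - Polynomial.C (bD i) * Polynomial.X : Polynomial (RD n)) ^ m i := by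
  suffices h : ∀ (m m' : Fin n →₀ ℕ) (i : Fin n),
      ∏ i, (1 - Polynomial.C (bD i) * Polynomial.X : Polynomial (RD n)) ^ m i =
      ∏ i, (1 - Polynomial.C (bD i) * Polynomial.X : Polynomial (RD n)) ^ m' i → m' i ≤ m i by
    intro m m' e
    ext i
    exact le_antisymm (h m' m i e.symm) (h m m' i e)
  intro m m' i e
  by_contra! hlt
  have hfac (k : Fin n) : (1 - Polynomial.C (bD k) * Polynomial.X : Polynomial (RD n)) ≠ 0 :=
    fun h => by simpa using congrArg (Polynomial.eval 0) h
  rw [← Finset.mul_prod_erase _ _ (Finset.mem_univ i), ← Finset.mul_prod_erase _ _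
    (Finset.mem_univ i), ← Nat.add_sub_cancel' hlt.le, pow_add, mul_assoc] at e
  have e' := mul_left_cancel₀ (pow_ne_zero _ (hfac i)) e
  -- After the common power of the i-th factor is cancelled, the right side vanishes at 1/b_i,
  -- whereas the left side contains only the other factors.
  have e2 := congrArg (Polynomial.eval₂ (algebraMap (RD n) (FractionRing (RD n)))
    (algebraMap (RD n) (FractionRing (RD n)) (bD i))⁻¹) e'
  have hb (k : Fin n) : algebraMap (RD n) (FractionRing (RD n)) (bD k) ≠ 0 := fun h =>
    bD_ne_zero k ((map_eq_zero_iff _ (IsFractionRing.injective _ _)).1 h)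
  rw [Polynomial.eval₂_mul, Polynomial.eval₂_pow, Polynomial.eval₂_finsetProd] at e2
  simp only [Polynomial.eval₂_pow, Polynomial.eval₂_sub, Polynomial.eval₂_one, Polynomial.eval₂_mul,
    Polynomial.eval₂_C, Polynomial.eval₂_X, mul_inv_cancel₀ (hb i), sub_self] at e2
  rw [zero_pow (by omega), zero_mul, Finset.prod_eq_zero_iff] at e2
  obtain ⟨k, hk, h0⟩ := e2
  have h1 := eq_zero_of_pow_eq_zero h0
  rw [sub_eq_zero, ← div_eq_mul_inv, eq_comm, div_eq_one_iff_eq (hb i)] at h1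
  exact (Finset.mem_erase.1 hk).1 (bD_injective n (IsFractionRing.injective _ _ h1))

/-- In one variable Ω(b) becomes the inverse of 1 - bx, so equal products of the Ω(b_i) give equal
products of these polynomials. -/
lemma prod_Om_injective : Function.Injective fun m : Fin n →₀ ℕ =>
    ∏ i, Om (bD i : RD n) ^ m i := by
  have key (m : Fin n →₀ ℕ) : ((∏ i, (1 - Polynomial.C (bD i) * Polynomial.X :
      Polynomial (RD n)) ^ m i : Polynomial (RD n)) : PowerSeries (RD n)) *
        oneVar n (∏ i, Om (bD i : RD n) ^ m i) = 1 := by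
    rw [map_prod, ← Polynomial.coeToPowerSeries.ringHom_apply, map_prod, ← Finset.prod_mul_distrib]
    refine Finset.prod_eq_one fun i _ => ?_
    rw [map_pow, map_pow, ← mul_pow, Polynomial.coeToPowerSeries.ringHom_apply, mul_oneVar_Om,
      one_pow]
  intro m m' h
  refine prod_one_sub_injective ?_
  have h' : ∏ i, Om (bD i : RD n) ^ m i = ∏ i, Om (bD i : RD n) ^ m' i := h
  refine Polynomial.coe_injective (RD n) ?_
  have h1 := key m
  have h2 := key m'
  rw [h'] at h1
  exact (IsUnit.of_mul_eq_one_right _ h2).mul_right_cancel (h1.trans h2.symm)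

/-- The series `Ω(b_i|y)` are algebraically independent. -/
lemma aeval_Om_injective (n : ℕ) : Function.Injective
    (MvPolynomial.aeval (fun i => Om (bD i)) : MvPolynomial (Fin n) (RD n) →ₐ[RD n] _) := by
  -- Monomials in the Ω(b_i) are group-like, and they are pairwise distinct by `prod_Om_injective`.
  have hli : LinearIndependent (RD n) fun m : Fin n →₀ ℕ => ∏ i, Om (bD i : RD n) ^ m i :=
    (linearIndependent_groupLike n).comp
      (fun m : Fin n →₀ ℕ => ⟨∏ i, Om (bD i : RD n) ^ m i, Submonoid.prod_mem _ fun i _ =>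
        Submonoid.pow_mem _ (Om_mem_groupLike _) _⟩)
      fun m m' h => prod_Om_injective (congrArg Subtype.val h)
  refine (injective_iff_map_eq_zero _).2 fun p hp => ?_
  rw [MvPolynomial.aeval_def, MvPolynomial.eval₂_eq'] at hp
  simp_rw [← Algebra.smul_def] at hp
  rw [linearIndependent_iff'] at hli
  have := hli p.support (fun m => p.coeff m) hp
  ext m
  by_cases hm : m ∈ p.support
  · exact this m hm
  · simpa using hm

end independence

/-! ### Injectivity on 𝒪(𝒵) and on its tensor square -/

section injectivity

variable (n : ℕ)

lemma isUnit_bb_sub_bb {n : ℕ} {i j : Fin n} (h : i ≠ j) :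
    IsUnit (algebraMap (RT n) (RD n) (bb i - bb j)) := by
  rw [bb_sub_bb, map_mul]
  refine IsUnit.mul (IsUnit.map _ (IsUnit.neg ?_)) (isUnit_cc h)
  exact IsUnit.of_mul_eq_one _ (ex_neg_mul (aa i))

variable [NeZero n]

/-- The series `ĥ_{j-1}(y|b_1, …, b_j)` are algebraically independent. -/
lemma aeval_row_injective : Function.Injective
    (MvPolynomial.aeval (fun j => betaD n (zz n 0 j)) :
      MvPolynomial (Fin n) (RD n) →ₐ[RD n] SymSer (RD n)) := by
  set Φ := (MvPolynomial.aeval (fun j => betaD n (zz n 0 j)) :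
      MvPolynomial (Fin n) (RD n) →ₐ[RD n] SymSer (RD n)) with hΦ
  set Ψ := (MvPolynomial.aeval (fun i => Om (bD i)) :
      MvPolynomial (Fin n) (RD n) →ₐ[RD n] SymSer (RD n)) with hΨ
  have hrel := (centralizerRel_zz n).map (betaD n)
  -- Over R(T)^Δ the first row and the diagonal generate each other: this direction divides by b_i -
  -- b_j, and `hdiag` uses the recursion without division.
  have hrow (j : Fin n) : betaD n (zz n 0 j) ∈ Ψ.range := by
    refine hrel.mem_of_diag Ψ.range.toSubmodule.toAddSubgroup (fun i j x hne hx => ?_)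
      (fun i => ⟨MvPolynomial.X i, ?_⟩) 0 j (Fin.zero_le j)
    · rw [← algebraMap_smul (RD n)] at hx
      exact (Submodule.smul_mem_iff_of_isUnit Ψ.range.toSubmodule (isUnit_bb_sub_bb hne)).1 hx
    · rw [Matrix.map_apply, betaD_diag]
      exact MvPolynomial.aeval_X _ i
  have hdiag (i : Fin n) : Om (bD i) ∈ Φ.range := by
    have := hrel.mem_of_row (Φ.range.toSubmodule.restrictScalars (RT n))
      (fun j => ⟨MvPolynomial.X j, MvPolynomial.aeval_X _ j⟩) i i le_rfl
    rwa [Matrix.map_apply, betaD_diag] at this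
  choose v hv using hrow
  have hcomp (p : MvPolynomial (Fin n) (RD n)) : Ψ (MvPolynomial.aeval v p) = Φ p := by
    have : Ψ.comp (MvPolynomial.aeval v) = Φ := by
      refine MvPolynomial.algHom_ext fun j => ?_
      rw [AlgHom.comp_apply, MvPolynomial.aeval_X, hΦ, MvPolynomial.aeval_X]
      exact hv j
    exact congrArg (fun F => F p) this
  -- Every Ω(b_i) is a polynomial in the first row. As the Ω(b_i) are independent, this says that
  -- the endomorphism expressing the row through them reaches every variable.
  have hsurj : Function.Surjective (MvPolynomial.aeval v :
      MvPolynomial (Fin n) (RD n) →ₐ[RD n] MvPolynomial (Fin n) (RD n)) := by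
    rw [← AlgHom.range_eq_top, eq_top_iff, ← MvPolynomial.adjoin_range_X, Algebra.adjoin_le_iff]
    rintro _ ⟨i, rfl⟩
    obtain ⟨p, hp⟩ := hdiag i
    refine ⟨p, aeval_Om_injective n ?_⟩
    rw [MvPolynomial.aeval_X]
    exact (hcomp p).trans hp
  have hinj := RingHom.injective_of_surjective_of_isNoetherianRing
    (MvPolynomial.aeval v : MvPolynomial (Fin n) (RD n) →ₐ[RD n] _).toRingHom hsurj
  intro p q hpq
  rw [← hcomp, ← hcomp] at hpq
  exact hinj (aeval_Om_injective n hpq)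

/-- The homomorphism `R(T)[x_1, …, x_n] → 𝒪(𝒵)`, `x_j ↦ z_{1j}`. -/
def rowHom : MvPolynomial (Fin n) (RT n) →ₐ[RT n] OZ n := MvPolynomial.aeval fun j => zz n 0 j

/-- Every function is a fraction of polynomials in the first row: before the localization the row
generates everything, including the denominators. -/
lemma exists_rowHom_mul (f : OZ n) :
    ∃ p s, IsUnit (rowHom n s) ∧ rowHom n s * f = rowHom n p := by
  have key (p : MvPolynomial (Fin n) (RT n)) : rowHom n p =
      algebraMap (QZ n) (OZ n) (MvPolynomial.aeval (fun j => mkQZ n (matX n 0 j)) p) := by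
    have : rowHom n = (IsScalarTower.toAlgHom (RT n) (QZ n) (OZ n)).comp
        (MvPolynomial.aeval (fun j => mkQZ n (matX n 0 j))) := by
      refine MvPolynomial.algHom_ext fun j => ?_
      rw [rowHom, MvPolynomial.aeval_X, AlgHom.comp_apply, MvPolynomial.aeval_X]
      rfl
    exact congrArg (fun F => F p) this
  obtain ⟨q, s, rfl⟩ := IsLocalization.exists_mk'_eq (diagSet n) f
  obtain ⟨p, rfl⟩ := aeval_row_surjective n q
  obtain ⟨t, ht⟩ := aeval_row_surjective n (s : QZ n)
  refine ⟨p, t, ?_, ?_⟩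
  · rw [key, ht]
    exact IsLocalization.map_units (OZ n) s
  · rw [key, key, ht]
    exact IsLocalization.mk'_spec' _ _ _

lemma betaD_rowHom (p : MvPolynomial (Fin n) (RT n)) : betaD n (rowHom n p) =
    MvPolynomial.aeval (fun j => betaD n (zz n 0 j))
      (MvPolynomial.map (algebraMap (RT n) (RD n)) p) := by
  rw [MvPolynomial.aeval_map_algebraMap, rowHom, MvPolynomial.comp_aeval_apply]

/-- After clearing denominators, f = 0 follows from the algebraic independence of the images of the
first row. -/
lemma betaD_injective : Function.Injective (betaD n) := by
  refine (injective_iff_map_eq_zero _).2 fun f hf => ?_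
  obtain ⟨p, s, hs, hp⟩ := exists_rowHom_mul n f
  have h := congrArg (betaD n) hp
  rw [map_mul, hf, mul_zero, betaD_rowHom, eq_comm,
    map_eq_zero_iff _ (aeval_row_injective n),
    map_eq_zero_iff _ (MvPolynomial.map_injective _ (algebraMap_RD_injective n))] at h
  rw [h, map_zero] at hp
  exact (hs.mul_right_eq_zero).1 hp

variable {n} in
omit [NeZero n] in
-- For a fixed monomial in y, a relation is a relation between the series in y'; its coefficients
-- vanish, and as the monomial varies they form relations between the series in y.
lemma linearIndependent_renameL_mul_renameR {ι : Type*} {g : ι → SymSer (RD n)}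
    (hg : LinearIndependent (RD n) g) : LinearIndependent (RD n) fun p : ι × ι =>
      renameL n (toSeries (RT n) (g p.1)) * renameR n (toSeries (RT n) (g p.2)) := by
  classical
  rw [linearIndependent_iff''] at hg ⊢
  intro s c hc h
  -- The support is enlarged to a rectangle, with zero coefficients, so that the double sum can be
  -- iterated.
  set s₁ := s.image Prod.fst with hs₁
  set s₂ := s.image Prod.snd with hs₂
  have hsub : s ⊆ s₁ ×ˢ s₂ := fun p hp => Finset.mem_product.2
    ⟨Finset.mem_image_of_mem _ hp, Finset.mem_image_of_mem _ hp⟩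
  have hc' (a b : ι) (hab : a ∉ s₁ ∨ b ∉ s₂) : c (a, b) = 0 := hc _ fun hp => by
    have := Finset.mem_product.1 (hsub hp)
    tauto
  rw [Finset.sum_subset hsub fun p _ hp => by rw [hc p hp, zero_smul]] at h
  have h1 (d : ℕ →₀ ℕ) (b : ι) :
      ∑ a ∈ s₁, c (a, b) * MvPowerSeries.coeff d (toSeries (RT n) (g a)) = 0 := by
    refine hg s₂ (fun b => ∑ a ∈ s₁, c (a, b) * MvPowerSeries.coeff d (toSeries (RT n) (g a)))
      (fun b hb => Finset.sum_eq_zero fun a _ => by rw [hc' a b (Or.inr hb), zero_mul]) ?_ b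
    refine Subtype.ext ?_
    ext d'
    have h2 := congrArg (MvPowerSeries.coeff (pairIdx d d')) h
    simp only [map_sum, map_smul, coeff_renameL_mul_renameR, map_zero, Finset.sum_product_right,
      smul_eq_mul] at h2
    change MvPowerSeries.coeff d' (toSeries (RD n) (∑ b ∈ s₂,
      (∑ a ∈ s₁, c (a, b) * MvPowerSeries.coeff d (toSeries (RT n) (g a))) • g b)) = 0
    rw [map_sum, map_sum, ← h2]
    refine Finset.sum_congr rfl fun b _ => ?_
    rw [map_smul, map_smul, smul_eq_mul, Finset.sum_mul]
    exact Finset.sum_congr rfl fun a _ => mul_assoc _ _ _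
  rintro ⟨a, b⟩
  refine hg s₁ (fun a => c (a, b)) (fun a ha => hc' a b (Or.inl ha)) ?_ a
  refine Subtype.ext ?_
  ext d
  change MvPowerSeries.coeff d (toSeries (RD n) (∑ a ∈ s₁, c (a, b) • g a)) = 0
  rw [map_sum, map_sum, ← h1 d b]
  exact Finset.sum_congr rfl fun a _ => by rw [map_smul, map_smul, smul_eq_mul]; rfl

/-- The map `f ⊗ g ↦ f(y) g(y')` on `𝒪(𝒵) ⊗ 𝒪(𝒵)`. -/
def pairSeries : OZ n ⊗[RT n] OZ n →ₐ[RT n] MvPowerSeries (ℕ ⊕ ℕ) (RD n) :=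
  Algebra.TensorProduct.productMap (((renameL n).comp (toSeries (RT n))).comp (betaD n))
    (((renameR n).comp (toSeries (RT n))).comp (betaD n))

lemma exists_map_rowHom_mul (x : OZ n ⊗[RT n] OZ n) :
    ∃ p s, IsUnit (Algebra.TensorProduct.map (rowHom n) (rowHom n) s) ∧
      Algebra.TensorProduct.map (rowHom n) (rowHom n) s * x =
        Algebra.TensorProduct.map (rowHom n) (rowHom n) p := by
  induction x with
  | zero => exact ⟨0, 1, by rw [map_one]; exact isUnit_one, by rw [mul_zero, map_zero]⟩
  | tmul f g =>
    obtain ⟨p, s, hs, h⟩ := exists_rowHom_mul n f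
    obtain ⟨q, t, ht, h'⟩ := exists_rowHom_mul n g
    refine ⟨p ⊗ₜ q, s ⊗ₜ t, ?_, ?_⟩
    · rw [Algebra.TensorProduct.map_tmul]
      have : rowHom n s ⊗ₜ[RT n] rowHom n t =
          (rowHom n s ⊗ₜ[RT n] (1 : OZ n)) * ((1 : OZ n) ⊗ₜ[RT n] rowHom n t) := by
        rw [Algebra.TensorProduct.tmul_mul_tmul, mul_one, one_mul]
      rw [this]
      exact (hs.map (Algebra.TensorProduct.includeLeft : OZ n →ₐ[RT n] OZ n ⊗[RT n] OZ n)).mul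
        (ht.map (Algebra.TensorProduct.includeRight : OZ n →ₐ[RT n] OZ n ⊗[RT n] OZ n))
    · rw [Algebra.TensorProduct.map_tmul, Algebra.TensorProduct.tmul_mul_tmul, h, h',
        Algebra.TensorProduct.map_tmul]
  | add x y hx hy =>
    obtain ⟨p, s, hs, h⟩ := hx
    obtain ⟨q, t, ht, h'⟩ := hy
    refine ⟨t * p + s * q, s * t, by rw [map_mul]; exact hs.mul ht, ?_⟩
    rw [map_add, map_mul, map_mul, map_mul, ← h, ← h']
    ring

/-- On polynomials in the first row, pairs of monomials form a basis and go to products of linearly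
independent series. Denominators are cleared as for `betaD_injective`. -/
lemma pairSeries_injective : Function.Injective (pairSeries n) := by
  have hinj : Function.Injective ((pairSeries n).comp
      (Algebra.TensorProduct.map (rowHom n) (rowHom n))) := by
    let b := MvPolynomial.basisMonomials (Fin n) (RT n)
    refine (LinearMap.injective_of_linearIndependent (v := b.tensorProduct b)
      (f := ((pairSeries n).comp
        (Algebra.TensorProduct.map (rowHom n) (rowHom n))).toLinearMap) ?_ ?_)
    · exact (b.tensorProduct b).span_eq
    · have hli : LinearIndependent (RD n) fun m => betaD n (rowHom n (b m)) := by
        have h := (MvPolynomial.basisMonomials (Fin n) (RD n)).linearIndependent.map'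
          (MvPolynomial.aeval (fun j => betaD n (zz n 0 j)) :
            MvPolynomial (Fin n) (RD n) →ₐ[RD n] SymSer (RD n)).toLinearMap
          (LinearMap.ker_eq_bot.2 (aeval_row_injective n))
        convert! h using 1
        ext1 m
        rw [betaD_rowHom, MvPolynomial.coe_basisMonomials, MvPolynomial.map_monomial, map_one]
        simp [MvPolynomial.coe_basisMonomials]
      have h2 := (linearIndependent_renameL_mul_renameR hli).restrict_scalars (R := RT n)
        (fun r s h => algebraMap_RD_injective n (by
          rwa [Algebra.algebraMap_eq_smul_one, Algebra.algebraMap_eq_smul_one]))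
      convert! h2 using 1
      ext1 m
      have e : b.tensorProduct b m = b m.1 ⊗ₜ b m.2 := Module.Basis.tensorProduct_apply' b b m
      simp only [Function.comp_apply, AlgHom.toLinearMap_apply, AlgHom.comp_apply, e,
        Algebra.TensorProduct.map_tmul, pairSeries, Algebra.TensorProduct.productMap_apply_tmul]
  refine (injective_iff_map_eq_zero _).2 fun x hx => ?_
  obtain ⟨p, s, hs, hp⟩ := exists_map_rowHom_mul n x
  have h := congrArg (pairSeries n) hp
  rw [map_mul, hx, mul_zero] at h
  have hp0 : p = 0 := hinj (by rw [AlgHom.comp_apply, ← h, map_zero])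
  rw [hp0, map_zero] at hp
  exact (hs.mul_right_eq_zero).1 hp

end injectivity

/-! ### The isomorphism and the 𝕂-module structure -/

section module

variable (n : ℕ) [NeZero n]

/-- The isomorphism `𝒪(𝒵) ≅ Λ̂_(n)`. -/
def betaEquiv : OZ n ≃ₐ[RT n] LambdaN n :=
  AlgEquiv.ofBijective
    ((betaD n).codRestrict (LambdaN n) fun f => range_betaD n ▸ (betaD n).mem_range_self f) <| by
    constructor
    · intro f g h
      exact betaD_injective n (congrArg Subtype.val h)
    · rintro ⟨g, hg⟩
      obtain ⟨f, hf⟩ : g ∈ (betaD n).range := range_betaD n ▸ hg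
      exact ⟨f, Subtype.ext hf⟩

lemma coe_betaEquiv (f : OZ n) : (betaEquiv n f : SymSer (RD n)) = betaD n f := rfl

/-- The `𝕂`-module structure of `𝒪(𝒵)` that is transported from `Λ̂_(n)`. -/
@[reducible]
def moduleOZ : Module (KK n) (OZ n) where
  smul x f := (betaEquiv n).symm (x • betaEquiv n f)
  one_smul f := by
    change (betaEquiv n).symm ((1 : KK n) • betaEquiv n f) = f
    rw [one_smul, AlgEquiv.symm_apply_apply]
  mul_smul x y f := by
    change (betaEquiv n).symm ((x * y) • betaEquiv n f) =
      (betaEquiv n).symm (x • betaEquiv n ((betaEquiv n).symm (y • betaEquiv n f)))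
    rw [AlgEquiv.apply_symm_apply, mul_smul]
  smul_zero x := by
    change (betaEquiv n).symm (x • betaEquiv n 0) = 0
    rw [map_zero, smul_zero, map_zero]
  smul_add x f g := by
    change (betaEquiv n).symm (x • betaEquiv n (f + g)) =
      (betaEquiv n).symm (x • betaEquiv n f) + (betaEquiv n).symm (x • betaEquiv n g)
    rw [map_add, smul_add, map_add]
  add_smul x y f := by
    change (betaEquiv n).symm ((x + y) • betaEquiv n f) =
      (betaEquiv n).symm (x • betaEquiv n f) + (betaEquiv n).symm (y • betaEquiv n f)
    rw [add_smul, map_add]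
  zero_smul f := by
    change (betaEquiv n).symm ((0 : KK n) • betaEquiv n f) = 0
    rw [zero_smul, map_zero]

lemma sRefl_smul_sym {i : Fin n} (hi : i ≠ 0) (f : SymSer (RD n)) :
    grp (sRefl n i) • f = permSym (Equiv.swap (i - 1) i) f := by
  rw [sRefl, if_neg hi, finW_smul_sym]

lemma sub_one_lt {i : Fin n} (hi : i ≠ 0) : i - 1 < i :=
  Fin.lt_def.2 (by have := val_sub_one_add_one n hi; omega)

lemma permSym_betaD_other {i : Fin n} (hi : i ≠ 0) {j l : Fin n} (hjl : j ≤ l) (hl : l ≠ i - 1)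
    (hj : j ≠ i) :
    permSym (Equiv.swap (i - 1) i) (betaD n (zz n j l)) = betaD n (zz n j l) := by
  rw [betaD_zz hjl, permSym_extSym_hSet, map_swap_Icc_other (val_sub_one_add_one n hi) hl hj]

lemma permSym_betaD_col {i : Fin n} (hi : i ≠ 0) {j : Fin n} (hj : j ≤ i - 1) :
    permSym (Equiv.swap (i - 1) i) (betaD n (zz n j (i - 1))) =
      betaD n (zz n j (i - 1) + (bb i - bb (i - 1) : RT n) • zz n j i) := by
  rw [map_add, map_smul, betaD_zz hj, betaD_zz (hj.trans (sub_one_lt n hi).le),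
    permSym_extSym_hSet, map_swap_Icc_col (val_sub_one_add_one n hi) hj]

lemma permSym_betaD_row {i : Fin n} (hi : i ≠ 0) {l : Fin n} (hl : i ≤ l) :
    permSym (Equiv.swap (i - 1) i) (betaD n (zz n i l)) =
      betaD n (zz n i l - (bb i - bb (i - 1) : RT n) • zz n (i - 1) l) := by
  rw [map_sub, map_smul, betaD_zz hl, betaD_zz ((sub_one_lt n hi).le.trans hl),
    permSym_extSym_hSet, map_swap_Icc_row (val_sub_one_add_one n hi) hl]

omit [NeZero n] in
lemma permSym_betaD_diag (σ : Equiv.Perm (Fin n)) (i : Fin n) :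
    permSym σ (betaD n (zz n i i)) = betaD n (zz n (σ i) (σ i)) := by
  rw [betaD_diag, permSym_Om, betaD_diag]

/-- Each prescribed formula is checked after applying the injective `betaD`, where s_i permutes the
coefficients and t_{ε_i} multiplies by Ω(b_i|y). -/
lemma isKModuleOZ_moduleOZ : IsKModuleOZ n (moduleOZ n) := by
  let _ := moduleOZ n
  have key (x : KK n) (f g : OZ n) (h : (x : KD n) • betaD n f = betaD n g) : x • f = g := by
    change (betaEquiv n).symm (x • betaEquiv n f) = g
    rw [AlgEquiv.symm_apply_eq]
    exact Subtype.ext h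
  have hsmul (x : KK n) (f : OZ n) : betaD n (x • f) = (x : KD n) • betaD n f := by
    change (betaEquiv n ((betaEquiv n).symm (x • betaEquiv n f)) : SymSer (RD n)) = _
    rw [AlgEquiv.apply_symm_apply]
    rfl
  have hrefl (i : Fin n) (hi : i ≠ 0) (f : OZ n) : betaD n (grpK n (sRefl n i) • f) =
      permSym (Equiv.swap (i - 1) i) (betaD n f) :=
    (hsmul _ _).trans (sRefl_smul_sym n hi _)
  have hrefl' (i : Fin n) (hi : i ≠ 0) (f g : OZ n)
      (h : permSym (Equiv.swap (i - 1) i) (betaD n f) = betaD n g) :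
      grpK n (sRefl n i) • f = g :=
    betaD_injective n ((hrefl i hi f).trans h)
  constructor
  · intro r f
    refine key _ _ _ ?_
    change coef (algebraMap (RT n) (RD n) r) • betaD n f = _
    rw [coef_smul, algebraMap_smul, map_smul]
  · intro i hi f g
    refine hrefl' i hi _ _ ?_
    rw [map_mul, map_mul, map_mul, hrefl i hi, hrefl i hi]
  · intro i hi
    refine hrefl' i hi _ _ ?_
    rw [map_one, map_one]
  · intro i hi j l hjl hl hj
    exact hrefl' i hi _ _ (permSym_betaD_other n hi hjl hl hj)
  · intro i hi
    refine hrefl' i hi _ _ ?_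
    rw [permSym_betaD_diag, Equiv.swap_apply_left]
  · intro i hi
    refine hrefl' i hi _ _ ?_
    rw [permSym_betaD_diag, Equiv.swap_apply_right]
  · intro i hi j hj
    exact hrefl' i hi _ _ (permSym_betaD_col n hi hj.le)
  · intro i hi l hl
    exact hrefl' i hi _ _ (permSym_betaD_row n hi hl.le)
  · intro i f
    refine key _ _ _ ?_
    change grp (tr (Pi.single i 1)) • betaD n f = _
    rw [tr_single_smul_sym, map_mul, betaD_diag]

lemma grpK_mul (w v : AffW n) : grpK n (w * v) = grpK n w * grpK n v :=
  Subtype.ext (grp_mul w v).symm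

/-- This identity holds inside 𝕂, so in any 𝕂-module the action of s_i determines that of T_i up to
c(α_i)-torsion. -/
lemma coefK_mul_TT {i : Fin n} (hi : i ≠ 0) :
    coefK n (cc (aa (i - 1) - aa i)) * ⟨TT n i, TT_mem n i⟩ = grpK n (sRefl n i) - 1 := by
  refine Subtype.ext ?_
  change coef (algebraMap (RT n) (RD n) (cc (root n i))) * TT n i = grp (sRefl n i) - 1
  have hu : IsUnit (algebraMap (RT n) (RD n) (cc (root n i))) :=
    isUnit_cc (sub_one_ne_of_ne_zero n hi)
  rw [TT, ← mul_assoc, coef_mul, Ring.mul_inverse_cancel _ hu, coef_one, one_mul]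

variable {n} in
-- Both sides are ring homomorphisms in f, so it suffices to compare them on scalars and on the
-- z_jl, where the prescribed formulas apply.
lemma IsKModuleOZ.betaD_sRefl_smul {m : Module (KK n) (OZ n)} (hm : IsKModuleOZ n m) {i : Fin n}
    (hi : i ≠ 0) (f : OZ n) :
    betaD n (grpK n (sRefl n i) • f) = permSym (Equiv.swap (i - 1) i) (betaD n f) := by
  let F : OZ n →+* SymSer (RD n) :=
    { toFun := fun f => betaD n (grpK n (sRefl n i) • f)
      map_one' := by rw [hm.refl_one i hi, map_one]
      map_mul' := fun f g => by rw [hm.refl_mul i hi, map_mul]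
      map_zero' := by rw [smul_zero, map_zero]
      map_add' := fun f g => by rw [smul_add, map_add] }
  have h : F = (permSym (Equiv.swap (i - 1) i)).comp (betaD n : OZ n →+* SymSer (RD n)) := by
    refine OZ_ringHom_ext (fun r => ?_) fun j l hjl => ?_
    · change betaD n (grpK n (sRefl n i) • algebraMap (RT n) (OZ n) r) =
        permSym (Equiv.swap (i - 1) i) (betaD n (algebraMap (RT n) (OZ n) r))
      -- The action of s_i on scalars is not among the prescribed properties; it follows from this
      -- commutation rule and s_i(1) = 1.
      have hcomm : grpK n (sRefl n i) * coefK n r =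
          coefK n (Equiv.swap (i - 1) i • r) * grpK n (sRefl n i) := by
        refine Subtype.ext ?_
        change grp (sRefl n i) * coef (algebraMap (RT n) (RD n) r) =
          coef (algebraMap (RT n) (RD n) (Equiv.swap (i - 1) i • r)) * grp (sRefl n i)
        rw [sRefl, if_neg hi, grp_coef, finW_smul, perm_smul_algebraMap]
      rw [Algebra.algebraMap_eq_smul_one, ← hm.coef_smul, ← mul_smul, hcomm, mul_smul,
        hm.refl_one i hi, hm.coef_smul, hm.coef_smul, map_smul, map_smul, map_one, permSym_smul',
        map_one]
    · change betaD n (grpK n (sRefl n i) • zz n j l) =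
        permSym (Equiv.swap (i - 1) i) (betaD n (zz n j l))
      by_cases hl : l = i - 1
      · subst hl
        rcases hjl.eq_or_lt with rfl | hj
        · rw [hm.refl_diag i hi, permSym_betaD_diag, Equiv.swap_apply_left]
        · rw [hm.refl_col i hi j hj, permSym_betaD_col n hi hjl]
      by_cases hj : j = i
      · subst hj
        rcases hjl.eq_or_lt with rfl | hl'
        · rw [hm.refl_diag' j hi, permSym_betaD_diag, Equiv.swap_apply_right]
        · rw [hm.refl_row j hi l hl', permSym_betaD_row n hi hjl]
      · rw [hm.refl_other i hi j l hjl hl hj, permSym_betaD_other n hi hjl hl hj]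
  exact congrArg (fun G => G f) h

variable {n} in
-- The cocharacters for which this holds form a subgroup, and it contains the ε_i.
lemma IsKModuleOZ.betaD_tr_smul {m : Module (KK n) (OZ n)} (hm : IsKModuleOZ n m)
    (mu : Fin n → ℤ) (f : OZ n) :
    betaD n (grpK n (tr mu) • f) = grp (tr mu) • betaD n f := by
  have hadd (mu nu : Fin n → ℤ) : (tr (mu + nu) : AffW n) = tr mu * tr nu :=
    map_mul SemidirectProduct.inl _ _
  have hzero (f : OZ n) : grpK n (tr 0) • f = f := one_smul (KK n) f
  have hzero' (f : SymSer (RD n)) : grp (tr (0 : Fin n → ℤ)) • f = f := one_smul (KD n) f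
  let H : AddSubgroup (Fin n → ℤ) :=
    { carrier := {mu | ∀ f : OZ n, betaD n (grpK n (tr mu) • f) = grp (tr mu) • betaD n f}
      add_mem' := fun {mu nu} h h' f => by
        rw [hadd, grpK_mul, mul_smul, h, h', ← grp_mul, mul_smul]
      zero_mem' := fun f => by rw [hzero, hzero']
      neg_mem' := fun {mu} h f => by
        have h1 := h (grpK n (tr (-mu)) • f)
        rw [← mul_smul, ← grpK_mul, ← hadd, add_neg_cancel, hzero] at h1
        rw [h1, ← mul_smul, grp_mul, ← hadd, neg_add_cancel, hzero'] }
  have hs (i : Fin n) : (Pi.single i 1 : Fin n → ℤ) ∈ H := fun f => by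
    rw [hm.trans_smul, map_mul, tr_single_smul_sym, betaD_diag]
  have : mu ∈ H := by
    rw [pi_eq_sum_univ' mu]
    refine sum_mem fun i _ => H.zsmul_mem ?_ _
    convert hs i using 1
  exact this f

variable {n} in
lemma IsKModuleOZ.betaD_smul {m : Module (KK n) (OZ n)} (hm : IsKModuleOZ n m) (x : KK n)
    (f : OZ n) : betaD n (x • f) = (x : KD n) • betaD n f := by
  refine KK_induction n
    (P := fun x => ∀ (hx : x ∈ KK n) (f : OZ n), betaD n ((⟨x, hx⟩ : KK n) • f) = x • betaD n f)
    ?_ ?_ ?_ ?_ ?_ x x.2 x.2 f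
  · intro r hr f
    exact (congrArg (betaD n) (hm.coef_smul r f)).trans
      (by rw [map_smul, CentralizerFamily.coef_smul, algebraMap_smul])
  · intro i hi hT f
    -- It is enough to verify the equation multiplied by c(α_i), which is the known statement for
    -- s_i; `TT_smul_eq` divides by c(α_i) in R(T)^Δ.
    refine (TT_smul_eq n hi _ _ ?_).symm
    rw [← hm.betaD_sRefl_smul hi, ← map_smul, ← hm.coef_smul, ← mul_smul, coefK_mul_TT n hi,
      sub_smul, one_smul, map_sub, add_sub_cancel]
  · intro w hw f
    have hfin (σ : Equiv.Perm (Fin n)) : ∀ f : OZ n,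
        betaD n (grpK n (finW σ) • f) = grp (finW σ) • betaD n f := by
      induction σ using finW_induction n with
      | hs i hi =>
        intro f
        have := hm.betaD_sRefl_smul hi f
        rw [← sRefl_smul_sym n hi, sRefl, if_neg hi] at this
        exact this
      | h1 =>
        intro f
        have h1 : grpK n (finW 1) • f = f := one_smul (KK n) f
        have h2 : grp (finW (1 : Equiv.Perm (Fin n))) • betaD n f = betaD n f :=
          one_smul (KD n) _
        rw [h1, h2]
      | hmul σ σ' h h' =>
        intro f
        rw [finW_mul, grpK_mul, mul_smul, h, h', ← grp_mul, mul_smul]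
    change betaD n (grpK n w • f) = _
    rw [aff_eq_tr_mul_finW n w, grpK_mul, mul_smul, hm.betaD_tr_smul, hfin, ← grp_mul, mul_smul]
  · intro x hx y hy h h' _ f
    rw [add_smul, ← h hx, ← h' hy, ← map_add, ← add_smul]
    rfl
  · intro x hx y hy h h' _ f
    rw [mul_smul, ← h' hy, ← h hx, ← mul_smul]
    rfl

variable {n} in
lemma IsKModuleOZ.betaEquiv_smul {m : Module (KK n) (OZ n)} (hm : IsKModuleOZ n m) (x : KK n)
    (f : OZ n) : betaEquiv n (x • f) = x • betaEquiv n f :=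
  Subtype.ext (hm.betaD_smul x f)

/-- Any admissible structure is intertwined by the same bijection with the fixed module Λ̂_(n), so
there is only one. -/
lemma existsUnique_isKModuleOZ : ∃! m : Module (KK n) (OZ n), IsKModuleOZ n m := by
  refine ⟨moduleOZ n, isKModuleOZ_moduleOZ n, fun m hm => ?_⟩
  refine Module.ext' _ _ fun x f => (betaEquiv n).injective ?_
  rw [hm.betaEquiv_smul]
  exact ((isKModuleOZ_moduleOZ n).betaEquiv_smul x f).symm

end module

/-! ### Compatibility with the coproduct and the counit -/

section hopf

variable (n : ℕ)

lemma tensorSeries_map_betaEquiv [NeZero n] (x : OZ n ⊗[RT n] OZ n) :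
    tensorSeries n (Algebra.TensorProduct.map (betaEquiv n : OZ n →ₐ[RT n] LambdaN n)
      (betaEquiv n : OZ n →ₐ[RT n] LambdaN n) x) = pairSeries n x := by
  have : (tensorSeries n).comp (Algebra.TensorProduct.map
      (betaEquiv n : OZ n →ₐ[RT n] LambdaN n) (betaEquiv n : OZ n →ₐ[RT n] LambdaN n)) =
      pairSeries n := by
    refine Algebra.TensorProduct.ext' fun f g => ?_
    simp only [AlgHom.comp_apply, Algebra.TensorProduct.map_tmul, tensorSeries, pairSeries,
      Algebra.TensorProduct.productMap_apply_tmul]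
    rfl
  exact congrArg (fun F => F x) this

lemma tensorSeries_injective [NeZero n] : Function.Injective (tensorSeries n) := by
  intro x y h
  obtain ⟨x, rfl⟩ := (Algebra.TensorProduct.congr (betaEquiv n) (betaEquiv n)).surjective x
  obtain ⟨y, rfl⟩ := (Algebra.TensorProduct.congr (betaEquiv n) (betaEquiv n)).surjective y
  have h' : pairSeries n x = pairSeries n y := by
    rw [← tensorSeries_map_betaEquiv, ← tensorSeries_map_betaEquiv]
    exact h
  rw [pairSeries_injective n h']

lemma comulOZ_diag (n : ℕ) (i : Fin n) :
    comulOZ n (zz n i i) = zz n i i ⊗ₜ[RT n] zz n i i := by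
  refine (liftOZ_zz _ _ _ _ i i).trans ?_
  rw [mulMat, Matrix.mul_apply, Finset.sum_eq_single i]
  · simp only [Matrix.map_apply, Algebra.TensorProduct.includeLeft_apply,
      Algebra.TensorProduct.includeRight_apply, Algebra.TensorProduct.tmul_mul_tmul, mul_one,
      one_mul]
  · intro k _ hk
    rw [Matrix.map_apply, Matrix.map_apply]
    rcases lt_or_gt_of_ne hk with hk | hk
    · rw [zz_lower hk, map_zero, zero_mul]
    · rw [zz_lower hk, map_zero, mul_zero]
  · simp

/-- Both sides are algebra maps to an R(T)^Δ-algebra, so it suffices to compare them on the z_ii.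
There z_ii is group-like for matrix multiplication and Ω(b_i|y) is group-like for f(y) ↦ f(y, y').
-/
lemma coprodSym_betaD (f : OZ n) : coprodSym (betaD n f) = pairSeries n (comulOZ n f) := by
  have : (coprodHom n).comp (betaD n) = (pairSeries n).comp (comulOZ n) := by
    refine OZ_algHom_ext fun i => ?_
    rw [AlgHom.comp_apply, AlgHom.comp_apply, comulOZ_diag, pairSeries,
      Algebra.TensorProduct.productMap_apply_tmul, betaD_diag, coprodHom_apply,
      (Om_mem_groupLike _).1]
    simp only [AlgHom.comp_apply, betaD_diag]
  exact congrArg (fun F => F f) this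

/-- Again only the z_ii matter, and both sides send them to 1. -/
lemma constantCoeff_betaD (f : OZ n) : MvPowerSeries.constantCoeff (toSeries (RD n) (betaD n f)) =
    algebraMap (RT n) (RD n) (counitOZ n f) := by
  have hC (r : RT n) : MvPowerSeries.constantCoeff (toSeries (RD n)
      (algebraMap (RT n) (SymSer (RD n)) r)) = algebraMap (RT n) (RD n) r := by
    rw [IsScalarTower.algebraMap_apply (RT n) (RD n) (SymSer (RD n)), AlgHom.commutes]
    exact MvPowerSeries.constantCoeff_C _
  let F : OZ n →ₐ[RT n] RD n :=
    { ((MvPowerSeries.constantCoeff (R := RD n) (σ := ℕ)).comp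
        (toSeries (RD n)).toRingHom).comp (betaD n : OZ n →+* SymSer (RD n)) with
      commutes' := fun r => by
        change MvPowerSeries.constantCoeff (toSeries (RD n) (betaD n (algebraMap _ _ r))) = _
        rw [AlgHom.commutes, hC] }
  have : F = (Algebra.ofId (RT n) (RD n)).comp (counitOZ n) := by
    refine OZ_algHom_ext fun i => ?_
    rw [AlgHom.comp_apply, counitOZ, liftOZ_zz, Matrix.one_apply_eq, map_one]
    change MvPowerSeries.constantCoeff (toSeries (RD n) (betaD n (zz n i i))) = 1
    rw [betaD_diag]
    exact (Om_mem_groupLike _).2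
  exact congrArg (fun F => F f) this

/-- The isomorphism factors through `betaR`, which takes values in series over R(T). -/
lemma exists_mapSym_eq [NeZero n] (f : LambdaN n) : ∃ g : SymSer (RT n),
    mapSym (algebraMap (RT n) (RD n)) g = (f : SymSer (RD n)) := by
  obtain ⟨f, rfl⟩ := (betaEquiv n).surjective f
  exact ⟨betaR n f, rfl⟩

end hopf

end

end CentralizerFamily

open CentralizerFamily
open scoped TensorProduct

/-- The coordinate ring `𝒪(𝒵)` of the centralizer family of `GL_n` is isomorphic to `Λ̂_(n)` as an
`R(T)`-algebra (and Hopf algebra) and as a `𝕂`-module. -/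
theorem theorem4 (n : ℕ) [NeZero n] :
    -- the action of `𝕂` on the coordinate ring is well defined
    (∃! m : Module (KK n) (OZ n), IsKModuleOZ n m) ∧
    -- the series in `Λ̂_(n)` have coefficients in `R(T)`
    (∀ f : LambdaN n, ∃ g : SymSer (RT n),
      mapSym (algebraMap (RT n) (RD n)) g = (f : SymSer (RD n))) ∧
    -- the isomorphism of `R(T)`-algebras
    ∃ β : OZ n ≃ₐ[RT n] LambdaN n,
      -- its values on the coordinate functions
      (∀ i j : Fin n, i ≤ j → (β (zz n i j) : SymSer (RD n)) =
        hhat (j.val - i.val) (fun k : Finset.Icc i j => bD k.val)) ∧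
      (∀ i j : Fin n, i ≤ j →
        hhat (j.val - i.val) (fun k : Finset.Icc i j => (bD k.val : RD n)) =
          (ex (∑ k ∈ Finset.Ico i j, aa k) : RT n) •
            (Om (bD i) * rotPow n (i.val + 1) (gRho n (j.val - i.val)))) ∧
      (∀ i : Fin n, (β (zz n i i) : SymSer (RD n)) = Om (bD i)) ∧
      -- it is an isomorphism of `𝕂`-modules
      (∀ m : Module (KK n) (OZ n), IsKModuleOZ n m →
        ∀ (x : KK n) (f : OZ n), β (x • f) = x • β f) ∧
      -- the coproduct and the counit of symmetric series restrict to `Λ̂_(n)`, and `β` is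
      -- compatible with them
      Function.Injective (tensorSeries n) ∧
      (∀ f : OZ n, coprodSym (β f : SymSer (RD n)) =
        tensorSeries n (Algebra.TensorProduct.map (β : OZ n →ₐ[RT n] LambdaN n)
          (β : OZ n →ₐ[RT n] LambdaN n) (comulOZ n f))) ∧
      (∀ f : OZ n, MvPowerSeries.constantCoeff (toSeries (RD n) (β f : SymSer (RD n))) =
        algebraMap (RT n) (RD n) (counitOZ n f)) := by
  refine ⟨existsUnique_isKModuleOZ n, exists_mapSym_eq n, betaEquiv n, fun i j hij => ?_,
    fun i j hij => ?_, fun i => betaD_diag i, fun m hm => hm.betaEquiv_smul,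
    tensorSeries_injective n, fun f => ?_, constantCoeff_betaD n⟩
  · rw [coe_betaEquiv, betaD_zz hij]
    exact mapSym_algebraMap_hSet i j hij
  · rw [← mapSym_algebraMap_hSet i j hij]
    exact extSym_hSet_eq_gRho n i j hij
  · rw [tensorSeries_map_betaEquiv]
    exact coprodSym_betaD n f
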